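/- **Definitions.** All manifolds are complex. An *F-manifold* is a triple $(M,\circ,e)$, where $M$ is a connected complex manifold of dimension $\ge 1$, $\circ$ is a commutative and associative $\mathcal O_M$-bilinear multiplication $\mathcal T_M\times\mathcal T_M\to\mathcal T_M$ on the sheaf of holomorphic vector fields, $e$ is a global holomorphic unit field, and $$\mathrm{Lie}_{X\circ Y}(\circ)=X\circ \mathrm{Lie}_Y(\circ)+Y\circ\mathrm{Lie}_X(\circ)$$ for all local holomorphic vector fields $X,Y$; here $\mathrm{Lie}_X(\circ)(Z,W)=[X,Z\circ W]-[X,Z]\circ W-Z\circ[X,W]$. An *Euler field of weight* $d\in\mathbb C$ is a holomorphic vector field $E$ with $\mathrm{Lie}_E(\circ)=d\cdot\circ$. The *product* of F-manifolds $(M_k,\circ_k,e_k)$ is $(\prod_k M_k,\bigoplus_k\circ_k,\sum_k e_k)$. A germ of an F-manifold is *irreducible* if it is not isomorphic to a product of two germs of F-manifolds (each of dimension $\ge 1$). The *eigenspace decomposition* $T_pM=\bigoplus_{k=1}^l (T_pM)_k$ is the simultaneous decomposition into generalized eigenspaces of the multiplication endomorphisms $a\circ$, $a\in T_pM$; the point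 $p$ is *semisimple* if all $(T_pM)_k$ have dimension $1$. **Theorem 4.2.** Let $(M,p)$ be the germ at $p$ of an F-manifold $(M,\circ,e)$, with eigenspace decomposition $T_pM=\bigoplus_{k=1}^l (T_pM)_k$. 1. There is a decomposition $(M,p)\cong\prod_{k=1}^l(M_k,p_k)$ of $(M,p)$ into a product of germs of F-manifolds, compatible with multiplications and unit fields, which extends the eigenspace decomposition: the tangent space $T_{p_k}M_k$ of the $k$-th factor corresponds to $(T_pM)_k$. It is unique: for any other such decomposition $(M,p)\cong\prod_{k=1}^l(M'_k,p'_k)$ extending the eigenspace decomposition there are isomorphisms of germs of F-manifolds $\psi_k:(M_k,p_k)\to(M'_k,p'_k)$ such that $\prod_k\psi_k$ carries the first identification to the second. 2. The germs $(M_k,p_k)$ are irreducible germs of F-manifolds, and the algebras $T_{p_k}M_k\cong(T_pM)_k$ are irreducible and local. 3. For every $d\in\mathbb C$, every Euler field $E$ of weight $d$ on $(M,p)$ is the sum of (the lifts of) Euler fields $E_k$ of weight $d$ on the germs $(M_k,p_k)$. 4. If $p$ is semisimple, there are canonical coordinates near $p$, that is, holomorphic coordinates $u_1,\dots,u_n$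 with $n=\dim M$, $\frac{\partial}{\partial u_i}\circ\frac{\partial}{\partial u_j}=\delta_{ij}\frac{\partial}{\partial u_i}$ and $e=\sum_i\frac{\partial}{\partial u_i}$. -/

import Mathlib

open scoped Manifold ContDiff Topology

section Definitions

universe u v w

/-- A multiplication on the tangent spaces of a complex manifold `M` modelled on `E`, turning
every `T_x M` into a commutative associative `ℂ`-algebra with unit. Nothing is required yet about
the dependence on `x`. -/
structure TangentAlg (E : Type u) [NormedAddCommGroup E] [NormedSpace ℂ E]
    (M : Type v) [TopologicalSpace M] [ChartedSpace E M] where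
  mul : ∀ x : M, TangentSpace 𝓘(ℂ, E) x →ₗ[ℂ] TangentSpace 𝓘(ℂ, E) x →ₗ[ℂ] TangentSpace 𝓘(ℂ, E) x
  unit : ∀ x : M, TangentSpace 𝓘(ℂ, E) x
  mul_comm : ∀ x a b, mul x a b = mul x b a
  mul_assoc : ∀ x a b c, mul x (mul x a b) c = mul x a (mul x b c)
  unit_mul : ∀ x a, mul x (unit x) a = a

/-- The vector field `X` is defined and holomorphic on the open set `V`; the values of `X`
outside `V` are irrelevant. -/
def HolField (E : Type u) [NormedAddCommGroup E] [NormedSpace ℂ E]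
    {M : Type v} [TopologicalSpace M] [ChartedSpace E M] [IsManifold 𝓘(ℂ, E) ω M]
    (V : Set M) (X : ∀ x : M, TangentSpace 𝓘(ℂ, E) x) : Prop :=
  ContMDiffOn 𝓘(ℂ, E) 𝓘(ℂ, E).tangent ω (fun x => (⟨x, X x⟩ : TangentBundle 𝓘(ℂ, E) M)) V

namespace TangentAlg

variable {E : Type u} [NormedAddCommGroup E] [NormedSpace ℂ E]
  {M : Type v} [TopologicalSpace M] [ChartedSpace E M]

/-- The product `X ∘ Y` of two vector fields. -/
noncomputable def fieldMul (A : TangentAlg E M) (X Y : ∀ x : M, TangentSpace 𝓘(ℂ, E) x) :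
    ∀ x : M, TangentSpace 𝓘(ℂ, E) x :=
  fun x => A.mul x (X x) (Y x)

/-- The Lie derivative of the multiplication, evaluated on two vector fields:
`Lie_X(∘)(Z, W) = [X, Z ∘ W] - [X, Z] ∘ W - Z ∘ [X, W]`. -/
noncomputable def lieMul (A : TangentAlg E M) (X Z W : ∀ x : M, TangentSpace 𝓘(ℂ, E) x) :
    ∀ x : M, TangentSpace 𝓘(ℂ, E) x :=
  fun x => VectorField.mlieBracket 𝓘(ℂ, E) X (A.fieldMul Z W) x
    - A.mul x (VectorField.mlieBracket 𝓘(ℂ, E) X Z x) (W x)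
    - A.mul x (Z x) (VectorField.mlieBracket 𝓘(ℂ, E) X W x)

/-- `(U, ∘, e)` is an F-manifold: `U` is a connected open set in a complex manifold of
dimension at least one, multiplication and unit field are holomorphic on `U`, and
`Lie_{X ∘ Y}(∘) = X ∘ Lie_Y(∘) + Y ∘ Lie_X(∘)` for all local holomorphic vector fields
`X`, `Y` on `U`. -/
structure IsFManifoldOn [IsManifold 𝓘(ℂ, E) ω M] (A : TangentAlg E M) (U : Set M) : Prop where
  isOpen : IsOpen U
  isConnected : IsConnected U
  one_le_dim : 1 ≤ Module.finrank ℂ E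
  hol_mul : ∀ V : Set M, IsOpen V → V ⊆ U → ∀ X Y : (∀ x : M, TangentSpace 𝓘(ℂ, E) x),
    HolField E V X → HolField E V Y → HolField E V (A.fieldMul X Y)
  hol_unit : HolField E U A.unit
  lie_mul : ∀ V : Set M, IsOpen V → V ⊆ U → ∀ X Y Z W : (∀ x : M, TangentSpace 𝓘(ℂ, E) x),
    HolField E V X → HolField E V Y → HolField E V Z → HolField E V W → ∀ x ∈ V,
    A.lieMul (A.fieldMul X Y) Z W x
      = A.mul x (X x) (A.lieMul Y Z W x) + A.mul x (Y x) (A.lieMul X Z W x)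

/-- `(M, p)` with this multiplication is the germ of an F-manifold. -/
def IsFGerm [IsManifold 𝓘(ℂ, E) ω M] (A : TangentAlg E M) (p : M) : Prop :=
  ∃ U : Set M, p ∈ U ∧ A.IsFManifoldOn U

/-- The vector field `X` is an Euler field of weight `d` on the open set `U`:
it is holomorphic and `Lie_X(∘) = d · ∘`. -/
structure IsEulerOn [IsManifold 𝓘(ℂ, E) ω M] (A : TangentAlg E M) (d : ℂ)
    (X : ∀ x : M, TangentSpace 𝓘(ℂ, E) x) (U : Set M) : Prop where
  hol : HolField E U X
  lie_mul : ∀ V : Set M, IsOpen V → V ⊆ U → ∀ Z W : (∀ x : M, TangentSpace 𝓘(ℂ, E) x),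
    HolField E V Z → HolField E V W → ∀ x ∈ V, A.lieMul X Z W x = d • A.mul x (Z x) (W x)

/-- `X` represents an Euler field of weight `d` on the germ `(M, p)`. -/
def IsEulerGerm [IsManifold 𝓘(ℂ, E) ω M] (A : TangentAlg E M) (p : M) (d : ℂ)
    (X : ∀ x : M, TangentSpace 𝓘(ℂ, E) x) : Prop :=
  ∃ U : Set M, IsOpen U ∧ p ∈ U ∧ A.IsEulerOn d X U

/-- The simultaneous generalized eigenspace in `T_p M` of all multiplication endomorphisms `a ∘`,
where `χ a` is the eigenvalue of `a ∘`. -/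
noncomputable def simEigenspace (A : TangentAlg E M) (p : M) (χ : TangentSpace 𝓘(ℂ, E) p → ℂ) :
    Submodule ℂ (TangentSpace 𝓘(ℂ, E) p) :=
  ⨅ a : TangentSpace 𝓘(ℂ, E) p, Module.End.maxGenEigenspace (A.mul p a) (χ a)

/-- The index set of the eigenspace decomposition of the algebra `T_p M`: the eigenvalue functions
with nonzero simultaneous generalized eigenspace. -/
def Weight (A : TangentAlg E M) (p : M) : Type u :=
  {χ : TangentSpace 𝓘(ℂ, E) p → ℂ // A.simEigenspace p χ ≠ ⊥}

/-- The summands `(T_p M)_k` of the eigenspace decomposition of the algebra `T_p M`. -/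
noncomputable def eigenspace (A : TangentAlg E M) (p : M) (k : A.Weight p) :
    Submodule ℂ (TangentSpace 𝓘(ℂ, E) p) :=
  A.simEigenspace p k.1

theorem finite_weight [FiniteDimensional ℂ E] (A : TangentAlg E M) (p : M) :
    Finite (A.Weight p) := by
  have : FiniteDimensional ℂ (TangentSpace 𝓘(ℂ, E) p) := inferInstanceAs (FiniteDimensional ℂ E)
  have h : iSupIndep (A.simEigenspace p) := by
    refine Module.End.independent_iInf_maxGenEigenspace_of_forall_mapsTo
      (fun a : TangentSpace 𝓘(ℂ, E) p => (A.mul p a : Module.End ℂ (TangentSpace 𝓘(ℂ, E) p))) ?_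
    intro a b φ
    apply Module.End.mapsTo_maxGenEigenspace_of_comm
    refine LinearMap.ext fun c => ?_
    change A.mul p b (A.mul p a c) = A.mul p a (A.mul p b c)
    rw [← A.mul_assoc, ← A.mul_assoc, A.mul_comm p a b]
  exact (WellFoundedGT.finite_ne_bot_of_iSupIndep h).to_subtype

noncomputable instance [FiniteDimensional ℂ E] (A : TangentAlg E M) (p : M) :
    Fintype (A.Weight p) :=
  have := A.finite_weight p
  Fintype.ofFinite _

/-- The algebra `T_p M` is irreducible: it is nonzero and is not the direct sum of two nonzero
ideals. -/
def IsIrreducibleAt (A : TangentAlg E M) (p : M) : Prop :=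
  A.unit p ≠ 0 ∧
    ∀ I J : Submodule ℂ (TangentSpace 𝓘(ℂ, E) p), IsCompl I J →
      (∀ a, ∀ b ∈ I, A.mul p a b ∈ I) → (∀ a, ∀ b ∈ J, A.mul p a b ∈ J) → I = ⊥ ∨ J = ⊥

/-- The algebra `T_p M` is local: it is nonzero, and whenever `a + b` is the unit, `a` or `b` is
invertible. -/
def IsLocalAt (A : TangentAlg E M) (p : M) : Prop :=
  A.unit p ≠ 0 ∧ ∀ a b : TangentSpace 𝓘(ℂ, E) p, a + b = A.unit p →
    (∃ c, A.mul p a c = A.unit p) ∨ (∃ c, A.mul p b c = A.unit p)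

/-- The algebra `T_p M` is semisimple: its eigenspaces `(T_p M)_k` are one-dimensional. -/
def IsSemisimpleAt (A : TangentAlg E M) (p : M) : Prop :=
  ∀ k : A.Weight p, Module.finrank ℂ (A.eigenspace p k) = 1

/-- The local biholomorphism `φ` is an isomorphism of the multiplications and of the unit
fields. -/
structure IsFIso {E' : Type*} [NormedAddCommGroup E'] [NormedSpace ℂ E']
    {N : Type*} [TopologicalSpace N] [ChartedSpace E' N]
    (A : TangentAlg E M) (B : TangentAlg E' N) (φ : OpenPartialHomeomorph M N) : Prop where
  hol : ContMDiffOn 𝓘(ℂ, E) 𝓘(ℂ, E') ω φ φ.source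
  hol_symm : ContMDiffOn 𝓘(ℂ, E') 𝓘(ℂ, E) ω φ.symm φ.target
  map_mul : ∀ x ∈ φ.source, ∀ a b : TangentSpace 𝓘(ℂ, E) x,
    mfderiv 𝓘(ℂ, E) 𝓘(ℂ, E') φ x (A.mul x a b)
      = B.mul (φ x) (mfderiv 𝓘(ℂ, E) 𝓘(ℂ, E') φ x a) (mfderiv 𝓘(ℂ, E) 𝓘(ℂ, E') φ x b)
  map_unit : ∀ x ∈ φ.source, mfderiv 𝓘(ℂ, E) 𝓘(ℂ, E') φ x (A.unit x) = B.unit (φ x)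

end TangentAlg

/-- A multiplication on the tangent spaces of `ℂ^m`. -/
abbrev CoordAlg (m : ℕ) : Type := TangentAlg (Fin m → ℂ) (Fin m → ℂ)

/-- The product multiplication `∘ = ⊕_k ∘_k`, with unit field `∑_k e_k`, on the product of the
spaces `ℂ^(m k)`. -/
noncomputable def prodAlg {ι : Type w} [Fintype ι] {m : ι → ℕ} (B : ∀ k, CoordAlg (m k)) :
    TangentAlg (∀ k, Fin (m k) → ℂ) (∀ k, Fin (m k) → ℂ) where
  mul x := LinearMap.mk₂ ℂ
    (fun a b : (∀ k, Fin (m k) → ℂ) => fun k => (B k).mul (x k) (a k) (b k))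
    (fun a a' b => funext fun k => LinearMap.map_add₂ ((B k).mul (x k)) (a k) (a' k) (b k))
    (fun c a b => funext fun k => LinearMap.map_smul₂ ((B k).mul (x k)) c (a k) (b k))
    (fun a b b' => funext fun k => map_add ((B k).mul (x k) (a k)) (b k) (b' k))
    (fun c a b => funext fun k => map_smul ((B k).mul (x k) (a k)) c (b k))
  unit x := fun k => (B k).unit (x k)
  mul_comm x a b := funext fun k => (B k).mul_comm (x k) (a k) (b k)
  mul_assoc x a b c := funext fun k => (B k).mul_assoc (x k) (a k) (b k) (c k)
  unit_mul x a := funext fun k => (B k).unit_mul (x k) (a k)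

/-- The multiplication on `ℂ^n` with `∂_i ∘ ∂_j = δ_ij ∂_i`, with unit field `∑_i ∂_i`. -/
noncomputable def canonicalAlg (n : ℕ) : CoordAlg n where
  mul _ := LinearMap.mul ℂ (Fin n → ℂ)
  unit _ := (1 : Fin n → ℂ)
  mul_comm _ a b := _root_.mul_comm (G := Fin n → ℂ) a b
  mul_assoc _ a b c := _root_.mul_assoc (G := Fin n → ℂ) a b c
  unit_mul _ a := _root_.one_mul (M := Fin n → ℂ) a

section Decomposition

variable {E : Type u} [NormedAddCommGroup E] [NormedSpace ℂ E]
  {M : Type v} [TopologicalSpace M] [ChartedSpace E M]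

/-- A decomposition of the germ `(M, p)` into a product, indexed by `ι`, of germs of F-manifolds.
The factors are written in coordinates, as germs at points of spaces `ℂ^m`; the identification
of `(M, p)` with the product of the factors is the germ at `p` of `chart`. -/
structure FDecomp (A : TangentAlg E M) (p : M) (ι : Type w) [Fintype ι] where
  dim : ι → ℕ
  alg : ∀ k, CoordAlg (dim k)
  pt : ∀ k, Fin (dim k) → ℂ
  isFGerm : ∀ k, (alg k).IsFGerm (pt k)
  chart : OpenPartialHomeomorph M (∀ k, Fin (dim k) → ℂ)
  mem_source : p ∈ chart.source
  chart_apply : chart p = pt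
  isFIso : A.IsFIso (prodAlg alg) chart

namespace FDecomp

variable {A : TangentAlg E M} {p : M} {ι : Type w} [Fintype ι]

/-- The component in the `k`-th factor of the image of a tangent vector of `M` at `x` under the
identification of `M` with the product. -/
noncomputable def comp (D : FDecomp A p ι) (k : ι) (x : M) (a : TangentSpace 𝓘(ℂ, E) x) :
    TangentSpace 𝓘(ℂ, Fin (D.dim k) → ℂ) (D.chart x k) :=
  (mfderiv 𝓘(ℂ, E) 𝓘(ℂ, ∀ k, Fin (D.dim k) → ℂ) D.chart x a : ∀ k, Fin (D.dim k) → ℂ) k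

/-- The decomposition extends the eigenspace decomposition of `T_p M`: the factors are indexed by
the eigenspaces, and the tangent space of the `k`-th factor is `(T_p M)_k`. -/
def Extends [FiniteDimensional ℂ E] (D : FDecomp A p (A.Weight p)) : Prop :=
  ∀ (k : A.Weight p) (a : TangentSpace 𝓘(ℂ, E) p),
    a ∈ A.eigenspace p k ↔ ∀ j, j ≠ k → D.comp j p a = 0

/-- Two decompositions are the same: isomorphisms between the germs of corresponding factors
carry one to the other. -/
def Same (D D' : FDecomp A p ι) : Prop :=
  ∃ ψ : ∀ k, OpenPartialHomeomorph (Fin (D.dim k) → ℂ) (Fin (D'.dim k) → ℂ),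
    (∀ k, D.pt k ∈ (ψ k).source ∧ ψ k (D.pt k) = D'.pt k ∧ (D.alg k).IsFIso (D'.alg k) (ψ k)) ∧
    ∀ᶠ x in 𝓝 p, ∀ k, D'.chart x k = ψ k (D.chart x k)

end FDecomp

/-- The germ `(M, p)` is an irreducible germ of an F-manifold: it is not a product of two germs of
F-manifolds (which have dimension at least one). -/
def TangentAlg.IsIrreducibleGerm [IsManifold 𝓘(ℂ, E) ω M] (A : TangentAlg E M) (p : M) : Prop :=
  A.IsFGerm p ∧ IsEmpty (FDecomp A p (Fin 2))

end Decomposition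

end Definitions

/-! Everything comes from idempotents. The eigenspaces of the finite-dimensional algebra T_pM are
ideals that meet pairwise in 0, so the unit at p is a sum of orthogonal idempotents ε_k, each
generating one summand. At an idempotent ε the equation a∘a = a has derivative 2ε∘ − id, which is
its own inverse; hence ε_k extends to a holomorphic field e_k of idempotents, and the extension is
locally unique (`exists_idempotent_extension`, `eventually_eq_of_idempotent`).

For an idempotent field e the integrability condition gives Lie_e(∘) = 0, hence Lie_{e∘X}(∘) =
e∘Lie_X(∘). It follows that ker(e_k∘) is involutive. Frobenius (`exists_firstIntegral`) then
supplies maps f_k with ker(e_k∘) contained in ker df_k, and their sum is a chart in which every e_k∘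
is a constant projection (`IsFStructure.exists_chart`). In these coordinates the same Lie identity,
applied to constant fields, shows that the k-th component of the multiplication depends on the k-th
coordinates only, so the germ is a product (`IsFStructure.exists_factors`). A bracket computation
with the components of the unit field splits Euler fields in the same way
(`IsFStructure.fderiv_euler_single`).

Uniqueness is rigidity of idempotents: the transition map between two decompositions matches the
components of the unit at p, hence nearby, so its derivative is block diagonal and it is a product
of maps. Irreducibility comes from locality: on an eigenspace each a∘ has a single eigenvalue, a
local algebra is not a sum of two ideals, and a product of germs would split the tangent algebra. At
a semisimple point all factors are one-dimensional, and integrating the form dual to the unit field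
gives the canonical coordinates.

The flows needed for Frobenius come from the implicit function theorem in the Banach space of
continuous curves on [0,1], which yields analytic dependence on initial value and parameter
together. -/

/-! ### Inverse functions. -/

section InverseFunction

variable {E F : Type*} [NormedAddCommGroup E] [NormedSpace ℂ E] [CompleteSpace E]
  [NormedAddCommGroup F] [NormedSpace ℂ F]

/-- The holomorphic inverse function theorem, with a prescribed bound for the domain. -/
theorem ContDiffAt.exists_openPartialHomeomorph {f : E → F} {a : E} (hf : ContDiffAt ℂ ω f a)
    {f' : E ≃L[ℂ] F} (hf' : HasFDerivAt f (f' : E →L[ℂ] F) a) {s : Set E} (hs : s ∈ 𝓝 a) :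
    ∃ φ : OpenPartialHomeomorph E F, a ∈ φ.source ∧ (φ : E → F) = f ∧ φ.source ⊆ s ∧
      ContDiffOn ℂ ω φ φ.source ∧ ContDiffOn ℂ ω φ.symm φ.target := by
  let φ₀ := hf.toOpenPartialHomeomorph f hf' (by simp)
  have h1 : ∀ᶠ x in 𝓝 a, ContDiffAt ℂ ω f x := hf.eventually (by simp)
  have h2 : ∀ᶠ x in 𝓝 a, fderiv ℂ f x ∈ Set.range ((↑) : (E ≃L[ℂ] F) → (E →L[ℂ] F)) := by
    have hc : ContinuousAt (fderiv ℂ f) a := hf.continuousAt_fderiv (by simp)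
    apply hc
    rw [hf'.fderiv]
    exact ContinuousLinearEquiv.nhds f'
  obtain ⟨o, ho, hoo, hao⟩ := mem_nhds_iff.1 (Filter.inter_mem (h1.and h2) hs)
  -- On `o` the map is analytic with invertible derivative at every point, which makes the inverse
  -- analytic on the whole target and not only at the image of `a`.
  let φ := φ₀.restrOpen o hoo
  have hsrc : φ.source = φ₀.source ∩ o := φ₀.restrOpen_source o hoo
  have hsub : φ.source ⊆ o := by rw [hsrc]; exact Set.inter_subset_right
  refine ⟨φ, ?_, rfl, fun x hx => (ho (hsub hx)).2, fun x hx =>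
    (ho (hsub hx)).1.1.contDiffWithinAt, fun y hy => ?_⟩
  · rw [hsrc]
    exact ⟨hf.mem_toOpenPartialHomeomorph_source hf' (by simp), hao⟩
  · have hx := ho (hsub (φ.map_target hy))
    obtain ⟨g, hg⟩ := hx.1.2
    refine (φ.contDiffAt_symm (f₀' := g) hy ?_ hx.1.1).contDiffWithinAt
    rw [hg]
    exact (hx.1.1.differentiableAt (by simp)).hasFDerivAt

end InverseFunction

/-! ### Analytic superposition operators on spaces of continuous functions. -/

section Superposition

variable {𝕜 : Type*} [NontriviallyNormedField 𝕜] {E F : Type*}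
  [NormedAddCommGroup E] [NormedSpace 𝕜 E] [NormedAddCommGroup F] [NormedSpace 𝕜 F]
  (T : Type*) [TopologicalSpace T] [CompactSpace T]

/-- Pointwise application of a continuous multilinear map to continuous functions. -/
noncomputable def ContinuousMultilinearMap.superpose {n : ℕ} (p : E [×n]→L[𝕜] F) :
    C(T, E) [×n]→L[𝕜] C(T, F) :=
  MultilinearMap.mkContinuous
    { toFun := fun β => ⟨fun t => p fun i => β i t, by fun_prop⟩
      map_update_add' := by
        intro _ m i x y
        have key : ∀ (z : C(T, E)) (t : T), (fun j => (Function.update m i z) j t)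
            = Function.update (fun j => m j t) i (z t) := by
          intro z t; funext j; by_cases h : j = i
          · subst h; simp
          · simp [h]
        ext t
        simp [key]
      map_update_smul' := by
        intro _ m i c x
        have key : ∀ (z : C(T, E)) (t : T), (fun j => (Function.update m i z) j t)
            = Function.update (fun j => m j t) i (z t) := by
          intro z t; funext j; by_cases h : j = i
          · subst h; simp
          · simp [h]
        ext t
        simp [key] }
    ‖p‖ (by
      intro β
      refine (ContinuousMap.norm_le _ (by positivity)).2 fun t => ?_
      refine (p.le_opNorm _).trans ?_
      gcongr with i
      exact (β i).norm_coe_le_norm t)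

theorem ContinuousMultilinearMap.norm_superpose_le {n : ℕ} (p : E [×n]→L[𝕜] F) :
    ‖p.superpose T‖ ≤ ‖p‖ :=
  MultilinearMap.mkContinuous_norm_le _ (norm_nonneg _) _

/-- Superposition with an analytic function is analytic on spaces of continuous functions. -/
theorem AnalyticAt.exists_superposition [CompleteSpace F] {R : E → F} {q : E}
    (hR : AnalyticAt 𝕜 R q) : ∃ S : C(T, E) → C(T, F), ∃ r > 0,
      ∀ β ∈ Metric.ball (ContinuousMap.const T q) r,
        AnalyticAt 𝕜 S β ∧ ∀ t, S β t = R (β t) := by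
  obtain ⟨p, r, hp⟩ := hR
  -- `S` is the sum of the superposed power series and not composition with `R`: it is then defined
  -- on all of `C(T, E)`, even where `R ∘ β` fails to be continuous. Superposition does not increase
  -- norms, so the radius of convergence does not shrink.
  let p' : FormalMultilinearSeries 𝕜 C(T, E) C(T, F) := fun n => (p n).superpose T
  have hrad : p.radius ≤ p'.radius :=
    FormalMultilinearSeries.radius_le_of_le fun n => (p n).norm_superpose_le T
  have hpos : 0 < p'.radius := hp.r_pos.trans_le (hp.r_le.trans hrad)
  have hS := (p'.hasFPowerSeriesOnBall hpos).comp_sub (ContinuousMap.const T q)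
  rw [zero_add] at hS
  obtain ⟨r', hr'0, hr'⟩ : ∃ r' : ℝ, 0 < r' ∧ ENNReal.ofReal r' ≤ r := by
    obtain ⟨x, hx0, hx⟩ := ENNReal.lt_iff_exists_nnreal_btwn.1 hp.r_pos
    exact ⟨x, by exact_mod_cast hx0, by rw [ENNReal.ofReal_coe_nnreal]; exact hx.le⟩
  refine ⟨_, r', hr'0, fun β hβ => ⟨hS.analyticAt_of_mem ?_, fun t => ?_⟩⟩
  · rw [Metric.mem_eball, edist_dist]
    exact ((ENNReal.ofReal_lt_ofReal_iff hr'0).2 hβ).trans_le (hr'.trans (hp.r_le.trans hrad))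
  · have hmem : β - ContinuousMap.const T q ∈ Metric.eball (0 : C(T, E)) p'.radius := by
      rw [Metric.mem_eball, edist_dist, dist_zero_right, ← dist_eq_norm]
      exact ((ENNReal.ofReal_lt_ofReal_iff hr'0).2 hβ).trans_le (hr'.trans (hp.r_le.trans hrad))
    have hmem' : β t - q ∈ Metric.eball (0 : E) r := by
      rw [Metric.mem_eball, edist_dist, dist_zero_right]
      refine lt_of_lt_of_le ((ENNReal.ofReal_lt_ofReal_iff hr'0).2 ?_) hr'
      refine lt_of_le_of_lt ?_ (by rwa [Metric.mem_ball, dist_eq_norm] at hβ)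
      exact (β - ContinuousMap.const T q).norm_coe_le_norm t
    -- Evaluation at `t` is continuous and linear, so it turns the series for `S β` term by term
    -- into the series for `R (β t)`.
    have h1 := (p'.hasSum hmem).mapL (ContinuousMap.evalCLM 𝕜 t)
    have h2 := hp.hasSum hmem'
    rw [add_sub_cancel] at h2
    exact h1.unique h2

end Superposition

/-! ### Integration of curves as a bounded operator. -/

section Volterra

variable {E : Type*} [NormedAddCommGroup E] [NormedSpace ℂ E]

/-- The primitive of a continuous curve, extended to the real line. -/
noncomputable def curvePrimitive (g : C(unitInterval, E)) (t : ℝ) : E :=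
  ∫ s in (0 : ℝ)..t, Set.IccExtend zero_le_one g s

variable [CompleteSpace E]

/-- The integrand is extended by constants beyond 0 and 1, so the derivative is two-sided at the
endpoints as well. -/
theorem hasDerivAt_curvePrimitive (g : C(unitInterval, E)) (t : ℝ) :
    HasDerivAt (curvePrimitive g) (g (Set.projIcc 0 1 zero_le_one t)) t := by
  have hc : Continuous (Set.IccExtend zero_le_one g) := g.continuous.Icc_extend'
  exact intervalIntegral.integral_hasDerivAt_right (hc.intervalIntegrable _ _)
    (hc.stronglyMeasurableAtFilter _ _) hc.continuousAt

/-- The operator of integration on the space of continuous curves. -/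
noncomputable def volterra : C(unitInterval, E) →L[ℂ] C(unitInterval, E) :=
  LinearMap.mkContinuous
    { toFun := fun g => ⟨fun t => curvePrimitive g t,
        (continuous_iff_continuousAt.2 fun t => (hasDerivAt_curvePrimitive g t).continuousAt).comp
          continuous_subtype_val⟩
      map_add' := fun g h => by
        ext t
        have hg : Continuous (Set.IccExtend zero_le_one g) := g.continuous.Icc_extend'
        have hh : Continuous (Set.IccExtend zero_le_one h) := h.continuous.Icc_extend'
        exact intervalIntegral.integral_add (hg.intervalIntegrable _ _)
          (hh.intervalIntegrable _ _)
      map_smul' := fun c g => by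
        ext t
        exact intervalIntegral.integral_smul c (Set.IccExtend zero_le_one g) }
    1 (by
      intro g
      rw [one_mul]
      refine (ContinuousMap.norm_le _ (norm_nonneg _)).2 fun t => ?_
      refine (intervalIntegral.norm_integral_le_of_norm_le_const (C := ‖g‖) fun s _ =>
        g.norm_coe_le_norm _).trans ?_
      rw [sub_zero, abs_of_nonneg t.2.1]
      exact mul_le_of_le_one_right (norm_nonneg _) t.2.2)

theorem volterra_apply (g : C(unitInterval, E)) (t : unitInterval) :
    volterra g t = curvePrimitive g t := rfl

end Volterra

/-! ### Analytic dependence of flows on initial values and parameters. -/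

section Flow

theorem eventually_forall_curve_mem {X : Type*} [PseudoMetricSpace X] {q : X} {s : Set X}
    (hs : s ∈ 𝓝 q) :
    ∀ᶠ β : C(unitInterval, X) in 𝓝 (ContinuousMap.const _ q), ∀ t, β t ∈ s := by
  obtain ⟨δ, hδ, hδs⟩ := Metric.mem_nhds_iff.1 hs
  filter_upwards [Metric.ball_mem_nhds _ hδ] with β hβ t
  exact hδs ((ContinuousMap.dist_apply_le_dist t).trans_lt hβ)

variable {E : Type*} [NormedAddCommGroup E] [NormedSpace ℂ E]
  {G : Type*} [NormedAddCommGroup G] [NormedSpace ℂ G]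

/-- The curve `(β, v)` with constant second component, as a linear function of `(β, v)`. -/
noncomputable def curvePair (E G : Type*) [NormedAddCommGroup E] [NormedSpace ℂ E]
    [NormedAddCommGroup G] [NormedSpace ℂ G] :
    C(unitInterval, E) × G →L[ℂ] C(unitInterval, E × G) :=
  ((ContinuousLinearMap.inl ℂ E G).compLeftContinuous ℂ unitInterval).comp
      (ContinuousLinearMap.fst ℂ _ _) +
    (((ContinuousLinearMap.inr ℂ E G).compLeftContinuous ℂ unitInterval).comp
      (ContinuousLinearMap.const ℂ unitInterval)).comp
      (ContinuousLinearMap.snd ℂ _ _)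

theorem curvePair_apply (β : C(unitInterval, E)) (v : G) (t : unitInterval) :
    curvePair E G (β, v) t = (β t, v) := by
  simp [curvePair]

variable [CompleteSpace E] [CompleteSpace G]

/-- Analytic dependence on the initial value `z` and on the parameter `v` of the solution of the
differential equation `β' = f (β, v)`, together with the variational equation. -/
theorem exists_analytic_flow {f : E × G → E} {q : E} (hf : AnalyticAt ℂ f (q, 0))
    (hf0 : ∀ᶠ y in 𝓝 q, f (y, 0) = 0) :
    ∃ β : E × G → C(unitInterval, E), ContDiffAt ℂ ω β (q, 0) ∧
      β (q, 0) = ContinuousMap.const _ q ∧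
      (∀ᶠ z in 𝓝 q, β (z, 0) = ContinuousMap.const _ z) ∧
      ∀ᶠ p in 𝓝 ((q, 0) : E × G),
        (∃ g : C(unitInterval, E), β p = ContinuousMap.const _ p.1 + volterra g ∧
          ∀ t, g t = f (β p t, p.2)) ∧
        ∀ w : E × G, ∃ g : C(unitInterval, E),
          fderiv ℂ β p w = ContinuousMap.const _ w.1 + volterra g ∧
          ∀ t, g t = fderiv ℂ f (β p t, p.2) (fderiv ℂ β p w t, w.2) := by
  obtain ⟨S, r, hr, hS⟩ := hf.exists_superposition unitInterval
  let K : E →L[ℂ] C(unitInterval, E) := ContinuousLinearMap.const ℂ unitInterval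
  have hK : ∀ z, K z = ContinuousMap.const _ z := fun z => rfl
  -- The differential equation is the integral equation Φ = 0, with `S` in the role of superposition
  -- by `f`. The implicit function theorem solves it for the curve on all of [0,1]; smallness of the
  -- parameter takes the place of smallness of time.
  let Φ : (E × G) × C(unitInterval, E) → C(unitInterval, E) :=
    fun x => x.2 - K x.1.1 - volterra (S (curvePair E G (x.2, x.1.2)))
  let u : (E × G) × C(unitInterval, E) := ((q, 0), ContinuousMap.const _ q)
  have hbase : ∀ z : E, curvePair E G (ContinuousMap.const _ z, 0)
      = ContinuousMap.const _ (z, 0) := by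
    intro z; ext t <;> simp [curvePair_apply]
  have hSan : AnalyticAt ℂ S (curvePair E G (ContinuousMap.const _ q, 0)) := by
    rw [hbase]; exact (hS _ (Metric.mem_ball_self hr)).1
  have hSc : ContDiffAt ℂ ω (fun x : (E × G) × C(unitInterval, E) =>
      S (curvePair E G (x.2, x.1.2))) u := by
    refine ContDiffAt.comp (g := S) u hSan.contDiffAt ?_
    fun_prop
  have hΦ : ContDiffAt ℂ ω Φ u := by
    refine ContDiffAt.sub (by fun_prop) ?_
    exact volterra.contDiff.contDiffAt.comp u hSc
  have hSball : ∀ᶠ x : C(unitInterval, E) × G in 𝓝 (ContinuousMap.const _ q, 0),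
      AnalyticAt ℂ S (curvePair E G x) ∧ ∀ t, S (curvePair E G x) t = f (x.1 t, x.2) := by
    have hc := (curvePair E G).continuous.continuousAt (x := (ContinuousMap.const _ q, 0))
    rw [ContinuousAt, hbase] at hc
    filter_upwards [hc (Metric.ball_mem_nhds _ hr)] with x hx
    refine ⟨(hS _ hx).1, fun t => ?_⟩
    rw [(hS _ hx).2 t, ← curvePair_apply]
  have hS0 : ∀ᶠ β : C(unitInterval, E) in 𝓝 (ContinuousMap.const _ q),
      S (curvePair E G (β, 0)) = 0 := by
    have h1 : Filter.Tendsto (fun β : C(unitInterval, E) => (β, (0 : G)))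
      (𝓝 (ContinuousMap.const _ q)) (𝓝 (ContinuousMap.const _ q, 0)) :=
      (Continuous.prodMk_left (0 : G)).continuousAt
    filter_upwards [h1.eventually hSball, eventually_forall_curve_mem hf0] with β hβ hβ0
    ext t
    rw [hβ.2 t]
    exact hβ0 t
  have hΦu : Φ u = 0 := by
    have := hS0.self_of_nhds
    simp only [Φ, u, hK, this, map_zero, sub_self]
  -- Near the constant curve and for zero parameter the integral term vanishes, because f(·, 0) = 0
  -- near q. The partial derivative in the curve is therefore exactly the identity.
  have hpart : fderiv ℂ Φ u ∘L .inr ℂ (E × G) C(unitInterval, E) = .id ℂ _ := by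
    have h1 : HasFDerivAt (fun β : C(unitInterval, E) => Φ ((q, 0), β))
        (fderiv ℂ Φ u ∘L .inr ℂ (E × G) C(unitInterval, E)) (ContinuousMap.const _ q) :=
      HasFDerivAt.comp (g := Φ) (ContinuousMap.const _ q)
        (hΦ.differentiableAt (by simp)).hasFDerivAt (hasFDerivAt_prodMk_right _ _)
    have h2 : HasFDerivAt (fun β : C(unitInterval, E) => β - K q) (.id ℂ _)
        (ContinuousMap.const _ q) := (hasFDerivAt_id _).sub_const _
    refine h1.unique (h2.congr_of_eventuallyEq ?_)
    filter_upwards [hS0] with β hβ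
    simp only [Φ, hβ, map_zero, sub_zero]
  have hinv : (fderiv ℂ Φ u ∘L .inr ℂ (E × G) C(unitInterval, E)).IsInvertible := by
    rw [hpart]; exact ⟨.refl ℂ _, rfl⟩
  let β := hΦ.implicitFunction (by simp) hinv
  have hβc : ContDiffAt ℂ ω β (q, 0) := hΦ.contDiffAt_implicitFunction (by simp) hinv
  have hβq : β (q, 0) = ContinuousMap.const _ q := hΦ.implicitFunction_apply_self (by simp) hinv
  have hβe : ∀ᶠ p in 𝓝 ((q, 0) : E × G),
      β p = K p.1 + volterra (S (curvePair E G (β p, p.2))) := by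
    filter_upwards [hΦ.eventually_apply_implicitFunction (by simp) hinv] with p hp
    rw [hΦu] at hp
    rw [← sub_eq_zero, ← sub_sub]
    exact hp
  have hpair : ContinuousAt (fun p : E × G => (β p, p.2)) (q, 0) :=
    hβc.continuousAt.prodMk continuousAt_snd
  have hev : ∀ᶠ p in 𝓝 ((q, 0) : E × G), AnalyticAt ℂ S (curvePair E G (β p, p.2)) ∧
      ∀ᶠ x in 𝓝 (β p, p.2), ∀ t, S (curvePair E G x) t = f (x.1 t, x.2) := by
    have h2 := hSball.eventually_nhds
    rw [← hβq] at h2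
    filter_upwards [hpair.eventually h2] with p hp
    exact ⟨hp.self_of_nhds.1, hp.mono fun x hx => hx.2⟩
  have hfan : ∀ᶠ p in 𝓝 ((q, 0) : E × G), ∀ t, AnalyticAt ℂ f (β p t, p.2) := by
    have h1 : ∀ᶠ c : C(unitInterval, E × G) in 𝓝 (ContinuousMap.const _ (q, 0)),
      ∀ t, AnalyticAt ℂ f (c t) := eventually_forall_curve_mem hf.eventually_analyticAt
    have hc : ContinuousAt (fun p : E × G => curvePair E G (β p, p.2)) (q, 0) :=
      (curvePair E G).continuous.continuousAt.comp hpair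
    rw [ContinuousAt, hβq, hbase] at hc
    filter_upwards [hc.eventually h1] with p hp t
    rw [← curvePair_apply]
    exact hp t
  refine ⟨β, hβc, hβq, ?_, ?_⟩
  -- Constant curves solve the equation with zero parameter; local uniqueness identifies them with
  -- `β`.
  · have h1 := hΦ.eventually_apply_eq_iff_implicitFunction (by simp) hinv
    have h2 : ContinuousAt (fun z : E => (((z, 0), K z) : (E × G) × C(unitInterval, E))) q :=
      ((continuous_id.prodMk continuous_const).prodMk K.continuous).continuousAt
    filter_upwards [h2.eventually h1, (K.continuous.continuousAt (x := q)).eventually hS0]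
      with z hz hz0
    refine hz.1 ?_
    rw [hΦu]
    simp only [Φ, hz0, map_zero, sub_self]
  · filter_upwards [hβe.eventually_nhds, hev, hfan, hβc.eventually (by simp)]
      with p hpe hpS hpf hpc
    refine ⟨⟨_, hpe.self_of_nhds, hpS.2.self_of_nhds⟩, fun w => ?_⟩
    -- Differentiating the integral equation gives the variational equation in integral form. The
    -- derivative of `S` is then computed at each time `t` from S(β, v)(t) = f(β t, v), valid for
    -- all nearby curves.
    have hd : HasFDerivAt β (fderiv ℂ β p) p := (hpc.differentiableAt (by simp)).hasFDerivAt
    have hd2 : HasFDerivAt (fun p : E × G => (β p, p.2))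
        ((fderiv ℂ β p).prod (.snd ℂ E G)) p := hd.prodMk hasFDerivAt_snd
    have hd3 : HasFDerivAt (fun x => S (curvePair E G x))
        (fderiv ℂ S (curvePair E G (β p, p.2)) ∘L curvePair E G) (β p, p.2) :=
      hpS.1.differentiableAt.hasFDerivAt.comp _ (curvePair E G).hasFDerivAt
    have hd4 := hd3.comp p hd2
    have hd5 := ((K ∘L .fst ℂ E G).hasFDerivAt (x := p)).add (volterra.hasFDerivAt.comp p hd4)
    have hd6 := hd.unique (hd5.congr_of_eventuallyEq hpe)
    refine ⟨_, by rw [hd6]; rfl, fun t => ?_⟩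
    have he1 : HasFDerivAt (fun x : C(unitInterval, E) × G => S (curvePair E G x) t)
        (ContinuousMap.evalCLM ℂ t ∘L (fderiv ℂ S (curvePair E G (β p, p.2)) ∘L curvePair E G))
        (β p, p.2) :=
      (ContinuousMap.evalCLM ℂ t : C(unitInterval, E) →L[ℂ] E).hasFDerivAt.comp (β p, p.2) hd3
    have he2 : HasFDerivAt (fun x : C(unitInterval, E) × G => f (x.1 t, x.2))
        (fderiv ℂ f (β p t, p.2) ∘L
          ((ContinuousMap.evalCLM ℂ t ∘L .fst ℂ C(unitInterval, E) G).prod (.snd ℂ _ G)))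
        (β p, p.2) :=
      HasFDerivAt.comp (g := f) (β p, p.2) (hpf t).differentiableAt.hasFDerivAt
        (((ContinuousMap.evalCLM ℂ t ∘L .fst ℂ C(unitInterval, E) G)).hasFDerivAt.prodMk
          hasFDerivAt_snd)
    have he3 := he1.unique (he2.congr_of_eventuallyEq (hpS.2.mono fun x hx => hx t))
    exact DFunLike.congr_fun he3 (fderiv ℂ β p w, w.2)

end Flow

/-! ### The holomorphic Frobenius theorem for kernels of projectors. -/

section Frobenius

variable {E : Type*} [NormedAddCommGroup E] [NormedSpace ℂ E]

theorem OpenPartialHomeomorph.fderiv_symm_comp_fderiv {E F : Type*} [NormedAddCommGroup E]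
    [NormedSpace ℂ E] [NormedAddCommGroup F] [NormedSpace ℂ F] (φ : OpenPartialHomeomorph E F)
    (h1 : ContDiffOn ℂ ω φ φ.source) (h2 : ContDiffOn ℂ ω φ.symm φ.target) {x : E}
    (hx : x ∈ φ.source) (a : E) : fderiv ℂ φ.symm (φ x) (fderiv ℂ φ x a) = a := by
  have e1 : HasFDerivAt φ (fderiv ℂ φ x) x :=
    ((h1.contDiffAt (φ.open_source.mem_nhds hx)).differentiableAt (by simp)).hasFDerivAt
  have e2 : HasFDerivAt φ.symm (fderiv ℂ φ.symm (φ x)) (φ x) :=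
    ((h2.contDiffAt (φ.open_target.mem_nhds (φ.map_source hx))).differentiableAt
      (by simp)).hasFDerivAt
  have e3 := (e2.comp x e1).unique ((hasFDerivAt_id x).congr_of_eventuallyEq
    (by filter_upwards [φ.open_source.mem_nhds hx] with z hz using φ.left_inv hz))
  exact DFunLike.congr_fun e3 a

theorem OpenPartialHomeomorph.fderiv_comp_fderiv_symm {E F : Type*} [NormedAddCommGroup E]
    [NormedSpace ℂ E] [NormedAddCommGroup F] [NormedSpace ℂ F] (φ : OpenPartialHomeomorph E F)
    (h1 : ContDiffOn ℂ ω φ φ.source) (h2 : ContDiffOn ℂ ω φ.symm φ.target) {y : F}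
    (hy : y ∈ φ.target) (a : F) : fderiv ℂ φ (φ.symm y) (fderiv ℂ φ.symm y a) = a :=
  φ.symm.fderiv_symm_comp_fderiv h2 h1 hy a

/-- The derivative of P ∘ P = P. In particular, the derivative of P maps vectors of ker P into the
image of P. -/
theorem fderiv_apply_of_idempotent {P : E → E →L[ℂ] E} {y : E} (hP : DifferentiableAt ℂ P y)
    (hid : ∀ᶠ y in 𝓝 y, ∀ a, P y (P y a) = P y a) (h a : E) :
    fderiv ℂ P y h (P y a) + P y (fderiv ℂ P y h a) = fderiv ℂ P y h a := by
  have h1 : HasFDerivAt (fun y => (P y).comp (P y)) _ y := hP.hasFDerivAt.clm_comp hP.hasFDerivAt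
  have h2 := h1.unique (hP.hasFDerivAt.congr_of_eventuallyEq
    (hid.mono fun z hz => ContinuousLinearMap.ext (hz ·)))
  have h3 := DFunLike.congr_fun (DFunLike.congr_fun h2 h) a
  simp at h3
  rw [add_comm]
  exact h3

variable [CompleteSpace E]

/-- The flow of sections of an involutive distribution, given as the kernel of a projector, stays
tangent to it when the section varies. -/
theorem exists_flow_tangent {P : E → E →L[ℂ] E} {q : E} (hP : AnalyticAt ℂ P q)
    (hid : ∀ᶠ y in 𝓝 q, ∀ a, P y (P y a) = P y a)
    (hinv : ∀ᶠ y in 𝓝 q, ∀ a b, P y a = 0 → P y b = 0 →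
      fderiv ℂ P y a b = fderiv ℂ P y b a) :
    ∃ ψ : E × E → E, ContDiffAt ℂ ω ψ (q, 0) ∧ ψ (q, 0) = q ∧
      (∀ z w, fderiv ℂ ψ (q, 0) (z, w) = z + (w - P q w)) ∧
      ∀ᶠ p in 𝓝 ((q, 0) : E × E), ∀ w, P (ψ p) (fderiv ℂ ψ p (0, w)) = 0 := by
  -- For fixed v this is the constant field v projected to the distribution ker P. The map ψ is its
  -- time-one flow, as a function of the starting point and of v.
  let f : E × E → E := fun x => x.2 - P x.1 x.2
  have hf : AnalyticAt ℂ f (q, 0) := by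
    have hPf : ContDiffAt ℂ ω (fun x : E × E => P x.1) (q, 0) :=
      ContDiffAt.comp (g := P) ((q, 0) : E × E) hP.contDiffAt contDiffAt_fst
    exact (contDiffAt_snd.sub (hPf.clm_apply contDiffAt_snd)).analyticAt
  have hfd : ∀ y v h w : E, AnalyticAt ℂ P y →
      fderiv ℂ f (y, v) (h, w) = w - (P y w + fderiv ℂ P y h v) := by
    intro y v h w hy
    have h1 : HasFDerivAt (fun x : E × E => P x.1) (fderiv ℂ P y ∘L .fst ℂ E E) (y, v) :=
      HasFDerivAt.comp (g := P) (y, v) hy.differentiableAt.hasFDerivAt hasFDerivAt_fst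
    have h2 : HasFDerivAt f _ (y, v) :=
      (hasFDerivAt_snd (𝕜 := ℂ) (E := E) (F := E)).sub (h1.clm_apply hasFDerivAt_snd)
    rw [h2.fderiv]
    simp
  obtain ⟨β, hβ, hβq, hβz, hβe⟩ := exists_analytic_flow hf (by simp [f])
  let ev : C(unitInterval, E) →L[ℂ] E := ContinuousMap.evalCLM ℂ 1
  have hψ : ∀ p, ContDiffAt ℂ ω β p → ∀ w, fderiv ℂ (fun p => β p 1) p w = fderiv ℂ β p w 1 := by
    intro p hp w
    have : HasFDerivAt (fun p => ev (β p)) (ev ∘L fderiv ℂ β p) p :=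
      ev.hasFDerivAt.comp p (hp.differentiableAt (by simp)).hasFDerivAt
    exact DFunLike.congr_fun this.fderiv w
  refine ⟨fun p => β p 1, ev.contDiff.contDiffAt.comp _ hβ, by simp [hβq], fun z w => ?_, ?_⟩
  · have hzw : ((z, w) : E × E) = (z, 0) + (0, w) := by simp
    rw [hzw, map_add, hψ _ hβ, hψ _ hβ]
    congr 1
    · have h1 : HasFDerivAt (fun z => β (z, 0)) (fderiv ℂ β (q, 0) ∘L .inl ℂ E E) q :=
        HasFDerivAt.comp (g := β) q (hβ.differentiableAt (by simp)).hasFDerivAt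
          (hasFDerivAt_prodMk_left q (0 : E))
      have h2 := h1.unique (((ContinuousLinearMap.const ℂ unitInterval :
        E →L[ℂ] C(unitInterval, E)).hasFDerivAt (x := q)).congr_of_eventuallyEq hβz)
      exact DFunLike.congr_fun (DFunLike.congr_fun h2 z) 1
    · obtain ⟨g, hg, hgt⟩ := hβe.self_of_nhds.2 (0, w)
      have hg' : g = ContinuousMap.const _ (w - P q w) := by
        ext t
        rw [hgt, hβq, ContinuousMap.const_apply, hfd _ _ _ _ hP]
        simp
      rw [hg, ContinuousMap.add_apply, volterra_apply, curvePrimitive, hg']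
      have : (∫ _ in (0 : ℝ)..1, (w - P q w)) = w - P q w := by simp
      exact (zero_add _).trans this
  -- Along a trajectory b let h be the variation in direction (0, w) and k = P(b) h. Involutivity
  -- turns the variational equation into the homogeneous linear equation k' = dP(v − Pv)(k) −
  -- dP(k)(v − Pv) with k(0) = 0, and a Grönwall estimate gives k = 0. `C` and `C'` bound the
  -- coefficients uniformly along nearby curves.
  · let C := ‖fderiv ℂ P q‖ + 1
    let C' := ‖P q‖ + 1
    have hC : ∀ᶠ y in 𝓝 q, ‖fderiv ℂ P y‖ < C :=
      hP.fderiv.continuousAt.norm.eventually_lt_const (lt_add_one _)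
    have hC' : ∀ᶠ y in 𝓝 q, ‖P y‖ < C' :=
      hP.continuousAt.norm.eventually_lt_const (lt_add_one _)
    have hgood := eventually_forall_curve_mem (((hP.eventually_analyticAt.and
      hid.eventually_nhds).and (hinv.and (hC.and hC'))))
    rw [← hβq] at hgood
    filter_upwards [hβ.continuousAt.eventually hgood, hβe, hβ.eventually (by simp)]
      with p hp hpe hpc w
    rw [hψ p hpc]
    obtain ⟨⟨g, hg, hgt⟩, hp2⟩ := hpe
    obtain ⟨γ, hγ, hγt⟩ := hp2 (0, w)
    set v := p.2 with hv
    let b : ℝ → E := fun t => p.1 + curvePrimitive g t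
    let h : ℝ → E := fun t => curvePrimitive γ t
    have hbt : ∀ t : unitInterval, b t = β p t := fun t => by rw [hg]; rfl
    have hht : ∀ t : unitInterval, h t = fderiv ℂ β p (0, w) t := fun t => by
      rw [hγ]
      simp [volterra_apply, h]
    have hbd : ∀ t : unitInterval, HasDerivAt b (v - P (b t) v) t := fun t => by
      have := (hasDerivAt_curvePrimitive g t).const_add p.1
      rw [Set.projIcc_val, hgt] at this
      rw [hbt]
      exact this
    have hhd : ∀ t : unitInterval,
        HasDerivAt h (w - (P (b t) w + fderiv ℂ P (b t) (h t) v)) t := fun t => by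
      have := hasDerivAt_curvePrimitive γ t
      rw [Set.projIcc_val, hγt, hfd _ _ _ _ (hp t).1.1] at this
      rw [hbt, hht]
      exact this
    let k : ℝ → E := fun t => P (b t) (h t)
    have hkd : ∀ t : unitInterval, HasDerivAt k
        (fderiv ℂ P (b t) (v - P (b t) v) (k t) - fderiv ℂ P (b t) (k t) (v - P (b t) v)) t := by
      intro t
      have hPd : DifferentiableAt ℂ P (b t) := by
        rw [hbt]; exact (hp t).1.1.differentiableAt
      have h1 : HasFDerivAt (fun x : E × E => P x.1) (fderiv ℂ P (b t) ∘L .fst ℂ E E)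
          (b t, h t) := HasFDerivAt.comp (g := P) (b t, h t) hPd.hasFDerivAt hasFDerivAt_fst
      have h2 := ((h1.clm_apply hasFDerivAt_snd).restrictScalars ℝ).comp_hasDerivAt (t : ℝ)
        ((hbd t).prodMk (hhd t))
      have h3 : HasDerivAt k (P (b t) (w - (P (b t) w + fderiv ℂ P (b t) (h t) v))
          + fderiv ℂ P (b t) (v - P (b t) v) (h t)) t := h2
      convert h3 using 1
      have hidt := (hp t).1.2
      rw [← hbt] at hidt
      have e1 := hidt.self_of_nhds
      have e2 := fderiv_apply_of_idempotent hPd hidt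
      have e3 := (hp t).2.1
      rw [← hbt] at e3
      -- This is the only use of involutivity: both v − Pv and h − Ph lie in ker P.
      have e4 := e3 (v - P (b t) v) (h t - P (b t) (h t))
        (by rw [map_sub, e1, sub_self]) (by rw [map_sub, e1, sub_self])
      have e5 : fderiv ℂ P (b t) (h t) (v - P (b t) v) = P (b t) (fderiv ℂ P (b t) (h t) v) := by
        rw [map_sub, sub_eq_iff_eq_add', e2]
      rw [map_sub (fderiv ℂ P (b t) (v - P (b t) v)), map_sub (fderiv ℂ P (b t)) (h t), sub_apply,
        e5] at e4
      rw [map_sub (P (b t)), map_add (P (b t)), e1, sub_add_cancel_left, ← sub_eq_zero,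
      ← sub_eq_zero.2 e4.symm]
      simp only [k]
      abel
    have hk0 := eq_zero_of_abs_deriv_le_mul_abs_self_of_eq_zero_right (a := 0) (b := 1)
      (f := k)
      (f' := fun t => fderiv ℂ P (b t) (v - P (b t) v) (k t)
        - fderiv ℂ P (b t) (k t) (v - P (b t) v)) (K := 2 * (C * (‖v‖ + C' * ‖v‖)))
      (fun t ht => (hkd ⟨t, ht⟩).continuousAt.continuousWithinAt)
      (fun t ht => (hkd ⟨t, ht.1, ht.2.le⟩).hasDerivWithinAt)
      (by simp [k, h, curvePrimitive])
      (fun t ht => by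
        have hpt := hp ⟨t, ht.1, ht.2.le⟩
        have hbt' := hbt ⟨t, ht.1, ht.2.le⟩
        simp only at hbt'
        rw [← hbt'] at hpt
        have hc1 := hpt.2.2.1.le
        have hc2 := hpt.2.2.2.le
        have hR : ‖v - P (b t) v‖ ≤ ‖v‖ + C' * ‖v‖ :=
          (norm_sub_le _ _).trans (by gcongr; exact (P (b t)).le_of_opNorm_le hc2 v)
        refine (norm_sub_le _ _).trans ?_
        have i1 : ‖fderiv ℂ P (b t) (v - P (b t) v) (k t)‖ ≤ C * (‖v‖ + C' * ‖v‖) * ‖k t‖ := by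
          refine (ContinuousLinearMap.le_opNorm₂ _ _ _).trans ?_
          gcongr
        have i2 : ‖fderiv ℂ P (b t) (k t) (v - P (b t) v)‖ ≤ C * ‖k t‖ * (‖v‖ + C' * ‖v‖) := by
          refine (ContinuousLinearMap.le_opNorm₂ _ _ _).trans ?_
          gcongr
        linarith) 1 ⟨zero_le_one, le_rfl⟩
    have hb1 := hbt 1
    have hh1 := hht 1
    rw [← hb1, ← hh1]
    exact hk0

/-- The holomorphic Frobenius theorem: an involutive distribution, given as the kernel of a
projector `P`, is locally the kernel of the derivative of a map with values in the image of
`P q`. -/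
theorem exists_firstIntegral {P : E → E →L[ℂ] E} {q : E} (hP : AnalyticAt ℂ P q)
    (hid : ∀ᶠ y in 𝓝 q, ∀ a, P y (P y a) = P y a)
    (hinv : ∀ᶠ y in 𝓝 q, ∀ a b, P y a = 0 → P y b = 0 →
      fderiv ℂ P y a b = fderiv ℂ P y b a) :
    ∃ f : E → E, ContDiffAt ℂ ω f q ∧ HasFDerivAt f (P q) q ∧ (∀ y, P q (f y) = f y) ∧
      ∀ᶠ y in 𝓝 q, ∀ a, P y a = 0 → fderiv ℂ f y a = 0 := by
  obtain ⟨ψ, hψ, hψq, hψd, hψt⟩ := exists_flow_tangent hP hid hinv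
  have hid0 := hid.self_of_nhds
  -- Coordinates adapted to the distribution: the starting point moves in the image of `P q` and the
  -- flow parameter in ker `P q`. The composite has derivative the identity at 0 and maps the
  -- directions in ker `P q` into ker P.
  let N : E →L[ℂ] E × E := (P q).prod (.id ℂ E - P q)
  let e : E → E × E := fun x => (q, 0) + N x
  have he0 : e 0 = (q, 0) := by simp [e]
  have hed : ∀ x, HasFDerivAt e N x := fun x => N.hasFDerivAt.const_add _
  have hec : ContDiffAt ℂ ω e 0 := (contDiff_const.add N.contDiff).contDiffAt
  rw [← he0] at hψ hψt
  have hΨ : ContDiffAt ℂ ω (ψ ∘ e) 0 := hψ.comp 0 hec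
  have hΨd : HasFDerivAt (ψ ∘ e) ((ContinuousLinearEquiv.refl ℂ E : E ≃L[ℂ] E) : E →L[ℂ] E) 0 := by
    convert (hψ.differentiableAt (by simp)).hasFDerivAt.comp 0 (hed 0) using 1
    ext a
    have : N a = (P q a, a - P q a) := rfl
    rw [ContinuousLinearMap.comp_apply, he0, this, hψd, map_sub, hid0]
    simp
  have hΨt : ∀ᶠ x in 𝓝 (0 : E), ∀ a, P (ψ (e x)) (fderiv ℂ (ψ ∘ e) x (a - P q a)) = 0 := by
    have hc : ContinuousAt e 0 := hec.continuousAt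
    filter_upwards [hc.eventually hψt, hc.eventually (hψ.eventually (by simp))] with x hx hx2 a
    rw [((hx2.differentiableAt (by simp)).hasFDerivAt.comp x (hed x)).fderiv,
      ContinuousLinearMap.comp_apply]
    have : N (a - P q a) = (0, a - P q a) := by
      change (P q (a - P q a), a - P q a - P q (a - P q a)) = _
      rw [map_sub, hid0, sub_self, sub_zero]
    rw [this]
    exact hx _
  obtain ⟨φ, h0, hφ, hφs, hφ1, hφ2⟩ := hΨ.exists_openPartialHomeomorph hΨd hΨt
  have hφ0 : φ 0 = q := by rw [hφ, Function.comp_apply, he0, hψq]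
  have hq : q ∈ φ.target := by rw [← hφ0]; exact φ.map_source h0
  have hsq : φ.symm q = 0 := by rw [← hφ0, φ.left_inv h0]
  have hsc : ContDiffAt ℂ ω φ.symm q := hφ2.contDiffAt (φ.open_target.mem_nhds hq)
  rw [← hφ] at hΨd
  have hsd : HasFDerivAt φ.symm (.id ℂ E) q := by
    have := (hsc.differentiableAt (by simp)).hasFDerivAt
    convert this using 1
    ext a
    have h1 := φ.fderiv_symm_comp_fderiv hφ1 hφ2 h0 a
    rw [hΨd.fderiv, hφ0] at h1
    exact h1.symm
  -- The first integral is the transverse coordinate. What remains is that the slices fill out ker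
  -- P, and are not merely tangent to it.
  refine ⟨fun y => P q (φ.symm y), (P q).contDiff.contDiffAt.comp q hsc,
    (P q).hasFDerivAt.comp q hsd, fun y => hid0 _, ?_⟩
  -- `Z y` records the transverse part of vectors of ker P. It vanishes at q, so it has norm less
  -- than 1 nearby; it is also idempotent there, hence 0. This avoids counting dimensions, and `E`
  -- may be infinite-dimensional.
  let Z : E → E →L[ℂ] E := fun y =>
    fderiv ℂ φ (φ.symm y) ∘L (P q ∘L (fderiv ℂ φ.symm y ∘L (.id ℂ E - P y)))
  have hZc : ContinuousAt Z q := by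
    have c1 : ContinuousAt (fderiv ℂ φ) (φ.symm q) := by
      rw [hsq]
      exact (hφ1.contDiffAt (φ.open_source.mem_nhds h0)).continuousAt_fderiv (by simp)
    have c2 : ContinuousAt (fun y => fderiv ℂ φ (φ.symm y)) q :=
      ContinuousAt.comp (g := fderiv ℂ φ) c1 hsc.continuousAt
    have c3 : ContinuousAt (fderiv ℂ φ.symm) q := hsc.continuousAt_fderiv (by simp)
    exact c2.clm_comp (continuousAt_const.clm_comp
      (c3.clm_comp (continuousAt_const.sub hP.continuousAt)))
  have hZq : Z q = 0 := by
    ext a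
    simp only [Z, hsq, hΨd.fderiv, hsd.fderiv]
    simp [hid0]
  have hZ1 : ∀ᶠ y in 𝓝 q, ‖Z y‖ < 1 :=
    hZc.norm.eventually_lt_const (by change ‖Z q‖ < 1; rw [hZq, norm_zero]; exact one_pos)
  filter_upwards [hZ1, hid, φ.open_target.mem_nhds hq] with y hy1 hyid hyt a ha
  have hys := φ.map_target hyt
  have hPy : ∀ b, P y (fderiv ℂ φ (φ.symm y) (b - P q b)) = 0 := by
    have h1 := hφs hys
    have h2 : ψ (e (φ.symm y)) = y := by
      have := φ.right_inv hyt
      rw [hφ] at this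
      exact this
    simp only [Set.mem_ofPred_eq, h2, ← hφ] at h1
    exact h1
  have hLM := fun b => φ.fderiv_comp_fderiv_symm hφ1 hφ2 hyt b
  have hML : ∀ b, fderiv ℂ φ.symm y (fderiv ℂ φ (φ.symm y) b) = b := fun b => by
    have := φ.fderiv_symm_comp_fderiv hφ1 hφ2 hys b
    rwa [φ.right_inv hyt] at this
  have hPQ : ∀ b, P y (fderiv ℂ φ (φ.symm y) (P q (fderiv ℂ φ.symm y b))) = P y b := fun b => by
    have := hPy (fderiv ℂ φ.symm y b)
    rw [map_sub, map_sub, hLM, sub_eq_zero] at this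
    exact this.symm
  have hZap : ∀ b, Z y b = fderiv ℂ φ (φ.symm y) (P q (fderiv ℂ φ.symm y (b - P y b))) :=
    fun b => rfl
  have hZZ : Z y ∘L Z y = Z y := by
    ext b
    rw [ContinuousLinearMap.comp_apply, hZap (Z y b), hZap b, hPQ, map_sub (P y), hyid, sub_self,
      sub_zero, hML, hid0]
  have hZ0 : Z y = 0 := by
    have h1 : ‖Z y‖ ≤ ‖Z y‖ * ‖Z y‖ := by
      conv_lhs => rw [← hZZ]
      exact ContinuousLinearMap.opNorm_comp_le _ _
    rw [← norm_eq_zero]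
    nlinarith [norm_nonneg (Z y)]
  have h2 := hZap a
  rw [ha, sub_zero, hZ0, zero_apply] at h2
  have hsy : HasFDerivAt φ.symm (fderiv ℂ φ.symm y) y :=
    ((hφ2.contDiffAt (φ.open_target.mem_nhds hyt)).differentiableAt (by simp)).hasFDerivAt
  have h3 : HasFDerivAt (fun y => P q (φ.symm y)) (P q ∘L fderiv ℂ φ.symm y) y :=
    (P q).hasFDerivAt.comp y hsy
  rw [h3.fderiv, ContinuousLinearMap.comp_apply, ← hML (P q (fderiv ℂ φ.symm y a)), ← h2, map_zero]

end Frobenius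

/-! ### F-manifold structures on open subsets of a vector space; idempotent fields. -/

section VectorSpace

open VectorField

variable {F : Type*} [NormedAddCommGroup F] [NormedSpace ℂ F]

/-- The Lie derivative of a multiplication on the tangent spaces of a vector space, evaluated on
vector fields. -/
noncomputable def lieDerivMul (m : F → F →L[ℂ] F →L[ℂ] F) (X Z W : F → F) (x : F) : F :=
  lieBracket ℂ X (fun y => m y (Z y) (W y)) x - m x (lieBracket ℂ X Z x) (W x)
    - m x (Z x) (lieBracket ℂ X W x)

/-- A holomorphic family, over an open subset of a vector space, of commutative associative unital
multiplications which satisfies the integrability condition of an F-manifold. -/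
structure IsFStructure (m : F → F →L[ℂ] F →L[ℂ] F) (u : F → F) (U : Set F) : Prop where
  isOpen : IsOpen U
  comm : ∀ x a b, m x a b = m x b a
  assoc : ∀ x a b c, m x (m x a b) c = m x a (m x b c)
  unit_mul : ∀ x a, m x (u x) a = a
  hol_mul : ContDiffOn ℂ ω m U
  hol_unit : ContDiffOn ℂ ω u U
  lie_mul : ∀ V : Set F, IsOpen V → V ⊆ U → ∀ X Y Z W : F → F,
    ContDiffOn ℂ ω X V → ContDiffOn ℂ ω Y V → ContDiffOn ℂ ω Z V → ContDiffOn ℂ ω W V → ∀ x ∈ V,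
    lieDerivMul m (fun y => m y (X y) (Y y)) Z W x
      = m x (X x) (lieDerivMul m Y Z W x) + m x (Y x) (lieDerivMul m X Z W x)

theorem lieDerivMul_congr {m : F → F →L[ℂ] F →L[ℂ] F} {X X' Z Z' W W' : F → F} {x : F}
    (hX : X =ᶠ[𝓝 x] X') (hZ : Z =ᶠ[𝓝 x] Z') (hW : W =ᶠ[𝓝 x] W') :
    lieDerivMul m X Z W x = lieDerivMul m X' Z' W' x := by
  have h : (fun y => m y (Z y) (W y)) =ᶠ[𝓝 x] fun y => m y (Z' y) (W' y) := by
    filter_upwards [hZ, hW] with y h1 h2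
    rw [h1, h2]
  rw [lieDerivMul, lieDerivMul, hX.lieBracket_vectorField_eq h, hX.lieBracket_vectorField_eq hZ,
    hX.lieBracket_vectorField_eq hW, hZ.self_of_nhds, hW.self_of_nhds]

/-- Two continuous families of idempotents which agree at a point agree in a neighbourhood. -/
theorem eventually_eq_of_idempotent {Y : Type*} [TopologicalSpace Y] {q : Y}
    {μ : Y → F →L[ℂ] F →L[ℂ] F} (hμ : ContinuousAt μ q) (comm : ∀ y a b, μ y a b = μ y b a)
    (assoc : ∀ y a b c, μ y (μ y a b) c = μ y a (μ y b c)) {a b : Y → F} (ha : ContinuousAt a q)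
    (hb : ContinuousAt b q) (hab : a q = b q) (hai : ∀ᶠ y in 𝓝 q, μ y (a y) (a y) = a y)
    (hbi : ∀ᶠ y in 𝓝 q, μ y (b y) (b y) = b y) : ∀ᶠ y in 𝓝 q, a y = b y := by
  have h1 : ∀ᶠ y in 𝓝 q, ‖μ y‖ < ‖μ q‖ + 1 :=
    (ContinuousAt.norm (E := F →L[ℂ] F →L[ℂ] F) hμ).eventually_lt_const (lt_add_one _)
  have h2 : ∀ᶠ y in 𝓝 q, ‖a y - b y‖ < (‖μ q‖ + 1)⁻¹ := by
    refine (ha.sub hb).norm.eventually_lt_const ?_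
    change ‖a q - b q‖ < _
    rw [hab, sub_self, norm_zero]
    positivity
  filter_upwards [h1, h2, hai, hbi] with y h1 h2 hai hbi
  have hba : μ y (b y) (a y) = μ y (a y) (b y) := comm _ _ _
  have haab : μ y (a y) (μ y (a y) (b y)) = μ y (a y) (b y) := by rw [← assoc, hai]
  have hbab : μ y (b y) (μ y (a y) (b y)) = μ y (a y) (b y) := by
    rw [← assoc, hba, assoc, hbi]
  -- The difference d of two commuting idempotents satisfies d∘d∘d = d, which forces d = 0 as soon
  -- as d is small compared with the norm of the multiplication.
  set d := a y - b y with hd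
  have hddd : μ y d (μ y d d) = d := by
    simp only [hd, map_sub, sub_apply, hai, hbi, hba, haab, hbab]
    abel
  by_contra hne
  have hd0 : 0 < ‖d‖ := norm_pos_iff.2 (sub_ne_zero.2 hne)
  have hK : 0 < ‖μ q‖ + 1 := by positivity
  have hKd : (‖μ q‖ + 1) * ‖d‖ < 1 := by
    rwa [← lt_inv_mul_iff₀ hK, mul_one]
  have b1 : ∀ v w, ‖μ y v w‖ ≤ (‖μ q‖ + 1) * ‖v‖ * ‖w‖ := fun v w =>
    (ContinuousLinearMap.le_opNorm₂ _ _ _).trans (by gcongr)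
  have b2 : ‖d‖ ≤ ((‖μ q‖ + 1) * ‖d‖) * (((‖μ q‖ + 1) * ‖d‖) * ‖d‖) := by
    conv_lhs => rw [← hddd]
    refine (b1 _ _).trans ?_
    gcongr
    exact b1 _ _
  have b3 : ((‖μ q‖ + 1) * ‖d‖) * (((‖μ q‖ + 1) * ‖d‖) * ‖d‖) < 1 * (1 * ‖d‖) := by
    have : (‖μ q‖ + 1) * ‖d‖ * ‖d‖ < 1 * ‖d‖ := by gcongr
    have h0 : 0 < (‖μ q‖ + 1) * ‖d‖ := by positivity
    nlinarith
  linarith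

/-- An idempotent of one of the multiplications extends to a holomorphic family of idempotents. -/
theorem exists_idempotent_extension [CompleteSpace F] {m : F → F →L[ℂ] F →L[ℂ] F} {q : F}
    (hm : ContDiffAt ℂ ω m q) (comm : ∀ x a b, m x a b = m x b a)
    (assoc : ∀ x a b c, m x (m x a b) c = m x a (m x b c)) {ε : F} (hε : m q ε ε = ε) :
    ∃ e : F → F, ContDiffAt ℂ ω e q ∧ e q = ε ∧ ∀ᶠ y in 𝓝 q, m y (e y) (e y) = e y := by
  let Φ : F × F → F := fun x => m x.1 x.2 x.2 - x.2
  have hΦ : ContDiffAt ℂ ω Φ (q, ε) := by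
    have h1 : ContDiffAt ℂ ω (fun x : F × F => m x.1) (q, ε) :=
      ContDiffAt.comp (g := m) (q, ε) hm contDiffAt_fst
    exact ((h1.clm_apply contDiffAt_snd).clm_apply contDiffAt_snd).sub contDiffAt_snd
  have hΦ0 : Φ (q, ε) = 0 := by simp [Φ, hε]
  -- The derivative of a∘a − a at ε. Since ε∘ is a projection, 2ε∘ − id is an involution.
  let N : F →L[ℂ] F := (2 : ℂ) • m q ε - .id ℂ F
  have hN : ∀ a, N a = (2 : ℂ) • m q ε a - a := fun a => rfl
  have hNN : ∀ a, N (N a) = a := fun a => by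
    simp only [hN, map_sub, map_smul, ← assoc, hε]
    module
  have hpart : fderiv ℂ Φ (q, ε) ∘L .inr ℂ F F = N := by
    have h1 : HasFDerivAt (fun v => Φ (q, v)) (fderiv ℂ Φ (q, ε) ∘L .inr ℂ F F) ε :=
      HasFDerivAt.comp (g := Φ) ε (hΦ.differentiableAt (by simp)).hasFDerivAt
        (hasFDerivAt_prodMk_right _ _)
    have h2 : HasFDerivAt (fun v => Φ (q, v)) _ ε :=
      (((m q).hasFDerivAt (x := ε)).clm_apply (hasFDerivAt_id ε)).sub (hasFDerivAt_id ε)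
    rw [h1.unique h2]
    ext a
    simp [hN, comm q a ε, two_smul]
  have hinv : (fderiv ℂ Φ (q, ε) ∘L .inr ℂ F F).IsInvertible := by
    rw [hpart]
    exact ⟨.equivOfInverse N N hNN hNN, rfl⟩
  refine ⟨hΦ.implicitFunction (by simp) hinv, hΦ.contDiffAt_implicitFunction (by simp) hinv,
    hΦ.implicitFunction_apply_self (by simp) hinv, ?_⟩
  filter_upwards [hΦ.eventually_apply_implicitFunction (by simp) hinv] with y hy
  rw [hΦ0] at hy
  exact sub_eq_zero.1 hy

namespace IsFStructure

variable {m : F → F →L[ℂ] F →L[ℂ] F} {u : F → F} {U : Set F}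

theorem mono (H : IsFStructure m u U) {V : Set F} (hV : IsOpen V) (hVU : V ⊆ U) :
    IsFStructure m u V :=
  ⟨hV, H.comm, H.assoc, H.unit_mul, H.hol_mul.mono hVU, H.hol_unit.mono hVU,
    fun V' hV' h => H.lie_mul V' hV' (h.trans hVU)⟩

/-- Idempotent fields preserve the multiplication of an F-manifold. -/
theorem lieDerivMul_idempotent (H : IsFStructure m u U) {V : Set F} (hV : IsOpen V) (hVU : V ⊆ U)
    {e Z W : F → F} (he : ContDiffOn ℂ ω e V) (hee : ∀ y ∈ V, m y (e y) (e y) = e y)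
    (hZ : ContDiffOn ℂ ω Z V) (hW : ContDiffOn ℂ ω W V) {x : F} (hx : x ∈ V) :
    lieDerivMul m e Z W x = 0 := by
  -- With X = Y = e and A = Lie_e(∘)(Z, W) the condition reads A = 2 e∘A. Multiplication by e gives
  -- e∘A = 2 e∘A, so e∘A = 0 and then A = 0.
  have h1 := H.lie_mul V hV hVU e e Z W he he hZ hW x hx
  rw [lieDerivMul_congr (X' := e) (by filter_upwards [hV.mem_nhds hx] using hee) .rfl .rfl] at h1
  set A := lieDerivMul m e Z W x
  have h2 : m x (e x) A = m x (e x) A + m x (e x) A := by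
    conv_lhs => rw [h1]
    rw [map_add, ← H.assoc, hee x hx]
  have h3 : m x (e x) A = 0 := by simpa using h2
  rw [h1, h3, add_zero]

/-- The term X∘Lie_e(∘) of the integrability condition drops out. Both the involutivity of the
annihilators and the independence of the factors rest on this identity. -/
theorem lieDerivMul_idempotent_mul (H : IsFStructure m u U) {V : Set F} (hV : IsOpen V)
    (hVU : V ⊆ U) {e X Z W : F → F} (he : ContDiffOn ℂ ω e V)
    (hee : ∀ y ∈ V, m y (e y) (e y) = e y) (hX : ContDiffOn ℂ ω X V)
    (hZ : ContDiffOn ℂ ω Z V) (hW : ContDiffOn ℂ ω W V) {x : F} (hx : x ∈ V) :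
    lieDerivMul m (fun y => m y (e y) (X y)) Z W x = m x (e x) (lieDerivMul m X Z W x) := by
  rw [H.lie_mul V hV hVU e X Z W he hX hZ hW x hx,
    H.lieDerivMul_idempotent hV hVU he hee hZ hW hx, map_zero, add_zero]

/-- The annihilator of an idempotent field is an involutive distribution. -/
theorem involutive_idempotent (H : IsFStructure m u U) {V : Set F} (hV : IsOpen V) (hVU : V ⊆ U)
    {e : F → F} (he : ContDiffOn ℂ ω e V) (hee : ∀ y ∈ V, m y (e y) (e y) = e y)
    {x : F} (hx : x ∈ V) {a b : F} (ha : m x (e x) a = 0) (hb : m x (e x) b = 0) :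
    fderiv ℂ (fun y => m y (e y)) x a b = fderiv ℂ (fun y => m y (e y)) x b a := by
  set P : F → F →L[ℂ] F := fun y => m y (e y)
  have hPV : ContDiffOn ℂ ω P V := (H.hol_mul.mono hVU).clm_apply he
  have hPP : ∀ y ∈ V, ∀ c, P y (P y c) = P y c := fun y hy c => by
    simp only [P]
    rw [← H.assoc, hee y hy]
  have hPd : DifferentiableAt ℂ P x :=
    (hPV.contDiffAt (hV.mem_nhds hx)).differentiableAt (by simp)
  let X : F → F := fun y => a - P y a
  let Y : F → F := fun y => b - P y b
  have hXV : ContDiffOn ℂ ω X V := contDiffOn_const.sub (hPV.clm_apply contDiffOn_const)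
  have hYV : ContDiffOn ℂ ω Y V := contDiffOn_const.sub (hPV.clm_apply contDiffOn_const)
  have hPX : (fun y => m y (e y) (X y)) =ᶠ[𝓝 x] 0 := by
    filter_upwards [hV.mem_nhds hx] with y hy
    change P y (a - P y a) = 0
    rw [map_sub, hPP y hy, sub_self]
  have hPY : (fun y => m y (e y) (Y y)) =ᶠ[𝓝 x] 0 := by
    filter_upwards [hV.mem_nhds hx] with y hy
    change P y (b - P y b) = 0
    rw [map_sub, hPP y hy, sub_self]
  have h1 := H.lieDerivMul_idempotent_mul hV hVU he hee hXV he hYV hx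
  rw [lieDerivMul_congr hPX .rfl .rfl] at h1
  have hYx : m x (e x) (Y x) = 0 := hPY.self_of_nhds
  have h2 : m x (e x) (lieBracket ℂ X Y x) = 0 := by
    simp only [lieDerivMul, lieBracket_zero_left, Pi.zero_apply, map_zero, zero_apply, sub_zero,
      (Filter.EventuallyEq.refl _ X).lieBracket_vectorField_eq hPY, lieBracket_zero_right,
      zero_sub, map_sub, map_neg] at h1
    rw [← H.assoc, H.comm x (e x), H.assoc, hYx, map_zero, neg_zero, zero_sub, ← H.assoc,
      hee x hx, eq_comm, neg_eq_zero] at h1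
    exact h1
  have hdX : fderiv ℂ X x = -((ContinuousLinearMap.apply ℂ F a) ∘L fderiv ℂ P x) :=
    (((ContinuousLinearMap.apply ℂ F a).hasFDerivAt.comp x hPd.hasFDerivAt).const_sub a).fderiv
  have hdY : fderiv ℂ Y x = -((ContinuousLinearMap.apply ℂ F b) ∘L fderiv ℂ P x) :=
    (((ContinuousLinearMap.apply ℂ F b).hasFDerivAt.comp x hPd.hasFDerivAt).const_sub b).fderiv
  have hXx : X x = a := by simp only [X, P, ha, sub_zero]
  have hYx' : Y x = b := by simp only [Y, P, hb, sub_zero]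
  have h3 : lieBracket ℂ X Y x = fderiv ℂ P x b a - fderiv ℂ P x a b := by
    rw [lieBracket, hdX, hdY, hXx, hYx']
    simp
    abel
  -- The bracket at x, a difference of values of dP on ker P, lies in the image of P; it also lies
  -- in the kernel, so it vanishes.
  have h4 : ∀ c d, P x d = 0 → P x (fderiv ℂ P x c d) = fderiv ℂ P x c d := fun c d hd => by
    have := fderiv_apply_of_idempotent hPd
      (by filter_upwards [hV.mem_nhds hx] with y hy using hPP y hy) c d
    rwa [hd, map_zero, zero_add] at this
  rw [h3] at h2
  change P x _ = 0 at h2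
  rw [map_sub, h4 _ _ ha, h4 _ _ hb, sub_eq_zero] at h2
  exact h2.symm

/-- A decomposition of the unit into orthogonal idempotents at a point extends to local
coordinates in which the multiplications by the idempotents are constant. -/
theorem exists_chart [CompleteSpace F] (H : IsFStructure m u U) {q : F} (hq : q ∈ U)
    {ι : Type*} [Fintype ι] {ε : ι → F} (hε : ∀ k, m q (ε k) (ε k) = ε k)
    (hort : ∀ j k, j ≠ k → m q (ε j) (ε k) = 0) (hsum : ∑ k, ε k = u q) :
    ∃ φ : OpenPartialHomeomorph F F, q ∈ φ.source ∧ φ.source ⊆ U ∧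
      ContDiffOn ℂ ω φ φ.source ∧ ContDiffOn ℂ ω φ.symm φ.target ∧
      (∀ k, fderiv ℂ φ q (ε k) = ε k) ∧
      ∃ e : ι → F → F, (∀ k, e k q = ε k) ∧ ∀ y ∈ φ.source, ∀ k a,
        fderiv ℂ φ y (m y (e k y) a) = m q (ε k) (fderiv ℂ φ y a) := by
  classical
  have hmq : ContDiffAt ℂ ω m q := H.hol_mul.contDiffAt (H.isOpen.mem_nhds hq)
  choose e he heq hee using fun k => exists_idempotent_extension hmq H.comm H.assoc (hε k)
  have hPq : ∀ k, ContDiffAt ℂ ω (fun y => m y (e k y)) q := fun k => hmq.clm_apply (he k)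
  have hPi : ∀ k, ∀ᶠ y in 𝓝 q, ∀ a, m y (e k y) (m y (e k y) a) = m y (e k y) a := fun k => by
    filter_upwards [hee k] with y hy a
    rw [← H.assoc, hy]
  have hPinv : ∀ k, ∀ᶠ y in 𝓝 q, ∀ a b, m y (e k y) a = 0 → m y (e k y) b = 0 →
      fderiv ℂ (fun y => m y (e k y)) y a b = fderiv ℂ (fun y => m y (e k y)) y b a := fun k => by
    obtain ⟨V, hVs, hV, hqV⟩ := mem_nhds_iff.1 (Filter.inter_mem
      (((he k).eventually (by simp)).and (hee k)) (H.isOpen.mem_nhds hq))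
    filter_upwards [hV.mem_nhds hqV] with y hy a b ha hb
    exact H.involutive_idempotent hV (fun z hz => (hVs hz).2)
      (fun z hz => (hVs hz).1.1.contDiffWithinAt) (fun z hz => (hVs hz).1.2) hy ha hb
  choose f hf hfq hfr hfk using fun k =>
    exists_firstIntegral (hPq k).analyticAt (hPi k) (hPinv k)
  simp only [heq] at hfq hfr
  have hPort : ∀ j k, j ≠ k → ∀ a, m q (ε j) (m q (ε k) a) = 0 := fun j k hjk a => by
    rw [← H.assoc, hort j k hjk, map_zero, zero_apply]
  -- The product of e_j and e_k is again idempotent and agrees at q with the idempotent 0, hence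
  -- near q.
  have hort' : ∀ j k, j ≠ k → ∀ᶠ y in 𝓝 q, m y (e j y) (e k y) = 0 := fun j k hjk => by
    refine eventually_eq_of_idempotent hmq.continuousAt H.comm H.assoc
      ((hPq j).clm_apply (he k)).continuousAt continuousAt_const ?_ ?_ (by simp)
    · rw [heq, heq, hort j k hjk]
    · filter_upwards [hee j, hee k] with y hj hk
      rw [H.assoc, H.comm y (e k y), H.assoc, hk, ← H.assoc, hj]
  -- Each `f k` has values in the image of ε_k∘ and derivative ε_k∘ at q. So the sum has derivative
  -- the identity at q, and ε_j∘ recovers df_j from dΦ.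
  let Φ : F → F := fun y => ∑ k, f k y
  have hΦ : ContDiffAt ℂ ω Φ q := ContDiffAt.sum fun k _ => hf k
  have hΦq : HasFDerivAt Φ ((ContinuousLinearEquiv.refl ℂ F : F ≃L[ℂ] F) : F →L[ℂ] F) q := by
    convert HasFDerivAt.fun_sum (u := Finset.univ) fun k _ => hfq k using 1
    ext a
    rw [← map_sum, hsum]
    exact (H.unit_mul q a).symm
  have hgood : ∀ᶠ y in 𝓝 q, (∀ k, DifferentiableAt ℂ (f k) y) ∧
      (∀ k, ∀ a, m y (e k y) (m y (e k y) a) = m y (e k y) a) ∧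
      (∀ k, ∀ a, m y (e k y) a = 0 → fderiv ℂ (f k) y a = 0) ∧
      (∀ j k, j ≠ k → m y (e j y) (e k y) = 0) ∧ y ∈ U := by
    refine .and ?_ (.and ?_ (.and ?_ (.and ?_ (H.isOpen.mem_nhds hq))))
    · refine Filter.eventually_all.2 fun k => ?_
      filter_upwards [(hf k).eventually (by simp)] with y hy using hy.differentiableAt (by simp)
    · exact Filter.eventually_all.2 hPi
    · exact Filter.eventually_all.2 hfk
    · refine Filter.eventually_all.2 fun j => Filter.eventually_all.2 fun k => ?_
      by_cases hjk : j = k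
      · simp [hjk]
      · filter_upwards [hort' j k hjk] with y hy _ using hy
  obtain ⟨φ, hqφ, hφ, hφs, hφ1, hφ2⟩ := hΦ.exists_openPartialHomeomorph hΦq hgood
  refine ⟨φ, hqφ, fun y hy => (hφs hy).2.2.2.2, hφ1, hφ2, fun k => by rw [hφ, hΦq.fderiv]; rfl, e,
    heq, fun y hy k a => ?_⟩
  obtain ⟨hd, hPP, hker, hor, -⟩ := hφs hy
  have hDΦ : ∀ a, fderiv ℂ φ y a = ∑ k, fderiv ℂ (f k) y a := fun a => by
    rw [hφ, (HasFDerivAt.fun_sum (u := Finset.univ) fun k _ => (hd k).hasFDerivAt).fderiv]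
    simp
  have hfr' : ∀ j a, m q (ε j) (fderiv ℂ (f j) y a) = fderiv ℂ (f j) y a := fun j a => by
    have h1 : HasFDerivAt (fun z => m q (ε j) (f j z)) _ y :=
      (m q (ε j)).hasFDerivAt.comp y (hd j).hasFDerivAt
    simp only [hfr j] at h1
    exact (DFunLike.congr_fun (h1.unique (hd j).hasFDerivAt) a)
  have hcomp : ∀ j a, m q (ε j) (fderiv ℂ φ y a) = fderiv ℂ (f j) y a := fun j a => by
    rw [hDΦ, map_sum, Finset.sum_eq_single j, hfr']
    · intro i _ hij
      rw [← hfr' i, hPort j i hij.symm]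
    · simp
  have hsub : ∀ j a, fderiv ℂ (f j) y (m y (e j y) a) = fderiv ℂ (f j) y a := fun j a => by
    rw [← sub_eq_zero, ← map_sub]
    exact hker j _ (by rw [map_sub, hPP, sub_self])
  -- For j ≠ k, df_j kills e_k∘a because e_j∘e_k = 0; and df_k does not distinguish e_k∘a from a,
  -- their difference being annihilated by e_k.
  rw [hDΦ, Finset.sum_eq_single k, hsub, hcomp]
  · intro j _ hjk
    refine hker j _ ?_
    rw [← H.assoc, hor j k hjk, map_zero, zero_apply]
  · simp

end IsFStructure

end VectorSpace

/-! ### Transport of fields, brackets and multiplications along isomorphisms. -/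

section Transport

open VectorField

variable {E : Type*} [NormedAddCommGroup E] [NormedSpace ℂ E]
  {M : Type*} [TopologicalSpace M] [ChartedSpace E M]
  {E' : Type*} [NormedAddCommGroup E'] [NormedSpace ℂ E']
  {N : Type*} [TopologicalSpace N] [ChartedSpace E' N]
  {E'' : Type*} [NormedAddCommGroup E''] [NormedSpace ℂ E'']
  {N' : Type*} [TopologicalSpace N'] [ChartedSpace E'' N']

theorem TangentAlg.lieMul_congr {A : TangentAlg E M} {X X' Z W : ∀ x : M, TangentSpace 𝓘(ℂ, E) x}
    {x : M} (hX : X =ᶠ[𝓝 x] X') : A.lieMul X Z W x = A.lieMul X' Z W x := by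
  have e : ∀ Y, mlieBracket 𝓘(ℂ, E) X Y x = mlieBracket 𝓘(ℂ, E) X' Y x := fun Y =>
    hX.mlieBracket_vectorField_eq (.refl _ Y)
  rw [lieMul, lieMul, e, e, e]

namespace TangentAlg.IsFIso

variable {A : TangentAlg E M} {B : TangentAlg E' N} {φ : OpenPartialHomeomorph M N}

theorem mdiff (h : A.IsFIso B φ) : φ.MDifferentiable 𝓘(ℂ, E) 𝓘(ℂ, E') :=
  ⟨h.hol.mdifferentiableOn (by simp), h.hol_symm.mdifferentiableOn (by simp)⟩

theorem contMDiffAt (h : A.IsFIso B φ) {x : M} (hx : x ∈ φ.source) :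
    ContMDiffAt 𝓘(ℂ, E) 𝓘(ℂ, E') ω φ x := h.hol.contMDiffAt (φ.open_source.mem_nhds hx)

theorem isInvertible (h : A.IsFIso B φ) {x : M} (hx : x ∈ φ.source) :
    (mfderiv 𝓘(ℂ, E) 𝓘(ℂ, E') φ x).IsInvertible := ⟨h.mdiff.mfderiv hx, rfl⟩

theorem mfderiv_symm_mfderiv (h : A.IsFIso B φ) {x : M} (hx : x ∈ φ.source)
    (a : TangentSpace 𝓘(ℂ, E) x) :
    mfderiv 𝓘(ℂ, E') 𝓘(ℂ, E) φ.symm (φ x) (mfderiv 𝓘(ℂ, E) 𝓘(ℂ, E') φ x a) = a :=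
  DFunLike.congr_fun (h.mdiff.symm_comp_deriv hx) a

theorem mfderiv_mfderiv_symm (h : A.IsFIso B φ) {y : N} (hy : y ∈ φ.target)
    (a : TangentSpace 𝓘(ℂ, E') y) :
    mfderiv 𝓘(ℂ, E) 𝓘(ℂ, E') φ (φ.symm y) (mfderiv 𝓘(ℂ, E') 𝓘(ℂ, E) φ.symm y a) = a :=
  DFunLike.congr_fun (h.mdiff.comp_symm_deriv hy) a

theorem mfderiv_mpullback (h : A.IsFIso B φ) {x : M} (hx : x ∈ φ.source)
    (X : ∀ y : N, TangentSpace 𝓘(ℂ, E') y) :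
    mfderiv 𝓘(ℂ, E) 𝓘(ℂ, E') φ x (mpullback 𝓘(ℂ, E) 𝓘(ℂ, E') φ X x) = X (φ x) := by
  obtain ⟨L, hL⟩ := h.isInvertible hx
  rw [mpullback_apply, ← hL, ContinuousLinearMap.inverse_equiv]
  exact L.apply_symm_apply _

theorem symm (h : A.IsFIso B φ) : B.IsFIso A φ.symm where
  hol := h.hol_symm
  hol_symm := by simpa using h.hol
  map_mul y hy a b := by
    have hs := φ.map_target hy
    refine h.mdiff.mfderiv_injective hs ?_
    rw [h.map_mul _ hs, h.mfderiv_mfderiv_symm hy, h.mfderiv_mfderiv_symm hy,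
      h.mfderiv_mfderiv_symm hy, φ.right_inv hy]
  map_unit y hy := by
    have hs := φ.map_target hy
    refine h.mdiff.mfderiv_injective hs ?_
    rw [h.map_unit _ hs, h.mfderiv_mfderiv_symm hy, φ.right_inv hy]

theorem trans (h : A.IsFIso B φ) {C : TangentAlg E'' N'} {χ : OpenPartialHomeomorph N N'}
    (h' : B.IsFIso C χ) : A.IsFIso C (φ.trans χ) := by
  have hd : ∀ x ∈ (φ.trans χ).source, ∀ a, mfderiv 𝓘(ℂ, E) 𝓘(ℂ, E'') (φ.trans χ) x a
      = mfderiv 𝓘(ℂ, E') 𝓘(ℂ, E'') χ (φ x) (mfderiv 𝓘(ℂ, E) 𝓘(ℂ, E') φ x a) := by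
    intro x hx a
    rw [φ.trans_source] at hx
    rw [φ.coe_trans, mfderiv_comp x (h'.mdiff.mdifferentiableAt hx.2)
      (h.mdiff.mdifferentiableAt hx.1)]
    rfl
  refine ⟨?_, ?_, fun x hx a b => ?_, fun x hx => ?_⟩
  · exact h'.hol.comp (h.hol.mono fun x hx => ((φ.trans_source χ).subset hx).1)
      fun x hx => ((φ.trans_source χ).subset hx).2
  · exact h.hol_symm.comp (h'.hol_symm.mono fun x hx => ((φ.trans_target χ).subset hx).1)
      fun x hx => ((φ.trans_target χ).subset hx).2
  · simp only [hd x hx]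
    rw [φ.trans_source] at hx
    rw [h.map_mul x hx.1, h'.map_mul _ hx.2]
    rfl
  · rw [hd x hx]
    rw [φ.trans_source] at hx
    rw [h.map_unit x hx.1, h'.map_unit _ hx.2]
    rfl

theorem restrOpen (h : A.IsFIso B φ) {s : Set M} (hs : IsOpen s) :
    A.IsFIso B (φ.restrOpen s hs) := by
  have hsub : (φ.restrOpen s hs).source ⊆ φ.source := by
    rw [φ.restrOpen_source]; exact Set.inter_subset_left
  refine ⟨h.hol.mono hsub, h.hol_symm.mono fun y hy => ?_,
    fun x hx => h.map_mul x (hsub hx), fun x hx => h.map_unit x (hsub hx)⟩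
  exact hy.1

theorem fieldMul_mpullback (h : A.IsFIso B φ) (X Y : ∀ y : N, TangentSpace 𝓘(ℂ, E') y) {x : M}
    (hx : x ∈ φ.source) :
    A.fieldMul (mpullback 𝓘(ℂ, E) 𝓘(ℂ, E') φ X) (mpullback 𝓘(ℂ, E) 𝓘(ℂ, E') φ Y) x
      = mpullback 𝓘(ℂ, E) 𝓘(ℂ, E') φ (B.fieldMul X Y) x := by
  refine h.mdiff.mfderiv_injective hx ?_
  rw [h.mfderiv_mpullback hx, fieldMul, h.map_mul x hx, h.mfderiv_mpullback hx,
    h.mfderiv_mpullback hx, fieldMul]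

theorem mpullback_mpullback_symm (h : A.IsFIso B φ) (X : ∀ x : M, TangentSpace 𝓘(ℂ, E) x) {x : M}
    (hx : x ∈ φ.source) :
    mpullback 𝓘(ℂ, E) 𝓘(ℂ, E') φ (mpullback 𝓘(ℂ, E') 𝓘(ℂ, E) φ.symm X) x = X x := by
  refine h.mdiff.mfderiv_injective hx ?_
  rw [h.mfderiv_mpullback hx]
  have h1 := h.symm.mfderiv_mpullback (φ.map_source hx) X
  have h2 : φ.symm (φ x) = x := φ.left_inv hx
  refine h.symm.mdiff.mfderiv_injective (φ.map_source hx) ?_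
  rw [h1, h.mfderiv_symm_mfderiv hx, h2]

variable [IsManifold 𝓘(ℂ, E) ω M] [IsManifold 𝓘(ℂ, E') ω N] [CompleteSpace E]

theorem holField_mpullback (h : A.IsFIso B φ) {X : ∀ y : N, TangentSpace 𝓘(ℂ, E') y} {V : Set N}
    (hV : IsOpen V) (hX : HolField E' V X) :
    HolField E (φ.source ∩ φ ⁻¹' V) (mpullback 𝓘(ℂ, E) 𝓘(ℂ, E') φ X) := by
  rintro x ⟨hx, hxV⟩
  have : IsManifold 𝓘(ℂ, E) (ω + 1) M := inferInstanceAs (IsManifold 𝓘(ℂ, E) ω M)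
  have : IsManifold 𝓘(ℂ, E') (ω + 1) N := inferInstanceAs (IsManifold 𝓘(ℂ, E') ω N)
  exact (ContMDiffAt.mpullback_vectorField_preimage (n := ω) (hX.contMDiffAt (hV.mem_nhds hxV))
    (h.contMDiffAt hx) (h.isInvertible hx) le_rfl).contMDiffWithinAt

theorem mlieBracket_mpullback (h : A.IsFIso B φ) {X Y : ∀ y : N, TangentSpace 𝓘(ℂ, E') y}
    {V : Set N} (hV : IsOpen V) (hX : HolField E' V X) (hY : HolField E' V Y) {x : M}
    (hx : x ∈ φ.source) (hxV : φ x ∈ V) :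
    mlieBracket 𝓘(ℂ, E) (mpullback 𝓘(ℂ, E) 𝓘(ℂ, E') φ X) (mpullback 𝓘(ℂ, E) 𝓘(ℂ, E') φ Y) x
      = mpullback 𝓘(ℂ, E) 𝓘(ℂ, E') φ (mlieBracket 𝓘(ℂ, E') X Y) x := by
  have : IsManifold 𝓘(ℂ, E) (minSmoothness ℂ 2) M := .of_le (n := ω) (by simp)
  have : IsManifold 𝓘(ℂ, E') (minSmoothness ℂ 2) N := .of_le (n := ω) (by simp)
  exact (mpullback_mlieBracket (n := ω)
    ((hX.contMDiffAt (hV.mem_nhds hxV)).mdifferentiableAt (by simp))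
    ((hY.contMDiffAt (hV.mem_nhds hxV)).mdifferentiableAt (by simp))
    (h.contMDiffAt hx) (by simp)).symm

/-- Brackets commute with pullback and φ respects products. Holomorphy of Z∘W is a separate
assumption because the bracket [X, Z∘W] must be transported before the multiplication `B` is known
to be holomorphic. -/
theorem lieMul_mpullback (h : A.IsFIso B φ) {X Z W : ∀ y : N, TangentSpace 𝓘(ℂ, E') y}
    {V : Set N} (hV : IsOpen V) (hX : HolField E' V X) (hZ : HolField E' V Z)
    (hW : HolField E' V W) (hZW : HolField E' V (B.fieldMul Z W)) {x : M}
    (hx : x ∈ φ.source) (hxV : φ x ∈ V) :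
    mfderiv 𝓘(ℂ, E) 𝓘(ℂ, E') φ x (A.lieMul (mpullback 𝓘(ℂ, E) 𝓘(ℂ, E') φ X)
      (mpullback 𝓘(ℂ, E) 𝓘(ℂ, E') φ Z) (mpullback 𝓘(ℂ, E) 𝓘(ℂ, E') φ W) x)
      = B.lieMul X Z W (φ x) := by
  have h1 : A.fieldMul (mpullback 𝓘(ℂ, E) 𝓘(ℂ, E') φ Z) (mpullback 𝓘(ℂ, E) 𝓘(ℂ, E') φ W)
      =ᶠ[𝓝 x] mpullback 𝓘(ℂ, E) 𝓘(ℂ, E') φ (B.fieldMul Z W) := by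
    filter_upwards [φ.open_source.mem_nhds hx] with y hy using h.fieldMul_mpullback Z W hy
  rw [lieMul, map_sub, map_sub, h.map_mul x hx, h.map_mul x hx,
    (Filter.EventuallyEq.refl _ _).mlieBracket_vectorField_eq h1,
    h.mlieBracket_mpullback hV hX hZW hx hxV, h.mlieBracket_mpullback hV hX hZ hx hxV,
    h.mlieBracket_mpullback hV hX hW hx hxV, h.mfderiv_mpullback hx, h.mfderiv_mpullback hx,
    h.mfderiv_mpullback hx, h.mfderiv_mpullback hx, h.mfderiv_mpullback hx, lieMul]

end TangentAlg.IsFIso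

end Transport

/-! ### F-manifold structures and Euler fields in charts. -/

section Linear

open VectorField

variable {F : Type*} [NormedAddCommGroup F] [NormedSpace ℂ F]

theorem holField_iff_contDiffOn {V : Set F} {X : F → F} :
    HolField F V X ↔ ContDiffOn ℂ ω X V :=
  contMDiffOn_vectorSpace_iff_contDiffOn

theorem mlieBracket_eq_lieBracket (X Y : F → F) (x : F) :
    mlieBracket 𝓘(ℂ, F) X Y x = lieBracket ℂ X Y x :=
  (congrFun mlieBracketWithin_eq_lieBracketWithin x).trans (congrFun lieBracketWithin_univ x)

variable {E : Type*} [NormedAddCommGroup E] [NormedSpace ℂ E]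
  {M : Type*} [TopologicalSpace M] [ChartedSpace E M]

/-- The multiplication of `M` can be pushed forward along a chart. -/
theorem TangentAlg.exists_pushforward (A : TangentAlg E M) {φ : OpenPartialHomeomorph M F}
    (h1 : ContMDiffOn 𝓘(ℂ, E) 𝓘(ℂ, F) ω φ φ.source)
    (h2 : ContMDiffOn 𝓘(ℂ, F) 𝓘(ℂ, E) ω φ.symm φ.target) {p : M} (hp : p ∈ φ.source) :
    ∃ B : TangentAlg F F, A.IsFIso B φ := by
  -- A multiplication must be given at every point of `F`. Outside the target of the chart, the
  -- algebra T_pM transported by the derivative at p serves as a default.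
  have hr : ∀ y : F, ∃ x, x ∈ φ.source ∧ (y ∈ φ.target → x = φ.symm y) := fun y => by
    by_cases hy : y ∈ φ.target
    · exact ⟨φ.symm y, φ.map_target hy, fun _ => rfl⟩
    · exact ⟨p, hp, fun h => (hy h).elim⟩
  choose r hrs hrt using hr
  have hm : φ.MDifferentiable 𝓘(ℂ, E) 𝓘(ℂ, F) :=
    ⟨h1.mdifferentiableOn (by simp), h2.mdifferentiableOn (by simp)⟩
  let L : ∀ y, TangentSpace 𝓘(ℂ, E) (r y) ≃L[ℂ] F := fun y => hm.mfderiv (hrs y)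
  let B : TangentAlg F F :=
    { mul := fun y => (LinearMap.mk₂ ℂ
        (fun a b : F => L y (A.mul (r y) ((L y).symm a) ((L y).symm b)))
        (fun (a a' b : F) => by rw [map_add, LinearMap.map_add₂, map_add])
        (fun (c : ℂ) (a b : F) => by rw [map_smul, LinearMap.map_smul₂, map_smul])
        (fun (a b b' : F) => by rw [map_add, map_add, map_add])
        (fun (c : ℂ) (a b : F) => by rw [map_smul, map_smul, map_smul]) :
          F →ₗ[ℂ] F →ₗ[ℂ] F)
      unit := fun y => L y (A.unit (r y))
      mul_comm := fun y a b => congrArg (L y) (A.mul_comm _ _ _)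
      mul_assoc := fun y a b c => by
        change L y (A.mul _ ((L y).symm (L y _)) _) = L y (A.mul _ _ ((L y).symm (L y _)))
        rw [(L y).symm_apply_apply, (L y).symm_apply_apply, A.mul_assoc]
      unit_mul := fun y a => by
        change L y (A.mul _ ((L y).symm (L y _)) _) = a
        rw [(L y).symm_apply_apply, A.unit_mul]
        exact (L y).apply_symm_apply a }
  have hrx : ∀ x ∈ φ.source, r (φ x) = x := fun x hx => by
    rw [hrt _ (φ.map_source hx), φ.left_inv hx]
  have key : ∀ x y, r y = x → (∀ a b, mfderiv 𝓘(ℂ, E) 𝓘(ℂ, F) φ x (A.mul x a b)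
      = B.mul y (mfderiv 𝓘(ℂ, E) 𝓘(ℂ, F) φ x a) (mfderiv 𝓘(ℂ, E) 𝓘(ℂ, F) φ x b)) ∧
      mfderiv 𝓘(ℂ, E) 𝓘(ℂ, F) φ x (A.unit x) = B.unit y := by
    rintro _ y rfl
    refine ⟨fun a b => ?_, rfl⟩
    change L y (A.mul _ a b) = L y (A.mul _ ((L y).symm (L y a)) ((L y).symm (L y b)))
    rw [(L y).symm_apply_apply, (L y).symm_apply_apply]
  exact ⟨B, h1, h2, fun x hx => (key x (φ x) (hrx x hx)).1, fun x hx => (key x _ (hrx x hx)).2⟩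

theorem TangentAlg.IsFIso.fieldMul_eqOn {A : TangentAlg E M} {B : TangentAlg F F}
    {φ : OpenPartialHomeomorph M F} (h : A.IsFIso B φ)
    (X Y : ∀ y : F, TangentSpace 𝓘(ℂ, F) y) {y : F} (hy : y ∈ φ.target) :
    mpullback 𝓘(ℂ, F) 𝓘(ℂ, E) φ.symm (A.fieldMul (mpullback 𝓘(ℂ, E) 𝓘(ℂ, F) φ X)
      (mpullback 𝓘(ℂ, E) 𝓘(ℂ, F) φ Y)) y = B.fieldMul X Y y := by
  rw [← h.symm.fieldMul_mpullback _ _ hy]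
  have h1 := h.symm.mpullback_mpullback_symm X hy
  have h2 := h.symm.mpullback_mpullback_symm Y hy
  rw [φ.symm_symm] at h1 h2
  unfold fieldMul
  rw [h1, h2]

variable [FiniteDimensional ℂ F]

/-- The multiplication on the tangent spaces of a vector space as a family of continuous bilinear
maps. -/
noncomputable def TangentAlg.cmul (B : TangentAlg F F) (x : F) : F →L[ℂ] F →L[ℂ] F :=
  LinearMap.toContinuousLinearMap
    ((LinearMap.toContinuousLinearMap : (F →ₗ[ℂ] F) ≃ₗ[ℂ] (F →L[ℂ] F)).toLinearMap ∘ₗ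
      (B.mul x : F →ₗ[ℂ] F →ₗ[ℂ] F))

theorem TangentAlg.lieMul_eq_lieDerivMul (B : TangentAlg F F) (X Z W : F → F) (x : F) :
    B.lieMul X Z W x = lieDerivMul B.cmul X Z W x := by
  unfold TangentAlg.lieMul lieDerivMul
  rw [← mlieBracket_eq_lieBracket, ← mlieBracket_eq_lieBracket, ← mlieBracket_eq_lieBracket]
  rfl

theorem TangentAlg.isFStructure_of_hol {B : TangentAlg F F} {U : Set F} (hU : IsOpen U)
    (hmul : ∀ X Y : (∀ y : F, TangentSpace 𝓘(ℂ, F) y),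
      HolField F U X → HolField F U Y → HolField F U (B.fieldMul X Y))
    (hunit : HolField F U B.unit)
    (hlie : ∀ V : Set F, IsOpen V → V ⊆ U → ∀ X Y Z W : (∀ y : F, TangentSpace 𝓘(ℂ, F) y),
      HolField F V X → HolField F V Y → HolField F V Z → HolField F V W → ∀ x ∈ V,
      B.lieMul (B.fieldMul X Y) Z W x
        = B.mul x (X x) (B.lieMul Y Z W x) + B.mul x (Y x) (B.lieMul X Z W x)) :
    IsFStructure B.cmul B.unit U where
  isOpen := hU
  comm := B.mul_comm
  assoc := B.mul_assoc
  unit_mul := B.unit_mul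
  hol_mul := by
    -- In finite dimension a family of bilinear maps is holomorphic once its values on constant
    -- fields are.
    refine contDiffOn_clm_apply.2 fun a => contDiffOn_clm_apply.2 fun b => ?_
    exact holField_iff_contDiffOn.1 (hmul (fun _ => a) (fun _ => b)
      (holField_iff_contDiffOn.2 contDiffOn_const) (holField_iff_contDiffOn.2 contDiffOn_const))
  hol_unit := holField_iff_contDiffOn.1 hunit
  lie_mul V hV hVU X Y Z W hX hY hZ hW x hx := by
    have := hlie V hV hVU X Y Z W (holField_iff_contDiffOn.2 hX) (holField_iff_contDiffOn.2 hY)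
      (holField_iff_contDiffOn.2 hZ) (holField_iff_contDiffOn.2 hW) x hx
    exact (B.lieMul_eq_lieDerivMul _ Z W x).symm.trans (this.trans (congrArg₂ (· + ·)
      (congrArg (B.cmul x (X x)) (B.lieMul_eq_lieDerivMul Y Z W x))
      (congrArg (B.cmul x (Y x)) (B.lieMul_eq_lieDerivMul X Z W x))))

theorem TangentAlg.IsFManifoldOn.isFStructure {B : TangentAlg F F} {U : Set F}
    (hB : B.IsFManifoldOn U) : IsFStructure B.cmul B.unit U :=
  TangentAlg.isFStructure_of_hol hB.isOpen (hB.hol_mul U hB.isOpen subset_rfl) hB.hol_unit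
    hB.lie_mul

theorem IsFStructure.isFManifoldOn {B : TangentAlg F F} {U : Set F}
    (H : IsFStructure B.cmul B.unit U) (hc : IsConnected U) (hd : 1 ≤ Module.finrank ℂ F) :
    B.IsFManifoldOn U where
  isOpen := H.isOpen
  isConnected := hc
  one_le_dim := hd
  hol_mul V _ hVU X Y hX hY := holField_iff_contDiffOn.2
    (((H.hol_mul.mono hVU).clm_apply (holField_iff_contDiffOn.1 hX)).clm_apply
      (holField_iff_contDiffOn.1 hY))
  hol_unit := holField_iff_contDiffOn.2 H.hol_unit
  lie_mul V hV hVU X Y Z W hX hY hZ hW x hx := by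
    have := H.lie_mul V hV hVU X Y Z W (holField_iff_contDiffOn.1 hX)
      (holField_iff_contDiffOn.1 hY) (holField_iff_contDiffOn.1 hZ)
      (holField_iff_contDiffOn.1 hW) x hx
    exact (B.lieMul_eq_lieDerivMul _ Z W x).trans (this.trans (congrArg₂ (· + ·)
      (congrArg (B.cmul x (X x)) (B.lieMul_eq_lieDerivMul Y Z W x).symm)
      (congrArg (B.cmul x (Y x)) (B.lieMul_eq_lieDerivMul X Z W x).symm)))

variable [IsManifold 𝓘(ℂ, E) ω M] [CompleteSpace E]

/-- The fields are pulled back to `M`, multiplied there, and the product is pulled back along the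
inverse chart. -/
theorem TangentAlg.IsFIso.holField_fieldMul {A : TangentAlg E M} {B : TangentAlg F F}
    {φ : OpenPartialHomeomorph M F} (h : A.IsFIso B φ) {U : Set M} (hA : A.IsFManifoldOn U)
    (hφ : φ.source ⊆ U) {V : Set F} (hV : IsOpen V) (hVφ : V ⊆ φ.target)
    {X Y : ∀ y : F, TangentSpace 𝓘(ℂ, F) y}
    (hX : HolField F V X) (hY : HolField F V Y) : HolField F V (B.fieldMul X Y) := by
  have hW : IsOpen (φ.source ∩ φ ⁻¹' V) := φ.isOpen_inter_preimage hV
  have h1 := hA.hol_mul _ hW (Set.inter_subset_left.trans hφ) _ _ (h.holField_mpullback hV hX)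
    (h.holField_mpullback hV hY)
  have h2 := h.symm.holField_mpullback hW h1
  refine (h2.mono fun y hy => ?_).congr fun y hy => ?_
  · refine ⟨hVφ hy, φ.map_target (hVφ hy), ?_⟩
    rw [Set.mem_preimage, φ.right_inv (hVφ hy)]
    exact hy
  · rw [h.fieldMul_eqOn X Y (hVφ hy)]

/-- The multiplication of an F-manifold, written in a chart. -/
theorem TangentAlg.IsFIso.isFStructure {A : TangentAlg E M} {B : TangentAlg F F}
    {φ : OpenPartialHomeomorph M F} (h : A.IsFIso B φ) {U : Set M} (hA : A.IsFManifoldOn U)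
    (hφ : φ.source ⊆ U) : IsFStructure B.cmul B.unit φ.target := by
  refine isFStructure_of_hol φ.open_target
    (fun X Y hX hY => h.holField_fieldMul hA hφ φ.open_target subset_rfl hX hY) ?_ ?_
  · have h2 := h.symm.holField_mpullback hA.isOpen hA.hol_unit
    refine (h2.mono fun y hy => ?_).congr fun y hy => ?_
    · exact ⟨hy, hφ (φ.map_target hy)⟩
    · congr 1
      refine h.symm.mdiff.mfderiv_injective hy ?_
      rw [h.symm.mfderiv_mpullback hy, h.symm.map_unit _ hy]
  · intro V hV hVφ X Y Z W hX hY hZ hW y hy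
    have hyt := hVφ hy
    obtain ⟨x, hx, rfl⟩ : ∃ x ∈ φ.source, φ x = y := ⟨_, φ.map_target hyt, φ.right_inv hyt⟩
    have hXY := h.holField_fieldMul hA hφ hV hVφ hX hY
    have hZW := h.holField_fieldMul hA hφ hV hVφ hZ hW
    have h0 := hA.lie_mul _ (φ.isOpen_inter_preimage hV) (Set.inter_subset_left.trans hφ) _ _ _ _
      (h.holField_mpullback hV hX) (h.holField_mpullback hV hY) (h.holField_mpullback hV hZ)
      (h.holField_mpullback hV hW) x ⟨hx, hy⟩
    have he : A.fieldMul (mpullback 𝓘(ℂ, E) 𝓘(ℂ, F) φ X) (mpullback 𝓘(ℂ, E) 𝓘(ℂ, F) φ Y)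
        =ᶠ[𝓝 x] mpullback 𝓘(ℂ, E) 𝓘(ℂ, F) φ (B.fieldMul X Y) := by
      filter_upwards [φ.open_source.mem_nhds hx] with z hz using h.fieldMul_mpullback X Y hz
    replace h0 := (lieMul_congr he).symm.trans h0
    have h2 := congrArg (mfderiv 𝓘(ℂ, E) 𝓘(ℂ, F) φ x) h0
    rw [map_add, h.map_mul x hx, h.map_mul x hx, h.lieMul_mpullback hV hXY hZ hW hZW hx hy,
      h.lieMul_mpullback hV hX hZ hW hZW hx hy, h.lieMul_mpullback hV hY hZ hW hZW hx hy,
      h.mfderiv_mpullback hx, h.mfderiv_mpullback hx] at h2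
    exact h2

/-- The push-forward of an Euler field along a chart. -/
theorem TangentAlg.IsFIso.euler {A : TangentAlg E M} {B : TangentAlg F F}
    {φ : OpenPartialHomeomorph M F} (h : A.IsFIso B φ) {U : Set M} (hA : A.IsFManifoldOn U)
    (hφ : φ.source ⊆ U) {d : ℂ} {X : ∀ x : M, TangentSpace 𝓘(ℂ, E) x}
    (hX : A.IsEulerOn d X φ.source) :
    ContDiffOn ℂ ω (mpullback 𝓘(ℂ, F) 𝓘(ℂ, E) φ.symm X) φ.target ∧
    ∀ V : Set F, IsOpen V → V ⊆ φ.target → ∀ Z W : F → F, ContDiffOn ℂ ω Z V →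
      ContDiffOn ℂ ω W V → ∀ y ∈ V,
      lieDerivMul B.cmul (mpullback 𝓘(ℂ, F) 𝓘(ℂ, E) φ.symm X) Z W y
        = d • B.cmul y (Z y) (W y) := by
  have hX' : HolField F φ.target (mpullback 𝓘(ℂ, F) 𝓘(ℂ, E) φ.symm X) :=
    (h.symm.holField_mpullback φ.open_source hX.hol).mono fun y hy => ⟨hy, φ.map_target hy⟩
  suffices key : ∀ V : Set F, IsOpen V → V ⊆ φ.target →
      ∀ Z W : (∀ y : F, TangentSpace 𝓘(ℂ, F) y), HolField F V Z → HolField F V W → ∀ y ∈ V,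
      B.lieMul (mpullback 𝓘(ℂ, F) 𝓘(ℂ, E) φ.symm X) Z W y = d • B.mul y (Z y) (W y) from
    ⟨holField_iff_contDiffOn.1 hX', fun V hV hVφ Z W hZ hW y hy =>
      (B.lieMul_eq_lieDerivMul _ Z W y).symm.trans (key V hV hVφ Z W
        (holField_iff_contDiffOn.2 hZ) (holField_iff_contDiffOn.2 hW) y hy)⟩
  intro V hV hVφ Z W hZ hW y hy
  have hyt := hVφ hy
  obtain ⟨x, hx, rfl⟩ : ∃ x ∈ φ.source, φ x = y := ⟨_, φ.map_target hyt, φ.right_inv hyt⟩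
  have hZW := h.holField_fieldMul hA hφ hV hVφ hZ hW
  have h0 := hX.lie_mul _ (φ.isOpen_inter_preimage hV) Set.inter_subset_left _ _
    (h.holField_mpullback hV hZ) (h.holField_mpullback hV hW) x ⟨hx, hy⟩
  have he : X =ᶠ[𝓝 x]
      mpullback 𝓘(ℂ, E) 𝓘(ℂ, F) φ (mpullback 𝓘(ℂ, F) 𝓘(ℂ, E) φ.symm X) := by
    filter_upwards [φ.open_source.mem_nhds hx] with z hz
      using (h.mpullback_mpullback_symm X hz).symm
  replace h0 := (lieMul_congr he).symm.trans h0
  have h2 := congrArg (mfderiv 𝓘(ℂ, E) 𝓘(ℂ, F) φ x) h0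
  rw [map_smul, h.map_mul x hx, h.lieMul_mpullback hV (hX'.mono hVφ) hZ hW hZW hx hy,
    h.mfderiv_mpullback hx, h.mfderiv_mpullback hx] at h2
  exact h2

end Linear

/-! ### Idempotents and locality in the eigenspace decomposition. -/

section Eigenspaces

variable {E : Type*} [NormedAddCommGroup E] [NormedSpace ℂ E]
  {M : Type*} [TopologicalSpace M] [ChartedSpace E M]

namespace TangentAlg

variable (A : TangentAlg E M) (p : M)

theorem commute_mul (a b : TangentSpace 𝓘(ℂ, E) p) :
    Commute (A.mul p a : Module.End ℂ (TangentSpace 𝓘(ℂ, E) p)) (A.mul p b) := by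
  refine LinearMap.ext fun c => ?_
  change A.mul p a (A.mul p b c) = A.mul p b (A.mul p a c)
  rw [← A.mul_assoc, ← A.mul_assoc, A.mul_comm p b a]

theorem mul_mem_simEigenspace {χ : TangentSpace 𝓘(ℂ, E) p → ℂ} (a : TangentSpace 𝓘(ℂ, E) p)
    {b : TangentSpace 𝓘(ℂ, E) p} (hb : b ∈ A.simEigenspace p χ) :
    A.mul p a b ∈ A.simEigenspace p χ := by
  rw [simEigenspace, Submodule.mem_iInf] at hb ⊢
  exact fun c => Module.End.mapsTo_maxGenEigenspace_of_comm (A.commute_mul p c a) _ (hb c)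

theorem iSupIndep_simEigenspace : iSupIndep (A.simEigenspace p) :=
  Module.End.independent_iInf_maxGenEigenspace_of_forall_mapsTo
    (fun a : TangentSpace 𝓘(ℂ, E) p => (A.mul p a : Module.End ℂ (TangentSpace 𝓘(ℂ, E) p)))
    fun a b φ => Module.End.mapsTo_maxGenEigenspace_of_comm (A.commute_mul p b a) φ

theorem eq_zero_of_mem_eigenspace {j k : A.Weight p} (hjk : j ≠ k) {a : TangentSpace 𝓘(ℂ, E) p}
    (hj : a ∈ A.eigenspace p j) (hk : a ∈ A.eigenspace p k) : a = 0 :=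
  Submodule.disjoint_def.1 ((A.iSupIndep_simEigenspace p).pairwiseDisjoint
    (Subtype.coe_injective.ne hjk)) a hj hk

variable [FiniteDimensional ℂ E]

instance : FiniteDimensional ℂ (TangentSpace 𝓘(ℂ, E) p) :=
  inferInstanceAs (FiniteDimensional ℂ E)

theorem iSup_eigenspace : ⨆ k, A.eigenspace p k = ⊤ := by
  have h : ⨆ χ, A.simEigenspace p χ = ⊤ := by
    refine Module.End.iSup_iInf_maxGenEigenspace_eq_top_of_forall_mapsTo
      (fun a : TangentSpace 𝓘(ℂ, E) p => (A.mul p a : Module.End ℂ (TangentSpace 𝓘(ℂ, E) p)))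
      (fun a b φ => Module.End.mapsTo_maxGenEigenspace_of_comm (A.commute_mul p b a) φ)
      fun a => Module.End.iSup_maxGenEigenspace_eq_top _
  rw [eq_top_iff, ← h]
  refine iSup_le fun χ => ?_
  by_cases hχ : A.simEigenspace p χ = ⊥
  · rw [hχ]; exact bot_le
  · exact le_iSup (A.eigenspace p) ⟨χ, hχ⟩

/-- The eigenspaces are the ideals generated by orthogonal idempotents. -/
theorem exists_idempotents : ∃ ε : A.Weight p → TangentSpace 𝓘(ℂ, E) p,
    ∑ k, ε k = A.unit p ∧ (∀ j k, j ≠ k → A.mul p (ε j) (ε k) = 0) ∧ (∀ k, ε k ≠ 0) ∧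
    ∀ k a, a ∈ A.eigenspace p k ↔ A.mul p (ε k) a = a := by
  -- The idempotents are the components of the unit. Eigenspaces are ideals and meet pairwise in 0,
  -- so the product of elements of two different ones is 0, and each component acts as a unit on its
  -- own eigenspace.
  have hu : A.unit p ∈ ⨆ k, A.eigenspace p k := by rw [iSup_eigenspace]; trivial
  obtain ⟨f, hf, hfu⟩ := (Submodule.mem_iSup_iff_exists_finsupp _ _).1 hu
  have hsum : ∑ k, f k = A.unit p := by
    rw [← hfu]
    exact (f.sum_fintype (fun _ x => x) fun _ => rfl).symm
  have hmem : ∀ k a, a ∈ A.eigenspace p k ↔ A.mul p (f k) a = a := by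
    refine fun k a => ⟨fun ha => ?_, fun ha => ?_⟩
    · conv_rhs => rw [← A.unit_mul p a, ← hsum, map_sum, LinearMap.sum_apply]
      rw [Finset.sum_eq_single k]
      · intro j _ hjk
        refine A.eq_zero_of_mem_eigenspace p hjk ?_ (A.mul_mem_simEigenspace p _ ha)
        rw [A.mul_comm]
        exact A.mul_mem_simEigenspace p _ (hf j)
      · simp
    · rw [← ha, A.mul_comm]
      exact A.mul_mem_simEigenspace p _ (hf k)
  refine ⟨f, hsum, fun j k hjk => ?_, fun k hk => ?_, hmem⟩
  · refine A.eq_zero_of_mem_eigenspace p hjk ?_ (A.mul_mem_simEigenspace p _ (hf k))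
    rw [A.mul_comm]
    exact A.mul_mem_simEigenspace p _ (hf j)
  · refine k.2 ((Submodule.eq_bot_iff _).2 fun a ha => ?_)
    rw [← (hmem k a).1 ha, hk, map_zero, LinearMap.zero_apply]

/-- In an eigenspace, an element is invertible or nilpotent, according to its eigenvalue. -/
theorem exists_inverse_of_ne_zero (k : A.Weight p) {a ε : TangentSpace 𝓘(ℂ, E) p}
    (hε : ε ∈ A.eigenspace p k) (hχ : k.1 a ≠ 0) : ∃ c, A.mul p a c = ε := by
  let W := A.eigenspace p k
  have hmaps : ∀ w ∈ W, A.mul p a w ∈ W := fun w hw => A.mul_mem_simEigenspace p a hw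
  -- A vector killed by a∘ belongs to the generalized eigenspaces for 0 and for χ(a) ≠ 0, hence is
  -- 0. Surjectivity follows by finite dimension.
  have hinj : Function.Injective ((A.mul p a).restrict hmaps) := by
    rw [← LinearMap.ker_eq_bot, Submodule.eq_bot_iff]
    intro w hw
    have hw0 : A.mul p a w = 0 := congrArg Subtype.val (LinearMap.mem_ker.1 hw)
    have h1 : (w : TangentSpace 𝓘(ℂ, E) p) ∈ Module.End.maxGenEigenspace (A.mul p a) (k.1 a) :=
      (Submodule.mem_iInf _).1 w.2 a
    have h2 : (w : TangentSpace 𝓘(ℂ, E) p) ∈ Module.End.maxGenEigenspace (A.mul p a) 0 := by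
      rw [Module.End.mem_maxGenEigenspace]
      exact ⟨1, by simp [hw0]⟩
    exact Subtype.ext (Submodule.disjoint_def.1
      (Module.End.disjoint_genEigenspace (A.mul p a) hχ ⊤ ⊤) _ h1 h2)
  obtain ⟨c, hc⟩ := LinearMap.injective_iff_surjective.1 hinj ⟨ε, hε⟩
  exact ⟨c, congrArg Subtype.val hc⟩

/-- If neither a nor b is invertible, both have eigenvalue 0. The last nonzero power a^n∘ε is then
some v with a∘v = 0, so b∘v = ε∘v = v, contradicting the eigenvalue 0 of b. Additivity of χ is not
needed. -/
theorem isLocal_eigenspace (k : A.Weight p) {ε : TangentSpace 𝓘(ℂ, E) p}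
    (hε : ∀ a, a ∈ A.eigenspace p k ↔ A.mul p ε a = a) (hεk : ε ∈ A.eigenspace p k) (hε0 : ε ≠ 0)
    {a b : TangentSpace 𝓘(ℂ, E) p} (hab : a + b = ε) :
    (∃ c, A.mul p a c = ε) ∨ (∃ c, A.mul p b c = ε) := by
  by_contra! hcon
  have ha : k.1 a = 0 := by
    by_contra h; obtain ⟨c, hc⟩ := A.exists_inverse_of_ne_zero p k hεk h; exact hcon.1 c hc
  have hb : k.1 b = 0 := by
    by_contra h; obtain ⟨c, hc⟩ := A.exists_inverse_of_ne_zero p k hεk h; exact hcon.2 c hc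
  have h1 : ε ∈ Module.End.maxGenEigenspace (A.mul p a) (k.1 a) := (Submodule.mem_iInf _).1 hεk a
  rw [ha, Module.End.mem_maxGenEigenspace, zero_smul, sub_zero] at h1
  obtain ⟨v, hvk, hv0, hav⟩ : ∃ v ∈ A.eigenspace p k, v ≠ 0 ∧ A.mul p a v = 0 := by
    classical
    let n := Nat.find h1
    have hn : ((A.mul p a : Module.End ℂ _) ^ n) ε = 0 := Nat.find_spec h1
    obtain ⟨n', hn'⟩ : ∃ n', n = n' + 1 := by
      refine Nat.exists_eq_succ_of_ne_zero fun h0 => hε0 ?_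
      rwa [h0, pow_zero] at hn
    refine ⟨((A.mul p a : Module.End ℂ _) ^ n') ε, ?_, Nat.find_min h1 (by omega), ?_⟩
    · clear hn hn'
      induction n' with
      | zero => exact hεk
      | succ i ih =>
        rw [pow_succ', Module.End.mul_apply]
        exact A.mul_mem_simEigenspace p a ih
    · rw [hn', pow_succ', Module.End.mul_apply] at hn
      exact hn
  have hbv : A.mul p b v = v := by
    rw [← eq_sub_iff_add_eq'] at hab
    rw [hab, map_sub, LinearMap.sub_apply, hav, sub_zero, (hε v).1 hvk]
  have h2 : v ∈ Module.End.maxGenEigenspace (A.mul p b) (k.1 b) := (Submodule.mem_iInf _).1 hvk b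
  have h3 : v ∈ Module.End.maxGenEigenspace (A.mul p b) 1 := by
    rw [Module.End.mem_maxGenEigenspace]
    exact ⟨1, by simp [hbv]⟩
  rw [hb] at h2
  exact hv0 (Submodule.disjoint_def.1
    (Module.End.disjoint_genEigenspace (A.mul p b) zero_ne_one ⊤ ⊤) _ h2 h3)

end TangentAlg

end Eigenspaces

/-! ### Structures on a product that respect the splitting of the tangent spaces. -/

section Product

open VectorField

section Split

variable {ι : Type*} [DecidableEq ι] {V : ι → Type*} [∀ k, NormedAddCommGroup (V k)]

/-- The `k`-th component of the unit field of an algebra structure on a product. -/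
noncomputable def unitComponent (u : (∀ k, V k) → ∀ k, V k) (k : ι) (z : ∀ k, V k) : ∀ k, V k :=
  Pi.single k (u z k)

theorem unitComponent_same (u : (∀ k, V k) → ∀ k, V k) (k : ι) (z : ∀ k, V k) :
    unitComponent u k z k = u z k := Pi.single_eq_same _ _

theorem unitComponent_of_ne (u : (∀ k, V k) → ∀ k, V k) {j k : ι} (h : j ≠ k) (z : ∀ k, V k) :
    unitComponent u k z j = 0 := Pi.single_eq_of_ne h _

variable [∀ k, NormedSpace ℂ (V k)]

/-- The multiplications respect the decomposition of the tangent spaces of a product. -/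
def IsSplit (m : (∀ k, V k) → (∀ k, V k) →L[ℂ] (∀ k, V k) →L[ℂ] ∀ k, V k)
    (u : (∀ k, V k) → ∀ k, V k) (U : Set (∀ k, V k)) : Prop :=
  ∀ z ∈ U, ∀ k a, m z (unitComponent u k z) a = Pi.single k (a k)

theorem IsSplit.idempotent_unitComponent
    {m : (∀ k, V k) → (∀ k, V k) →L[ℂ] (∀ k, V k) →L[ℂ] ∀ k, V k}
    {u : (∀ k, V k) → ∀ k, V k} {U : Set (∀ k, V k)} (hs : IsSplit m u U) {z : ∀ k, V k}
    (hz : z ∈ U) (k : ι) :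
    m z (unitComponent u k z) (unitComponent u k z) = unitComponent u k z := by
  rw [hs z hz, unitComponent, Pi.single_eq_same]

end Split

variable {ι : Type*} [Fintype ι] {V : ι → Type*} [∀ k, NormedAddCommGroup (V k)]
  [∀ k, NormedSpace ℂ (V k)]

theorem eq_of_fderiv_sub_eq_zero {F G : Type*} [NormedAddCommGroup F] [NormedSpace ℂ F]
    [NormedAddCommGroup G] [NormedSpace ℂ G] {g : F → G} {s : Set F} (hs : Convex ℝ s)
    (hg : ∀ x ∈ s, DifferentiableAt ℂ g x) {z z' : F} (hz : z ∈ s) (hz' : z' ∈ s)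
    (h : ∀ x ∈ s, fderiv ℂ g x (z' - z) = 0) : g z' = g z := by
  have hmem : ∀ t ∈ Set.Icc (0 : ℝ) 1, z + t • (z' - z) ∈ s := fun t ht =>
    hs.add_smul_sub_mem hz hz' ht
  have hd : ∀ t ∈ Set.Icc (0 : ℝ) 1, HasDerivAt (fun t : ℝ => g (z + t • (z' - z))) 0 t := by
    intro t ht
    have h1 : HasDerivAt (fun t : ℝ => z + t • (z' - z)) (z' - z) t := by
      simpa using ((hasDerivAt_id t).smul_const (z' - z)).const_add z
    have h2 := ((hg _ (hmem t ht)).hasFDerivAt.restrictScalars ℝ).comp_hasDerivAt t h1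
    have h3 := h _ (hmem t ht)
    rw [← h3]
    exact h2
  have := constant_of_has_deriv_right_zero (f := fun t : ℝ => g (z + t • (z' - z))) (a := 0)
    (b := 1) (fun t ht => (hd t ht).continuousAt.continuousWithinAt)
    (fun t ht => (hd t ⟨ht.1, ht.2.le⟩).hasDerivWithinAt) 1 ⟨zero_le_one, le_rfl⟩
  simpa using this

/-- A component of a Lie bracket on a product. -/
theorem lieBracket_apply_of_comp {k : ι} {z : ∀ k, V k} {X Y : (∀ k, V k) → ∀ k, V k}
    {X' Y' : V k → V k} (hX : DifferentiableAt ℂ X z) (hY : DifferentiableAt ℂ Y z)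
    (hX' : DifferentiableAt ℂ X' (z k)) (hY' : DifferentiableAt ℂ Y' (z k))
    (hXX' : ∀ᶠ w in 𝓝 z, X w k = X' (w k)) (hYY' : ∀ᶠ w in 𝓝 z, Y w k = Y' (w k)) :
    lieBracket ℂ X Y z k = lieBracket ℂ X' Y' (z k) := by
  have key : ∀ {X : (∀ k, V k) → ∀ k, V k} {X' : V k → V k}, DifferentiableAt ℂ X z →
      DifferentiableAt ℂ X' (z k) → (∀ᶠ w in 𝓝 z, X w k = X' (w k)) →
      ∀ a, fderiv ℂ X z a k = fderiv ℂ X' (z k) (a k) := by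
    intro X X' hX hX' h a
    have h1 : HasFDerivAt (fun w => X w k) (ContinuousLinearMap.proj k ∘L fderiv ℂ X z) z :=
      (ContinuousLinearMap.proj (R := ℂ) (φ := V) k).hasFDerivAt.comp z hX.hasFDerivAt
    have h2 : HasFDerivAt (fun w : ∀ k, V k => X' (w k))
        (fderiv ℂ X' (z k) ∘L ContinuousLinearMap.proj k) z :=
      HasFDerivAt.comp (g := X') z hX'.hasFDerivAt
        (ContinuousLinearMap.proj (R := ℂ) (φ := V) k).hasFDerivAt
    exact DFunLike.congr_fun (h1.unique (h2.congr_of_eventuallyEq h)) a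
  rw [lieBracket, lieBracket, Pi.sub_apply, key hY hY' hYY', key hX hX' hXX', hXX'.self_of_nhds,
    hYY'.self_of_nhds]

/-- A component of the Lie derivative of the multiplication on a product. -/
theorem lieDerivMul_apply_of_comp {k : ι} {z : ∀ k, V k}
    {m : (∀ k, V k) → (∀ k, V k) →L[ℂ] (∀ k, V k) →L[ℂ] ∀ k, V k}
    {μ : V k → V k →L[ℂ] V k →L[ℂ] V k} {X Z W : (∀ k, V k) → ∀ k, V k} {X' Z' W' : V k → V k}
    (hm : DifferentiableAt ℂ m z) (hμ : DifferentiableAt ℂ μ (z k))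
    (hmμ : ∀ᶠ w in 𝓝 z, ∀ a b, m w a b k = μ (w k) (a k) (b k))
    (hX : DifferentiableAt ℂ X z) (hZ : DifferentiableAt ℂ Z z) (hW : DifferentiableAt ℂ W z)
    (hX' : DifferentiableAt ℂ X' (z k)) (hZ' : DifferentiableAt ℂ Z' (z k))
    (hW' : DifferentiableAt ℂ W' (z k)) (hXX' : ∀ᶠ w in 𝓝 z, X w k = X' (w k))
    (hZZ' : ∀ᶠ w in 𝓝 z, Z w k = Z' (w k)) (hWW' : ∀ᶠ w in 𝓝 z, W w k = W' (w k)) :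
    lieDerivMul m X Z W z k = lieDerivMul μ X' Z' W' (z k) := by
  have h1 : ∀ᶠ w in 𝓝 z, m w (Z w) (W w) k = μ (w k) (Z' (w k)) (W' (w k)) := by
    filter_upwards [hmμ, hZZ', hWW'] with w h1 h2 h3
    rw [h1, h2, h3]
  rw [lieDerivMul, lieDerivMul, Pi.sub_apply, Pi.sub_apply, hmμ.self_of_nhds, hmμ.self_of_nhds,
    lieBracket_apply_of_comp hX ((hm.clm_apply hZ).clm_apply hW) hX'
      ((hμ.clm_apply hZ').clm_apply hW') hXX' h1,
    lieBracket_apply_of_comp hX hZ hX' hZ' hXX' hZZ',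
    lieBracket_apply_of_comp hX hW hX' hW' hXX' hWW', hZZ'.self_of_nhds, hWW'.self_of_nhds]

variable [DecidableEq ι]

/-- A function on a convex subset of a product whose derivatives in the directions of all factors
but one vanish depends on the coordinate in this factor only. -/
theorem eq_of_fderiv_single_eq_zero {G : Type*} [NormedAddCommGroup G] [NormedSpace ℂ G]
    {g : (∀ k, V k) → G} {s : Set (∀ k, V k)} (hs : Convex ℝ s)
    (hg : ∀ x ∈ s, DifferentiableAt ℂ g x) {k : ι}
    (h : ∀ x ∈ s, ∀ j, j ≠ k → ∀ c : V j, fderiv ℂ g x (Pi.single j c) = 0)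
    {z z' : ∀ k, V k} (hz : z ∈ s) (hz' : z' ∈ s) (hk : z' k = z k) : g z' = g z := by
  refine eq_of_fderiv_sub_eq_zero hs hg hz hz' fun x hx => ?_
  rw [← Finset.univ_sum_single (z' - z), map_sum]
  refine Finset.sum_eq_zero fun j _ => ?_
  by_cases hj : j = k
  · subst hj
    rw [Pi.sub_apply, hk, sub_self, Pi.single_zero, map_zero]
  · exact h x hx j hj _

namespace IsFStructure

variable {m : (∀ k, V k) → (∀ k, V k) →L[ℂ] (∀ k, V k) →L[ℂ] ∀ k, V k}
  {u : (∀ k, V k) → ∀ k, V k} {U : Set (∀ k, V k)}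

/-- Vectors supported in factor k are the multiples e_k∘a, so this is e_k∘a∘e_k∘b = e_k∘a∘b. -/
theorem mul_single_single (H : IsFStructure m u U) (hs : IsSplit m u U) {z : ∀ k, V k}
    (hz : z ∈ U) (k : ι) (a b : ∀ k, V k) :
    m z (Pi.single k (a k)) (Pi.single k (b k)) = Pi.single k (m z a b k) := by
  rw [← hs z hz k a, ← hs z hz k b, H.assoc, H.comm z a, H.assoc, ← hs z hz, H.comm z b a]
  rw [hs z hz, hs z hz, Pi.single_eq_same]

theorem contDiffOn_unitComponent (H : IsFStructure m u U) (k : ι) :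
    ContDiffOn ℂ ω (unitComponent u k) U :=
  (ContinuousLinearMap.single ℂ V k).contDiff.comp_contDiffOn
    ((ContinuousLinearMap.proj (R := ℂ) (φ := V) k).contDiff.comp_contDiffOn H.hol_unit)

/-- In a split structure, the multiplication in one factor does not depend on the other
coordinates. -/
theorem fderiv_mul_single (H : IsFStructure m u U) (hs : IsSplit m u U) {z : ∀ k, V k}
    (hz : z ∈ U) {j k : ι} (hjk : j ≠ k) (c : V j) (a b : V k) :
    fderiv ℂ (fun w => m w (Pi.single k a) (Pi.single k b) k) z (Pi.single j c) = 0 := by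
  have hmz : DifferentiableAt ℂ (fun w => m w (Pi.single k a) (Pi.single k b)) z :=
    ((((H.hol_mul.clm_apply contDiffOn_const).clm_apply contDiffOn_const).contDiffAt
      (H.isOpen.mem_nhds hz)).differentiableAt (by simp))
  -- A constant field c in factor j satisfies e_j∘c = c, so Lie_c(∘) = e_j∘Lie_c(∘) has no
  -- k-component. On constant arguments, Lie_c(∘)(a, b) is the derivative of a∘b along c.
  have h1 := H.lieDerivMul_idempotent_mul H.isOpen subset_rfl (H.contDiffOn_unitComponent j)
    (fun z hz => hs.idempotent_unitComponent hz j) (X := fun _ => Pi.single j c)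
    (Z := fun _ => Pi.single k a) (W := fun _ => Pi.single k b)
    contDiffOn_const contDiffOn_const contDiffOn_const hz
  have hconst : ∀ a b : ∀ k, V k, lieBracket ℂ (fun _ => a) (fun _ => b) z = 0 := fun a b => by
    simp [lieBracket]
  rw [hs z hz, lieDerivMul_congr (X' := fun _ => Pi.single j c)
    (by filter_upwards [H.isOpen.mem_nhds hz] with w hw
        rw [hs w hw, Pi.single_eq_same]) .rfl .rfl] at h1
  have h2 := congrFun h1 k
  rw [Pi.single_eq_of_ne hjk.symm, lieDerivMul, hconst, hconst, map_zero, map_zero, zero_apply,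
    sub_zero, sub_zero, lieBracket] at h2
  have h3 : HasFDerivAt (fun w => m w (Pi.single k a) (Pi.single k b) k) _ z :=
    (ContinuousLinearMap.proj (R := ℂ) (φ := V) k).hasFDerivAt.comp z hmz.hasFDerivAt
  rw [h3.fderiv]
  simpa using h2

/-- The components of an Euler field of a split structure depend on the corresponding coordinates
only. -/
theorem fderiv_euler_single (H : IsFStructure m u U) (hs : IsSplit m u U) {d : ℂ}
    {X : (∀ k, V k) → ∀ k, V k} (hX : ContDiffOn ℂ ω X U)
    (hE : ∀ Z W : (∀ k, V k) → ∀ k, V k, ContDiffOn ℂ ω Z U → ContDiffOn ℂ ω W U → ∀ z ∈ U,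
      lieDerivMul m X Z W z = d • m z (Z z) (W z)) {z : ∀ k, V k} (hz : z ∈ U) {j k : ι}
    (hjk : j ≠ k) (c : V j) : fderiv ℂ (fun w => X w k) z (Pi.single j c) = 0 := by
  have hXz : DifferentiableAt ℂ X z :=
    (hX.contDiffAt (H.isOpen.mem_nhds hz)).differentiableAt (by simp)
  set e := unitComponent u k
  have he := H.contDiffOn_unitComponent k
  have hee : m z (e z) (e z) = e z := hs.idempotent_unitComponent hz k
  have hec : ∀ w ∈ U, m w (e w) (Pi.single j c) = 0 := fun w hw => by
    rw [hs w hw, Pi.single_eq_of_ne hjk.symm, Pi.single_zero]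
  -- On (e, e) the Euler condition reads [X, e] − 2 e∘[X, e] = d e, whence [X, e] = −d e. On (e, c)
  -- with e∘c = 0 it then leaves e∘[X, c] = 0, and for constant c the bracket is minus the
  -- derivative of X along c.
  have h1 := hE e e he he z hz
  have h2 := hE e (fun _ => Pi.single j c) he contDiffOn_const z hz
  rw [hec z hz, smul_zero, lieDerivMul,
    (Filter.EventuallyEq.refl _ X).lieBracket_vectorField_eq (W := 0)
      (by filter_upwards [H.isOpen.mem_nhds hz] with w hw using hec w hw),
    lieBracket_zero_right, Pi.zero_apply, zero_sub] at h2
  rw [lieDerivMul, (Filter.EventuallyEq.refl _ X).lieBracket_vectorField_eq (W := e)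
    (by filter_upwards [H.isOpen.mem_nhds hz] with w hw using hs.idempotent_unitComponent hw k),
    hee, H.comm z _ (e z)] at h1
  have h3 : m z (e z) (lieBracket ℂ X e z) = -(d • e z) := by
    have := congrArg (m z (e z)) h1
    rw [map_sub, map_sub, ← H.assoc, hee, sub_self, zero_sub, map_smul, hee] at this
    rw [← this, neg_neg]
  have h4 : lieBracket ℂ X e z = -(d • e z) := by
    rw [h3] at h1
    rw [sub_eq_iff_eq_add, sub_eq_iff_eq_add] at h1
    rw [h1]
    abel
  rw [h4, map_neg, map_smul, neg_apply, smul_apply, hec z hz, smul_zero, neg_zero, neg_zero,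
    zero_sub, neg_eq_zero, hs z hz] at h2
  have h5 := congrFun h2 k
  rw [Pi.single_eq_same, lieBracket] at h5
  have h6 : HasFDerivAt (fun w => X w k) _ z :=
    (ContinuousLinearMap.proj (R := ℂ) (φ := V) k).hasFDerivAt.comp z hXz.hasFDerivAt
  rw [h6.fderiv]
  simpa using h5

end IsFStructure

end Product

/-! ### Factors of a split structure. -/

section Factors

open Metric

variable {ι : Type*} [Fintype ι] {V : ι → Type*} [∀ k, NormedAddCommGroup (V k)]

theorem update_mem_ball [DecidableEq ι] {z₀ z : ∀ k, V k} {r : ℝ} (hz : z ∈ ball z₀ r) {k : ι}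
    {y : V k} (hy : y ∈ ball (z₀ k) r) : Function.update z k y ∈ ball z₀ r := by
  have hr : 0 < r := pos_of_mem_ball hy
  rw [mem_ball, dist_pi_lt_iff hr] at hz ⊢
  intro j
  obtain rfl | hj := eq_or_ne j k
  · simpa using hy
  · simpa [Function.update_of_ne hj] using hz j

theorem apply_mem_ball {z₀ z : ∀ k, V k} {r : ℝ} (hz : z ∈ ball z₀ r) (k : ι) :
    z k ∈ ball (z₀ k) r :=
  (dist_le_pi_dist z z₀ k).trans_lt hz

/-- A structure which is compatible with the decomposition of the tangent spaces of a product is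
locally a product of structures on the factors. -/
theorem IsFStructure.exists_factors [DecidableEq ι] [∀ k, NormedSpace ℂ (V k)]
    [∀ k, FiniteDimensional ℂ (V k)]
    {m : (∀ k, V k) → (∀ k, V k) →L[ℂ] (∀ k, V k) →L[ℂ] ∀ k, V k}
    {u : (∀ k, V k) → ∀ k, V k} {U : Set (∀ k, V k)} (H : IsFStructure m u U)
    (hs : IsSplit m u U) {z₀ : ∀ k, V k} (hz₀ : z₀ ∈ U) :
    ∃ r > 0, ball z₀ r ⊆ U ∧ ∃ alg : ∀ k, TangentAlg (V k) (V k),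
      (∀ k, IsFStructure (alg k).cmul (alg k).unit (ball (z₀ k) r)) ∧
      ∀ z ∈ ball z₀ r, (∀ a b k, m z a b k = (alg k).cmul (z k) (a k) (b k)) ∧
        ∀ k, u z k = (alg k).unit (z k) := by
  classical
  obtain ⟨r, hr, hrU⟩ := isOpen_iff.1 H.isOpen z₀ hz₀
  have hz₀r : z₀ ∈ ball z₀ r := mem_ball_self hr
  -- The k-th factor is the slice through z₀ in the k-th direction. Outside the ball the base point
  -- falls back to z₀: the algebra axioms are needed everywhere, but the splitting is known only on
  -- `U`.
  let base : ∀ k, V k → ∀ k, V k := fun k y =>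
    Function.update z₀ k (if y ∈ ball (z₀ k) r then y else z₀ k)
  have hbase : ∀ k y, y ∈ ball (z₀ k) r → base k y = Function.update z₀ k y := fun k y hy => by
    simp only [base, if_pos hy]
  have hbr : ∀ k y, base k y ∈ ball z₀ r := fun k y => by
    by_cases hy : y ∈ ball (z₀ k) r
    · rw [hbase k y hy]
      exact update_mem_ball hz₀r hy
    · simp only [base, if_neg hy, Function.update_eq_self]
      exact hz₀r
  have hbU : ∀ k y, base k y ∈ U := fun k y => hrU (hbr k y)
  have hmm : ∀ z ∈ U, ∀ k (a b : V k), Pi.single k (m z (Pi.single k a) (Pi.single k b) k)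
      = m z (Pi.single k a) (Pi.single k b) := fun z hz k a b => by
    have := H.mul_single_single hs hz k (Pi.single k a) (Pi.single k b)
    rw [← this, Pi.single_eq_same, Pi.single_eq_same]
  have hassoc : ∀ k y (a b c : V k),
      m (base k y) (Pi.single k (m (base k y) (Pi.single k a) (Pi.single k b) k)) (Pi.single k c) k
        = m (base k y) (Pi.single k a)
          (Pi.single k (m (base k y) (Pi.single k b) (Pi.single k c) k)) k := fun k y a b c => by
    rw [hmm _ (hbU k y), hmm _ (hbU k y), H.assoc]
  have hone : ∀ k y (a : V k), m (base k y) (Pi.single k (u (base k y) k)) (Pi.single k a) k = a :=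
    fun k y a => (congrFun (hs _ (hbU k y) k (Pi.single k a)) k).trans (by
      rw [Pi.single_eq_same, Pi.single_eq_same])
  let alg : ∀ k, TangentAlg (V k) (V k) := fun k =>
    { mul := fun y => (LinearMap.mk₂ ℂ
        (fun a b : V k => m (base k y) (Pi.single k a) (Pi.single k b) k)
        (fun (a a' b : V k) => by
          rw [Pi.single_add, map_add, add_apply, Pi.add_apply])
        (fun (c : ℂ) (a b : V k) => by
          rw [Pi.single_smul, map_smul, smul_apply, Pi.smul_apply])
        (fun (a b b' : V k) => by
          rw [Pi.single_add, map_add, Pi.add_apply])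
        (fun (c : ℂ) (a b : V k) => by
          rw [Pi.single_smul, map_smul, Pi.smul_apply]) :
          V k →ₗ[ℂ] V k →ₗ[ℂ] V k)
      unit := fun y => u (base k y) k
      mul_comm := fun y a b => congrFun (H.comm (base k y) _ _) k
      mul_assoc := hassoc k
      unit_mul := hone k }
  have halg : ∀ k y (a b : V k), (alg k).cmul y a b
      = m (base k y) (Pi.single k a) (Pi.single k b) k := fun k y a b => rfl
  have hind : ∀ z ∈ ball z₀ r, ∀ a b k, m z a b k = (alg k).cmul (z k) (a k) (b k) := by
    intro z hz a b k
    have h1 := congrFun (H.mul_single_single hs (hrU hz) k a b) k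
    rw [Pi.single_eq_same] at h1
    rw [halg, ← h1]
    refine eq_of_fderiv_single_eq_zero
      (g := fun w => m w (Pi.single k (a k)) (Pi.single k (b k)) k)
      (convex_ball z₀ r) (fun x hx => ?_)
      (fun x hx j hj c => H.fderiv_mul_single hs (hrU hx) hj c _ _) (hbr k (z k)) hz ?_
    · exact (ContinuousLinearMap.proj (R := ℂ) (φ := V) k).differentiableAt.comp x
        ((((H.hol_mul.clm_apply contDiffOn_const).clm_apply contDiffOn_const).contDiffAt
          (H.isOpen.mem_nhds (hrU hx))).differentiableAt (by simp))
    · rw [hbase k _ (apply_mem_ball hz k), Function.update_self]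
  -- No further differentiation is needed: the multiplication is already known to be a product, and
  -- it determines the unit.
  have hunit : ∀ z ∈ ball z₀ r, ∀ k, u z k = (alg k).unit (z k) := by
    intro z hz k
    let e : V k := (alg k).unit (z k)
    have h1 : e = (alg k).cmul (z k) (u z k) e := by
      refine Eq.trans ?_ ((hind z hz (u z) (Pi.single k e) k).trans (by rw [Pi.single_eq_same]))
      rw [H.unit_mul, Pi.single_eq_same]
    exact (h1.trans (((alg k).mul_comm (z k) (u z k) e).trans
      ((alg k).unit_mul (z k) (u z k)))).symm
  have hupd : ∀ k, ContDiff ℂ ω (fun y : V k => Function.update z₀ k y) := fun k =>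
    contDiff_update ω z₀ k
  have hmapsTo : ∀ k, Set.MapsTo (fun y : V k => Function.update z₀ k y) (ball (z₀ k) r) U :=
    fun k y hy => hrU (update_mem_ball hz₀r hy)
  have hholm : ∀ k, ContDiffOn ℂ ω (alg k).cmul (ball (z₀ k) r) := fun k => by
    refine contDiffOn_clm_apply.2 fun a => contDiffOn_clm_apply.2 fun b => ?_
    have h1 : ContDiffOn ℂ ω (fun y : V k => m (Function.update z₀ k y)) (ball (z₀ k) r) :=
      H.hol_mul.comp (hupd k).contDiffOn (hmapsTo k)
    refine ((ContinuousLinearMap.proj (R := ℂ) (φ := V) k).contDiff.comp_contDiffOn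
      ((h1.clm_apply (contDiffOn_const (c := Pi.single k a))).clm_apply
        (contDiffOn_const (c := Pi.single k b)))).congr fun y hy => ?_
    rw [halg, hbase k y hy]
    rfl
  refine ⟨r, hr, hrU, alg, fun k => ⟨isOpen_ball, (alg k).mul_comm, (alg k).mul_assoc,
    (alg k).unit_mul, hholm k, ?_, ?_⟩, fun z hz => ⟨hind z hz, hunit z hz⟩⟩
  · refine ((ContinuousLinearMap.proj (R := ℂ) (φ := V) k).contDiff.comp_contDiffOn
      (H.hol_unit.comp (hupd k).contDiffOn (hmapsTo k))).congr fun y hy => ?_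
    change u (base k y) k = _
    rw [hbase k y hy]
    rfl
  · intro O hO hOr X Y Z W hX hY hZ hW y hy
    have hyr := hOr hy
    -- Fields on the factor are lifted to the product; the k-th component of the integrability
    -- condition there is the condition on the factor.
    let lift : (V k → V k) → (∀ k, V k) → ∀ k, V k := fun X w => Pi.single k (X (w k))
    let O' : Set (∀ k, V k) := ball z₀ r ∩ (fun w => w k) ⁻¹' O
    have hO' : IsOpen O' := isOpen_ball.inter (hO.preimage (continuous_apply k))
    have hlift : ∀ {X : V k → V k}, ContDiffOn ℂ ω X O → ContDiffOn ℂ ω (lift X) O' :=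
      fun {X} hX => (ContinuousLinearMap.single ℂ V k).contDiff.comp_contDiffOn
        (hX.comp (ContinuousLinearMap.proj (R := ℂ) (φ := V) k).contDiff.contDiffOn
          fun w hw => hw.2)
    have hliftk : ∀ (X : V k → V k) w, lift X w k = X (w k) := fun X w => by simp [lift]
    obtain ⟨z, hzk, hzr⟩ : ∃ z, z k = y ∧ z ∈ ball z₀ r :=
      ⟨Function.update z₀ k y, by simp, update_mem_ball hz₀r hyr⟩
    subst hzk
    have hzO : z ∈ O' := ⟨hzr, hy⟩
    have hd' : ∀ {X : V k → V k}, ContDiffOn ℂ ω X O → DifferentiableAt ℂ X (z k) := fun hX =>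
      (hX.contDiffAt (hO.mem_nhds hy)).differentiableAt (by simp)
    have hd : ∀ {X : (∀ k, V k) → ∀ k, V k}, ContDiffOn ℂ ω X O' → DifferentiableAt ℂ X z :=
      fun hX => (hX.contDiffAt (hO'.mem_nhds hzO)).differentiableAt (by simp)
    have hm : DifferentiableAt ℂ m z :=
      (H.hol_mul.contDiffAt (H.isOpen.mem_nhds (hrU hzr))).differentiableAt (by simp)
    have hμ : DifferentiableAt ℂ (alg k).cmul (z k) :=
      ((hholm k).contDiffAt (isOpen_ball.mem_nhds hyr)).differentiableAt (by simp)
    have hmμ : ∀ᶠ w in 𝓝 z, ∀ a b, m w a b k = (alg k).cmul (w k) (a k) (b k) := by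
      filter_upwards [isOpen_ball.mem_nhds hzr] with w hw a b using hind w hw a b k
    have hO'U : O' ⊆ U := Set.inter_subset_left.trans hrU
    have hmul : ContDiffOn ℂ ω (fun w => m w (lift X w) (lift Y w)) O' :=
      ((H.hol_mul.mono hO'U).clm_apply (hlift hX)).clm_apply (hlift hY)
    have hmul' : ContDiffOn ℂ ω (fun w => (alg k).cmul w (X w) (Y w)) O :=
      (((hholm k).mono hOr).clm_apply hX).clm_apply hY
    have key : ∀ {X : (∀ k, V k) → ∀ k, V k} {X' : V k → V k}, ContDiffOn ℂ ω X O' →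
        ContDiffOn ℂ ω X' O → (∀ᶠ w in 𝓝 z, X w k = X' (w k)) →
        lieDerivMul m X (lift Z) (lift W) z k = lieDerivMul (alg k).cmul X' Z W (z k) :=
      fun hX hX' h => lieDerivMul_apply_of_comp hm hμ hmμ (hd hX) (hd (hlift hZ)) (hd (hlift hW))
        (hd' hX') (hd' hZ) (hd' hW) h (.of_forall (hliftk Z)) (.of_forall (hliftk W))
    have h1 := congrFun (H.lie_mul O' hO' hO'U _ _ _ _ (hlift hX) (hlift hY) (hlift hZ)
      (hlift hW) z hzO) k
    rw [Pi.add_apply, hind z hzr, hind z hzr, hliftk, hliftk,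
      key (hlift hX) hX (.of_forall (hliftk X)), key (hlift hY) hY (.of_forall (hliftk Y)),
      key hmul hmul' (by
        filter_upwards [hmμ] with w hw
        rw [hw, hliftk, hliftk])] at h1
    exact h1

end Factors

/-! ### Existence of a decomposition with prescribed idempotents. -/

section Existence

/-- Complementary projections identify a finite-dimensional space with a product of coordinate
spaces. -/
theorem exists_equiv_pi_of_projections {E : Type*} [NormedAddCommGroup E] [NormedSpace ℂ E]
    [FiniteDimensional ℂ E] {ι : Type*} [Fintype ι] [DecidableEq ι] {P : ι → E →L[ℂ] E}
    (hP : ∀ k a, P k (P k a) = P k a) (hort : ∀ j k, j ≠ k → ∀ a, P j (P k a) = 0)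
    (hsum : ∀ a, ∑ k, P k a = a) (hne : ∀ k, P k ≠ 0) :
    ∃ m : ι → ℕ, (∀ k, 1 ≤ m k) ∧ ∃ L : E ≃L[ℂ] ∀ k, Fin (m k) → ℂ,
      ∀ k a, L (P k a) = Pi.single k (L a k) := by
  let m : ι → ℕ := fun k => Module.finrank ℂ (P k).range
  let b : ∀ k, (P k).range ≃ₗ[ℂ] (Fin (m k) → ℂ) := fun k => (Module.finBasis ℂ _).equivFun
  let f : E →ₗ[ℂ] ∀ k, Fin (m k) → ℂ :=
    LinearMap.pi fun k => (b k).toLinearMap ∘ₗ (P k : E →ₗ[ℂ] E).rangeRestrict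
  have hf : ∀ a k, f a k = b k ⟨P k a, a, rfl⟩ := fun a k => rfl
  let g : (∀ k, Fin (m k) → ℂ) → E := fun v => ∑ k, ((b k).symm (v k) : E)
  have hPb : ∀ j k (v : Fin (m k) → ℂ), P j ((b k).symm v : E)
      = if j = k then ((b k).symm v : E) else 0 := fun j k v => by
    obtain ⟨a, ha⟩ := ((b k).symm v).2
    have ha' : P k a = ((b k).symm v : E) := ha
    rw [← ha']
    split_ifs with h
    · subst h; exact hP j a
    · exact hort j k h a
  have hPg : ∀ v k, P k (g v) = ((b k).symm (v k) : E) := fun v k => by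
    rw [map_sum, Finset.sum_congr rfl fun j _ => hPb k j (v j)]
    simp
  have hgf : ∀ a, g (f a) = a := fun a => by
    simp only [g, hf, LinearEquiv.symm_apply_apply, hsum]
  have hfg : ∀ v, f (g v) = v := fun v => funext fun k => by
    rw [hf, ← (b k).symm.injective.eq_iff, LinearEquiv.symm_apply_apply]
    exact Subtype.ext (hPg v k)
  let L : E ≃L[ℂ] ∀ k, Fin (m k) → ℂ :=
    LinearEquiv.toContinuousLinearEquiv { f with invFun := g, left_inv := hgf, right_inv := hfg }
  have hL : ∀ a k, L a k = b k ⟨P k a, a, rfl⟩ := hf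
  refine ⟨m, fun k => ?_, L, fun k a => funext fun j => ?_⟩
  · refine Nat.one_le_iff_ne_zero.2 fun h => hne k ?_
    have := LinearMap.range_eq_bot.1 (Submodule.finrank_eq_zero.1 h)
    exact ContinuousLinearMap.ext fun a => DFunLike.congr_fun this a
  · rw [hL]
    obtain rfl | hj := eq_or_ne j k
    · rw [Pi.single_eq_same, hL]
      congr 2
      exact hP j a
    · rw [Pi.single_eq_of_ne hj, ← map_zero (b j)]
      congr 1
      exact Subtype.ext (hort j k hj a)

/-- A decomposition of the unit into orthogonal idempotents at a point gives coordinates which split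
the multiplication. -/
theorem IsFStructure.exists_split_chart {E : Type*} [NormedAddCommGroup E] [NormedSpace ℂ E]
    [FiniteDimensional ℂ E] {B : TangentAlg E E} {U : Set E}
    (H : IsFStructure B.cmul B.unit U) {q : E} (hq : q ∈ U) {ι : Type*} [Fintype ι] [DecidableEq ι]
    {ε : ι → E} (hε : ∀ k, B.cmul q (ε k) (ε k) = ε k)
    (hort : ∀ j k, j ≠ k → B.cmul q (ε j) (ε k) = 0) (hsum : ∑ k, ε k = B.unit q)
    (hne : ∀ k, ε k ≠ 0) :
    ∃ m : ι → ℕ, (∀ k, 1 ≤ m k) ∧ ∃ χ : OpenPartialHomeomorph E (∀ k, Fin (m k) → ℂ),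
      q ∈ χ.source ∧ ∃ C, B.IsFIso C χ ∧ IsSplit C.cmul C.unit χ.target ∧
      ∀ j k, j ≠ k → fderiv ℂ χ q (ε k) j = 0 := by
  have : CompleteSpace E := FiniteDimensional.complete ℂ E
  obtain ⟨φ, hqφ, hφU, hφ, hφ', hdφ, e, heq, he⟩ := H.exists_chart hq hε hort hsum
  obtain ⟨m, hm, L, hL⟩ := exists_equiv_pi_of_projections (P := fun k => B.cmul q (ε k))
    (fun k a => by rw [← H.assoc, hε]) (fun j k hjk a => by
      rw [← H.assoc, hort j k hjk, map_zero, zero_apply]) (fun a => by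
      rw [← sum_apply, ← map_sum, hsum]
      exact H.unit_mul q a) (fun k h => hne k (by rw [← hε k, h, zero_apply]))
  let χ := φ.transHomeomorph L.toHomeomorph
  have hχ : (χ : E → _) = L ∘ φ := rfl
  have hd : ∀ y ∈ φ.source, ∀ a, fderiv ℂ χ y a = L (fderiv ℂ φ y a) := fun y hy a => by
    have h1 : HasFDerivAt χ ((L : E →L[ℂ] _) ∘L fderiv ℂ φ y) y :=
      L.hasFDerivAt.comp y ((hφ.contDiffAt (φ.open_source.mem_nhds hy)).differentiableAt
        (by simp)).hasFDerivAt
    rw [h1.fderiv]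
    rfl
  obtain ⟨C, hC⟩ := B.exists_pushforward (φ := χ)
    (contMDiffOn_iff_contDiffOn.2 (L.contDiff.comp_contDiffOn hφ))
    (contMDiffOn_iff_contDiffOn.2 (hφ'.comp L.symm.contDiff.contDiffOn fun y hy => hy)) hqφ
  have hCmul : ∀ y ∈ φ.source, ∀ a b, fderiv ℂ χ y (B.cmul y a b)
      = C.cmul (χ y) (fderiv ℂ χ y a) (fderiv ℂ χ y b) := fun y hy a b => by
    rw [← mfderiv_eq_fderiv]
    exact hC.map_mul y hy a b
  have hCunit : ∀ y ∈ φ.source, fderiv ℂ χ y (B.unit y) = C.unit (χ y) := fun y hy => by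
    rw [← mfderiv_eq_fderiv]
    exact hC.map_unit y hy
  have hsplit : ∀ y ∈ φ.source, ∀ k a,
      fderiv ℂ χ y (B.cmul y (e k y) a) = Pi.single k (fderiv ℂ χ y a k) := fun y hy k a => by
    rw [hd y hy, he y hy, hL, hd y hy]
  refine ⟨m, hm, χ, hqφ, C, hC, fun z hz k a => ?_, fun j k hjk => ?_⟩
  · obtain ⟨y, hy, rfl⟩ : ∃ y ∈ φ.source, χ y = z := ⟨_, χ.map_target hz, χ.right_inv hz⟩
    obtain ⟨a, rfl⟩ : ∃ a', fderiv ℂ χ y a' = a := by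
      obtain ⟨a', ha'⟩ := (hC.mdiff.mfderiv_bijective hy).2 a
      exact ⟨a', (DFunLike.congr_fun mfderiv_eq_fderiv.symm a').trans ha'⟩
    -- e_k is e_k∘unit, and the chart turns e_k∘ into projection to the k-th factor.
    have h1 : unitComponent C.unit k (χ y) = fderiv ℂ χ y (e k y) := by
      refine (congrArg (fun w : ∀ k, Fin (m k) → ℂ => (Pi.single k (w k) : ∀ k, Fin (m k) → ℂ))
        (hCunit y hy).symm).trans ?_
      exact (hsplit y hy k (B.unit y)).symm.trans (congrArg (fderiv ℂ χ y)
        ((H.comm y _ _).trans (H.unit_mul y _)))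
    rw [h1, ← hCmul y hy, hsplit y hy]
  · rw [hd q hqφ, hdφ, ← hε k, hL, Pi.single_eq_of_ne hjk]

theorem TangentAlg.IsFIso.congr {E : Type*} [NormedAddCommGroup E] [NormedSpace ℂ E]
    {M : Type*} [TopologicalSpace M] [ChartedSpace E M]
    {E' : Type*} [NormedAddCommGroup E'] [NormedSpace ℂ E']
    {N : Type*} [TopologicalSpace N] [ChartedSpace E' N] {A : TangentAlg E M}
    {B B' : TangentAlg E' N} {φ : OpenPartialHomeomorph M N} (h : A.IsFIso B φ)
    (hmul : ∀ y ∈ φ.target, ∀ a b, B.mul y a b = B'.mul y a b)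
    (hunit : ∀ y ∈ φ.target, B.unit y = B'.unit y) : A.IsFIso B' φ where
  hol := h.hol
  hol_symm := h.hol_symm
  map_mul x hx a b := (h.map_mul x hx a b).trans (hmul _ (φ.map_source hx) _ _)
  map_unit x hx := (h.map_unit x hx).trans (hunit _ (φ.map_source hx))

/-- A decomposition of the unit of `T_p M` into orthogonal idempotents extends to a decomposition of
the germ `(M, p)`. -/
theorem FDecomp.exists_of_idempotents {E : Type*} [NormedAddCommGroup E] [NormedSpace ℂ E]
    [FiniteDimensional ℂ E] {M : Type*} [TopologicalSpace M] [ChartedSpace E M]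
    [IsManifold 𝓘(ℂ, E) ω M] {A : TangentAlg E M} {p : M} (hA : A.IsFGerm p) {ι : Type*} [Fintype ι]
    {ε : ι → TangentSpace 𝓘(ℂ, E) p} (hε : ∀ k, A.mul p (ε k) (ε k) = ε k)
    (hort : ∀ j k, j ≠ k → A.mul p (ε j) (ε k) = 0) (hsum : ∑ k, ε k = A.unit p)
    (hne : ∀ k, ε k ≠ 0) :
    ∃ D : FDecomp A p ι, ∀ j k, j ≠ k → D.comp j p (ε k) = 0 := by
  classical
  have : CompleteSpace E := FiniteDimensional.complete ℂ E
  obtain ⟨U, hpU, hU⟩ := hA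
  let φ := (chartAt E p).restrOpen U hU.isOpen
  have hφs : φ.source ⊆ (chartAt E p).source ∩ U :=
    ((chartAt E p).restrOpen_source U hU.isOpen).subset
  have hpφ : p ∈ φ.source := ⟨mem_chart_source E p, hpU⟩
  obtain ⟨B, hB⟩ := A.exists_pushforward (φ := φ)
    ((contMDiffOn_chart (I := 𝓘(ℂ, E)) (n := ω) (x := p)).mono fun x hx => (hφs hx).1)
    ((contMDiffOn_chart_symm (I := 𝓘(ℂ, E)) (n := ω) (x := p)).mono fun y hy => hy.1) hpφ
  have hφU : φ.source ⊆ U := fun x hx => (hφs hx).2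
  have HB := hB.isFStructure hU hφU
  let dφ := mfderiv 𝓘(ℂ, E) 𝓘(ℂ, E) φ p
  obtain ⟨m, hm, χ, hqχ, C, hC, hCs, hdχ⟩ := HB.exists_split_chart (φ.map_source hpφ)
    (ε := fun k => dφ (ε k))
    (fun k => (hB.map_mul p hpφ (ε k) (ε k)).symm.trans (congrArg dφ (hε k)))
    (fun j k hjk => (hB.map_mul p hpφ (ε j) (ε k)).symm.trans
      ((congrArg dφ (hort j k hjk)).trans (map_zero dφ)))
    ((map_sum dφ ε _).symm.trans ((congrArg dφ hsum).trans (hB.map_unit p hpφ)))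
    (fun k h => hne k (hB.mdiff.mfderiv_injective hpφ (h.trans (map_zero dφ).symm)))
  let τ := φ.trans χ
  have hpτ : p ∈ τ.source := by
    rw [φ.trans_source]
    exact ⟨hpφ, hqχ⟩
  have hτU : τ.source ⊆ U := fun x hx => by
    rw [φ.trans_source] at hx
    exact hφU hx.1
  have hCτ : A.IsFIso C τ := hB.trans hC
  have HC := hCτ.isFStructure hU hτU
  have hsp : IsSplit C.cmul C.unit τ.target := fun z hz => hCs z (by
    rw [φ.trans_target] at hz
    exact hz.1)
  obtain ⟨r, hr, hrτ, alg, halg, hCalg⟩ := HC.exists_factors hsp (τ.map_source hpτ)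
  have hO := τ.isOpen_inter_preimage (Metric.isOpen_ball (x := τ p) (ε := r))
  let κ := τ.restrOpen _ hO
  have hpκ : p ∈ κ.source := ⟨hpτ, hpτ, Metric.mem_ball_self hr⟩
  have hκt : κ.target ⊆ Metric.ball (τ p) r := fun y hy => by
    have h1 : κ (κ.symm y) ∈ Metric.ball (τ p) r := (κ.map_target hy).2.2
    rwa [κ.right_inv hy] at h1
  have hκ : A.IsFIso (prodAlg alg) κ := (hCτ.restrOpen hO).congr
    (fun y hy a b => funext fun k => (hCalg y (hκt hy)).1 a b k)
    (fun y hy => funext fun k => (hCalg y (hκt hy)).2 k)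
  refine ⟨⟨m, alg, τ p, fun k => ⟨Metric.ball (τ p k) r, Metric.mem_ball_self hr,
    (halg k).isFManifoldOn ((convex_ball _ _).isConnected ⟨_, Metric.mem_ball_self hr⟩)
      (by simpa using hm k)⟩, κ, hpκ, rfl, hκ⟩, fun j k hjk => ?_⟩
  have h1 : mfderiv 𝓘(ℂ, E) 𝓘(ℂ, ∀ k, Fin (m k) → ℂ) (χ ∘ φ) p = _ :=
    mfderiv_comp p (hC.mdiff.mdifferentiableAt hqχ) (hB.mdiff.mdifferentiableAt hpφ)
  refine (congrArg (fun w : ∀ k, Fin (m k) → ℂ => w j) (DFunLike.congr_fun h1 (ε k))).trans ?_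
  refine Eq.trans ?_ (hdχ j k hjk)
  exact congrArg (fun w : ∀ k, Fin (m k) → ℂ => w j)
    (DFunLike.congr_fun mfderiv_eq_fderiv (dφ (ε k)))

end Existence

/-! ### Tangent algebras of the factors; irreducibility and locality. -/

section Decompositions

variable {E : Type*} [NormedAddCommGroup E] [NormedSpace ℂ E]
  {M : Type*} [TopologicalSpace M] [ChartedSpace E M] {A : TangentAlg E M} {p : M}

theorem TangentAlg.idempotents_mul_self {ι : Type*} [Fintype ι]
    {ε : ι → TangentSpace 𝓘(ℂ, E) p} (hort : ∀ j k, j ≠ k → A.mul p (ε j) (ε k) = 0)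
    (hsum : ∑ k, ε k = A.unit p) (k : ι) : A.mul p (ε k) (ε k) = ε k := by
  conv_rhs => rw [← A.unit_mul p (ε k), ← hsum, map_sum, LinearMap.sum_apply]
  exact (Finset.sum_eq_single k (fun j _ hj => hort j k hj) (by simp)).symm

/-- Write the unit as a + b along two complementary ideals. One summand is invertible, and the ideal
containing it is everything. -/
theorem TangentAlg.IsLocalAt.isIrreducibleAt (h : A.IsLocalAt p) : A.IsIrreducibleAt p := by
  refine ⟨h.1, fun I J hIJ hI hJ => ?_⟩
  have key : ∀ K : Submodule ℂ (TangentSpace 𝓘(ℂ, E) p), (∀ a, ∀ b ∈ K, A.mul p a b ∈ K) →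
      ∀ a ∈ K, (∃ c, A.mul p a c = A.unit p) → K = ⊤ := by
    rintro K hK a ha ⟨c, hc⟩
    refine eq_top_iff.2 fun b _ => ?_
    rw [← A.unit_mul p b, ← hc, A.mul_comm p a c, A.mul_comm, ← A.mul_assoc]
    exact hK _ a ha
  obtain ⟨a, ha, b, hb, hab⟩ : ∃ a ∈ I, ∃ b ∈ J, a + b = A.unit p := by
    rw [← Submodule.mem_sup, hIJ.sup_eq_top]
    trivial
  rcases h.2 a b hab with h | h
  · right
    rw [key I hI a ha h] at hIJ
    exact disjoint_top.1 hIJ.symm.disjoint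
  · left
    rw [key J hJ b hb h] at hIJ
    exact disjoint_top.1 hIJ.disjoint

namespace FDecomp

variable {ι : Type*} [Fintype ι]

/-- The component of tangent vectors in a factor as a linear map. -/
noncomputable def compₗ (D : FDecomp A p ι) (k : ι) (x : M) :
    TangentSpace 𝓘(ℂ, E) x →ₗ[ℂ] TangentSpace 𝓘(ℂ, Fin (D.dim k) → ℂ) (D.chart x k) :=
  (LinearMap.proj k : (∀ k, Fin (D.dim k) → ℂ) →ₗ[ℂ] (Fin (D.dim k) → ℂ)) ∘ₗ
    (mfderiv 𝓘(ℂ, E) 𝓘(ℂ, ∀ k, Fin (D.dim k) → ℂ) D.chart x).toLinearMap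

variable (D : FDecomp A p ι) {x : M}

theorem compₗ_apply (k : ι) (a : TangentSpace 𝓘(ℂ, E) x) : D.compₗ k x a = D.comp k x a := rfl

theorem compₗ_mul (hx : x ∈ D.chart.source) (k : ι) (a b : TangentSpace 𝓘(ℂ, E) x) :
    D.compₗ k x (A.mul x a b) = (D.alg k).mul (D.chart x k) (D.compₗ k x a) (D.compₗ k x b) :=
  congrFun (D.isFIso.map_mul x hx a b) k

theorem compₗ_unit (hx : x ∈ D.chart.source) (k : ι) :
    D.compₗ k x (A.unit x) = (D.alg k).unit (D.chart x k) :=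
  congrFun (D.isFIso.map_unit x hx) k

theorem ext_comp (hx : x ∈ D.chart.source) {a b : TangentSpace 𝓘(ℂ, E) x}
    (h : ∀ k, D.compₗ k x a = D.compₗ k x b) : a = b :=
  D.isFIso.mdiff.mfderiv_injective hx (funext h)

theorem exists_comp (hx : x ∈ D.chart.source)
    (c : ∀ k, TangentSpace 𝓘(ℂ, Fin (D.dim k) → ℂ) (D.chart x k)) :
    ∃ a, ∀ k, D.compₗ k x a = c k := by
  obtain ⟨a, ha⟩ := (D.isFIso.mdiff.mfderiv_bijective hx).2 c
  exact ⟨a, fun k => congrFun ha k⟩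

theorem one_le_dim (k : ι) : 1 ≤ D.dim k := by
  obtain ⟨U, -, hU⟩ := D.isFGerm k
  simpa using hU.one_le_dim

theorem exists_single [DecidableEq ι] (hx : x ∈ D.chart.source) (k : ι)
    (c : TangentSpace 𝓘(ℂ, Fin (D.dim k) → ℂ) (D.chart x k)) :
    ∃ a, D.compₗ k x a = c ∧ ∀ j, j ≠ k → D.compₗ j x a = 0 := by
  obtain ⟨a, ha⟩ := D.exists_comp hx
    (Pi.single (M := fun k => TangentSpace 𝓘(ℂ, Fin (D.dim k) → ℂ) (D.chart x k)) k c)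
  exact ⟨a, (ha k).trans (Pi.single_eq_same _ _), fun j hj =>
    (ha j).trans (Pi.single_eq_of_ne hj _)⟩

/-- If a germ is a product, then so is its tangent algebra. -/
theorem isEmpty_of_isIrreducibleAt (h : A.IsIrreducibleAt p) : IsEmpty (FDecomp A p (Fin 2)) := by
  refine ⟨fun D => ?_⟩
  have hp := D.mem_source
  -- The kernels of the two component maps are complementary ideals, each nonzero because the other
  -- factor has positive dimension.
  have hne : ∀ k, (D.compₗ k p).ker ≠ ⊥ := fun k hk => by
    let j : Fin 2 := 1 - k
    have hjk : k ≠ j := by fin_cases k <;> simp [j]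
    have : Nonempty (Fin (D.dim j)) := Fin.pos_iff_nonempty.1 (D.one_le_dim j)
    obtain ⟨c, hc⟩ := exists_ne (0 : Fin (D.dim j) → ℂ)
    obtain ⟨a, ha, ha'⟩ := D.exists_single hp j c
    have ha0 : a ∈ (D.compₗ k p).ker := ha' k hjk
    rw [hk, Submodule.mem_bot] at ha0
    rw [ha0, map_zero] at ha
    exact hc ha.symm
  have hideal : ∀ k a, ∀ b ∈ (D.compₗ k p).ker, A.mul p a b ∈ (D.compₗ k p).ker :=
    fun k a b hb => by
      rw [LinearMap.mem_ker] at hb ⊢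
      rw [D.compₗ_mul hp, hb, map_zero]
  have hcompl : IsCompl (D.compₗ 0 p).ker (D.compₗ 1 p).ker := by
    refine ⟨Submodule.disjoint_def.2 fun a h0 h1 => D.ext_comp hp fun k => ?_,
      codisjoint_iff.2 (eq_top_iff.2 fun a _ => Submodule.mem_sup.2 ?_)⟩
    · rw [map_zero]
      fin_cases k
      exacts [h0, h1]
    · obtain ⟨b, hb, hb'⟩ := D.exists_single hp 1 (D.compₗ 1 p a)
      refine ⟨b, hb' 0 (by simp), a - b, ?_, by abel⟩
      rw [LinearMap.mem_ker, map_sub, hb, sub_self]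
  rcases h.2 _ _ hcompl (hideal 0) (hideal 1) with h | h
  exacts [hne 0 h, hne 1 h]

section Extends

variable [FiniteDimensional ℂ E] {D : FDecomp A p (A.Weight p)}
  {ε : A.Weight p → TangentSpace 𝓘(ℂ, E) p}

theorem Extends.comp_idempotent_of_ne (hD : D.Extends)
    (hε : ∀ k, ε k ∈ A.eigenspace p k) {j k : A.Weight p} (hjk : j ≠ k) :
    D.compₗ j p (ε k) = 0 := (hD k (ε k)).1 (hε k) j hjk

theorem Extends.comp_idempotent (hD : D.Extends) (hε : ∀ k, ε k ∈ A.eigenspace p k)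
    (hsum : ∑ k, ε k = A.unit p) (k : A.Weight p) :
    D.compₗ k p (ε k) = (D.alg k).unit (D.chart p k) := by
  rw [← D.compₗ_unit D.mem_source, ← hsum, map_sum]
  exact (Finset.sum_eq_single k (fun j _ hj => hD.comp_idempotent_of_ne hε hj.symm)
    (by simp)).symm

/-- A decomposition extends the eigenspace decomposition as soon as it is compatible with the
idempotents. -/
theorem extends_of_comp_idempotent (hε : ∀ k a, a ∈ A.eigenspace p k ↔ A.mul p (ε k) a = a)
    (hsum : ∑ k, ε k = A.unit p) (h : ∀ j k, j ≠ k → D.comp j p (ε k) = 0) : D.Extends := by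
  intro k a
  have hp := D.mem_source
  have hk : D.compₗ k p (ε k) = (D.alg k).unit (D.chart p k) := by
    rw [← D.compₗ_unit hp, ← hsum, map_sum]
    exact (Finset.sum_eq_single k (fun j _ hj => h k j hj.symm) (by simp)).symm
  rw [hε k a]
  refine ⟨fun ha j hj => ?_, fun ha => D.ext_comp hp fun j => ?_⟩
  · change D.compₗ j p a = 0
    rw [← ha, D.compₗ_mul hp, compₗ_apply, h j k hj, map_zero, LinearMap.zero_apply]
  · rw [D.compₗ_mul hp]
    obtain rfl | hj := eq_or_ne j k
    · rw [hk, (D.alg j).unit_mul]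
    · have h1 : D.compₗ j p a = 0 := ha j hj
      rw [h1, map_zero]

/-- Elements of the factor are lifted to T_pM with zero components elsewhere. A sum equal to the
unit lifts to ε_k, so locality of the eigenspace applies. -/
theorem Extends.isLocalAt (hD : D.Extends) (k : A.Weight p) : (D.alg k).IsLocalAt (D.pt k) := by
  classical
  have hp := D.mem_source
  obtain ⟨ε, hsum, hort, hne, hε⟩ := A.exists_idempotents p
  have hεk : ∀ k, ε k ∈ A.eigenspace p k := fun k =>
    (hε k _).2 (A.idempotents_mul_self hort hsum k)
  have hu := hD.comp_idempotent hεk hsum k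
  rw [← D.chart_apply]
  refine ⟨fun h => hne k (D.ext_comp hp fun j => ?_), fun a b hab => ?_⟩
  · obtain rfl | hj := eq_or_ne j k
    · rw [hu, h, map_zero]
    · rw [map_zero, hD.comp_idempotent_of_ne hεk hj]
  · obtain ⟨a', ha, ha'⟩ := D.exists_single hp k a
    obtain ⟨b', hb, hb'⟩ := D.exists_single hp k b
    have hab' : a' + b' = ε k := D.ext_comp hp fun j => by
      obtain rfl | hj := eq_or_ne j k
      · rw [map_add, ha, hb, hab, hu]
      · rw [map_add, ha' j hj, hb' j hj, hD.comp_idempotent_of_ne hεk hj, add_zero]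
    refine (A.isLocal_eigenspace p k (hε k) (hεk k) (hne k) hab').imp ?_ ?_
    · rintro ⟨c, hc⟩
      exact ⟨D.compₗ k p c, by rw [← hu, ← hc, D.compₗ_mul hp, ha]⟩
    · rintro ⟨c, hc⟩
      exact ⟨D.compₗ k p c, by rw [← hu, ← hc, D.compₗ_mul hp, hb]⟩

end Extends

theorem exists_extends [FiniteDimensional ℂ E] [IsManifold 𝓘(ℂ, E) ω M] (hA : A.IsFGerm p) :
    ∃ D : FDecomp A p (A.Weight p), D.Extends := by
  obtain ⟨ε, hsum, hort, hne, hε⟩ := A.exists_idempotents p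
  obtain ⟨D, hD⟩ := exists_of_idempotents hA (A.idempotents_mul_self hort hsum) hort hsum hne
  exact ⟨D, extends_of_comp_idempotent hε hsum hD⟩

end FDecomp

end Decompositions

/-! ### Isomorphisms between products. -/

section Uniqueness

theorem TangentAlg.IsFIso.fderiv_mul {F G : Type*} [NormedAddCommGroup F] [NormedSpace ℂ F]
    [FiniteDimensional ℂ F] [NormedAddCommGroup G] [NormedSpace ℂ G] [FiniteDimensional ℂ G]
    {B : TangentAlg F F} {C : TangentAlg G G} {φ : OpenPartialHomeomorph F G} (h : B.IsFIso C φ)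
    {x : F} (hx : x ∈ φ.source) (a b : F) :
    fderiv ℂ φ x (B.cmul x a b) = C.cmul (φ x) (fderiv ℂ φ x a) (fderiv ℂ φ x b) := by
  rw [← mfderiv_eq_fderiv]
  exact h.map_mul x hx a b

theorem TangentAlg.IsFIso.fderiv_unit {F G : Type*} [NormedAddCommGroup F] [NormedSpace ℂ F]
    [NormedAddCommGroup G] [NormedSpace ℂ G]
    {B : TangentAlg F F} {C : TangentAlg G G} {φ : OpenPartialHomeomorph F G} (h : B.IsFIso C φ)
    {x : F} (hx : x ∈ φ.source) : fderiv ℂ φ x (B.unit x : F) = (C.unit (φ x) : G) := by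
  rw [← mfderiv_eq_fderiv]
  exact h.map_unit x hx

theorem hasFDerivAt_update_single {ι : Type*} [Fintype ι] [DecidableEq ι] {V : ι → Type*}
    [∀ k, NormedAddCommGroup (V k)] [∀ k, NormedSpace ℂ (V k)] (z : ∀ k, V k) (k : ι) (y : V k) :
    HasFDerivAt (Function.update z k) (ContinuousLinearMap.single ℂ V k) y := by
  refine (hasFDerivAt_update z y).congr_fderiv (ContinuousLinearMap.ext fun c => funext fun j => ?_)
  obtain rfl | hj := eq_or_ne j k
  · simp
  · simp [Pi.single_eq_of_ne hj]

variable {ι : Type*} [Fintype ι] {m m' : ι → ℕ} {alg : ∀ k, CoordAlg (m k)}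
  {alg' : ∀ k, CoordAlg (m' k)}

theorem prodAlg_cmul_apply (z a b : ∀ k, Fin (m k) → ℂ) (k : ι) :
    (prodAlg alg).cmul z a b k = (alg k).cmul (z k) (a k) (b k) := rfl

theorem prodAlg_unit_apply (z : ∀ k, Fin (m k) → ℂ) (k : ι) :
    (prodAlg alg).unit z k = (alg k).unit (z k) := rfl

variable [DecidableEq ι]

theorem isSplit_prodAlg (U : Set (∀ k, Fin (m k) → ℂ)) :
    IsSplit (prodAlg alg).cmul (prodAlg alg).unit U := by
  intro z _ k a
  funext j
  rw [prodAlg_cmul_apply]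
  obtain rfl | hj := eq_or_ne j k
  · rw [Pi.single_eq_same]
    refine Eq.trans (congrArg (fun v => (alg j).cmul (z j) v (a j)) ?_)
      ((alg j).unit_mul (z j) (a j))
    exact Pi.single_eq_same _ _
  · rw [Pi.single_eq_of_ne hj]
    refine Eq.trans (congrArg (fun v => (alg j).cmul (z j) v (a j)) (Pi.single_eq_of_ne hj _)) ?_
    rw [map_zero, zero_apply]

variable {τ : OpenPartialHomeomorph (∀ k, Fin (m k) → ℂ) (∀ k, Fin (m' k) → ℂ)}

/-- The image of the k-th unit component of the source and the k-th unit component of the target are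
continuous families of idempotents that agree at the base point, hence nearby. Multiplicativity of
the derivative then makes it block diagonal. -/
theorem TangentAlg.IsFIso.eventually_fderiv_single (h : (prodAlg alg).IsFIso (prodAlg alg') τ)
    (H : IsFStructure (prodAlg alg).cmul (prodAlg alg).unit τ.source)
    (H' : IsFStructure (prodAlg alg').cmul (prodAlg alg').unit τ.target)
    {y₀ : ∀ k, Fin (m k) → ℂ} (hy₀ : y₀ ∈ τ.source)
    (h₀ : ∀ j k, j ≠ k → fderiv ℂ τ y₀ (unitComponent (prodAlg alg).unit k y₀) j = 0) :
    ∀ᶠ y in 𝓝 y₀, ∀ k a, fderiv ℂ τ y (Pi.single k (a k)) = Pi.single k (fderiv ℂ τ y a k) := by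
  have hτ : ContDiffOn ℂ ω τ τ.source := contMDiffOn_iff_contDiffOn.1 h.hol
  have hmul := fun y hy => h.fderiv_mul (x := y) hy
  have hunit := fun y hy => h.fderiv_unit (x := y) hy
  have hnhds := τ.open_source.mem_nhds hy₀
  have hτc : ContinuousAt τ y₀ := τ.continuousAt hy₀
  have ht₀ := τ.map_source hy₀
  have key : ∀ k, ∀ᶠ y in 𝓝 y₀, fderiv ℂ τ y (unitComponent (prodAlg alg).unit k y)
      = unitComponent (prodAlg alg').unit k (τ y) := by
    intro k
    refine eventually_eq_of_idempotent (μ := fun y => (prodAlg alg').cmul (τ y)) ?_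
      (fun y => H'.comm (τ y)) (fun y => H'.assoc (τ y)) ?_ ?_ ?_ ?_ ?_
    · exact (H'.hol_mul.contDiffAt (H'.isOpen.mem_nhds ht₀)).continuousAt.comp hτc
    · exact ((((hτ.contDiffAt hnhds).fderiv_right (m := ω) (by simp)).clm_apply
        ((H.contDiffOn_unitComponent k).contDiffAt hnhds))).continuousAt
    · exact ContinuousAt.comp (g := unitComponent (prodAlg alg').unit k)
        ((H'.contDiffOn_unitComponent k).contDiffAt (H'.isOpen.mem_nhds ht₀)).continuousAt hτc
    · funext j
      obtain rfl | hj := eq_or_ne j k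
      · refine Eq.trans ?_ (unitComponent_same (V := fun k => Fin (m' k) → ℂ) _ j _).symm
        rw [← hunit y₀ hy₀]
        have hs : (prodAlg alg).unit y₀ = ∑ k, unitComponent (prodAlg alg).unit k y₀ :=
          (Finset.univ_sum_single _).symm
        refine Eq.trans ?_ (congrArg (fun v : ∀ k, Fin (m k) → ℂ => fderiv ℂ τ y₀ v j) hs).symm
        rw [map_sum, Finset.sum_apply]
        exact (Finset.sum_eq_single j (fun k _ hk => h₀ j k hk.symm) (by simp)).symm
      · exact (h₀ j k hj).trans (unitComponent_of_ne (V := fun k => Fin (m' k) → ℂ) _ hj _).symm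
    · filter_upwards [hnhds] with y hy
      rw [← hmul y hy, (isSplit_prodAlg _).idempotent_unitComponent hy]
    · filter_upwards [hnhds] with y hy
      exact (isSplit_prodAlg _).idempotent_unitComponent (τ.map_source hy) k
  filter_upwards [hnhds, Filter.eventually_all.2 key] with y hy hk k a
  rw [← isSplit_prodAlg τ.source y hy k a, hmul y hy, hk,
    isSplit_prodAlg τ.target _ (τ.map_source hy)]

/-- An isomorphism of products which respects the splitting of the tangent space at one point is
locally a product of isomorphisms. -/
theorem TangentAlg.IsFIso.exists_factors (h : (prodAlg alg).IsFIso (prodAlg alg') τ)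
    (H : IsFStructure (prodAlg alg).cmul (prodAlg alg).unit τ.source)
    (H' : IsFStructure (prodAlg alg').cmul (prodAlg alg').unit τ.target)
    {y₀ : ∀ k, Fin (m k) → ℂ} (hy₀ : y₀ ∈ τ.source)
    (h₀ : ∀ j k, j ≠ k → fderiv ℂ τ y₀ (unitComponent (prodAlg alg).unit k y₀) j = 0) :
    ∃ ψ : ∀ k, OpenPartialHomeomorph (Fin (m k) → ℂ) (Fin (m' k) → ℂ),
      (∀ k, y₀ k ∈ (ψ k).source ∧ (alg k).IsFIso (alg' k) (ψ k)) ∧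
      ∀ᶠ z in 𝓝 y₀, ∀ k, τ z k = ψ k (z k) := by
  have hτ : ContDiffOn ℂ ω τ τ.source := contMDiffOn_iff_contDiffOn.1 h.hol
  obtain ⟨r, hr, hball⟩ := Metric.eventually_nhds_iff_ball.1
    ((h.eventually_fderiv_single H H' hy₀ h₀).and (τ.open_source.mem_nhds hy₀))
  set O := Metric.ball y₀ r with hO
  have hyO : y₀ ∈ O := Metric.mem_ball_self hr
  have hd : ∀ z ∈ O, HasFDerivAt τ (fderiv ℂ τ z) z := fun z hz =>
    ((hτ.contDiffAt (τ.open_source.mem_nhds (hball z hz).2)).differentiableAt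
      (by simp)).hasFDerivAt
  have hsingle : ∀ z ∈ O, ∀ k (c : Fin (m k) → ℂ),
      fderiv ℂ τ z (Pi.single k c) = Pi.single k (fderiv ℂ τ z (Pi.single k c) k) :=
    fun z hz k c => by
      have := (hball z hz).1 k (Pi.single k c)
      rwa [Pi.single_eq_same] at this
  have hup : ∀ k, ∀ y ∈ Metric.ball (y₀ k) r, Function.update y₀ k y ∈ O := fun k y hy =>
    update_mem_ball hyO hy
  -- Block diagonality on a convex ball means that the k-th component of τ depends on the k-th
  -- coordinate alone, so it can be read off on the slice through y₀.
  let g : ∀ k, (Fin (m k) → ℂ) → Fin (m' k) → ℂ := fun k y => τ (Function.update y₀ k y) k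
  have hg : ∀ k, ContDiffOn ℂ ω (g k) (Metric.ball (y₀ k) r) := fun k =>
    (ContinuousLinearMap.proj (R := ℂ) (φ := fun k => Fin (m' k) → ℂ) k).contDiff.comp_contDiffOn
      (hτ.comp (contDiff_update ω y₀ k).contDiffOn fun y hy => (hball _ (hup k y hy)).2)
  have hτg : ∀ z ∈ O, ∀ k, τ z k = g k (z k) := fun z hz k => by
    refine eq_of_fderiv_single_eq_zero (V := fun k => Fin (m k) → ℂ) (g := fun w => τ w k) (k := k)
      (convex_ball y₀ r) (fun x hx => ?_) (fun x hx j hj c => ?_) (hup k _ (apply_mem_ball hz k)) hz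
      (by rw [Function.update_self])
    · exact differentiableAt_pi.1 (hd x hx).differentiableAt k
    · rw [(hasFDerivAt_pi'.1 (hd x hx) k).fderiv]
      change fderiv ℂ τ x (Pi.single j c) k = 0
      rw [hsingle x hx, Pi.single_eq_of_ne hj.symm]
  have hgd : ∀ k, ∀ y ∈ Metric.ball (y₀ k) r, ∃ L : (Fin (m k) → ℂ) ≃L[ℂ] (Fin (m' k) → ℂ),
      HasFDerivAt (g k) (L : (Fin (m k) → ℂ) →L[ℂ] (Fin (m' k) → ℂ)) y ∧
      ∀ c, L c = fderiv ℂ τ (Function.update y₀ k y) (Pi.single k c) k := by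
    intro k y hy
    have hz := hup k y hy
    set z := Function.update y₀ k y with hzdef
    let f : (Fin (m k) → ℂ) →L[ℂ] (Fin (m' k) → ℂ) :=
      (ContinuousLinearMap.proj (R := ℂ) (φ := fun k => Fin (m' k) → ℂ) k ∘L fderiv ℂ τ z) ∘L
        ContinuousLinearMap.single ℂ (fun k => Fin (m k) → ℂ) k
    have hf : ∀ c, f c = fderiv ℂ τ z (Pi.single k c) k := fun c => rfl
    have hbij := h.mdiff.mfderiv_bijective (hball z hz).2
    rw [mfderiv_eq_fderiv] at hbij
    -- The diagonal blocks of an invertible block-diagonal map are invertible.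
    have hfb : Function.Bijective f := by
      refine ⟨(injective_iff_map_eq_zero f).2 fun c hc => ?_, fun c => ?_⟩
      · have h1 := hsingle z hz k c
        rw [← hf, hc, Pi.single_zero] at h1
        have h2 : (Pi.single k c : ∀ k, Fin (m k) → ℂ) = 0 := hbij.1 (h1.trans (map_zero _).symm)
        simpa using congrFun h2 k
      · obtain ⟨a, ha⟩ := hbij.2 (Pi.single k c : ∀ k, Fin (m' k) → ℂ)
        have ha' : fderiv ℂ τ z a = (Pi.single k c : ∀ k, Fin (m' k) → ℂ) := ha
        refine ⟨(a : ∀ k, Fin (m k) → ℂ) k, ?_⟩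
        rw [hf, (hball z hz).1 k a, ha', Pi.single_eq_same, Pi.single_eq_same]
    have hfd : HasFDerivAt (g k) f y :=
      (ContinuousLinearMap.proj (R := ℂ) (φ := fun k => Fin (m' k) → ℂ) k).hasFDerivAt.comp y
        (HasFDerivAt.comp (g := τ) y (hd z hz) (hasFDerivAt_update_single y₀ k y))
    let L : (Fin (m k) → ℂ) ≃L[ℂ] (Fin (m' k) → ℂ) :=
      (LinearEquiv.ofBijective (f : (Fin (m k) → ℂ) →ₗ[ℂ] (Fin (m' k) → ℂ))
        hfb).toContinuousLinearEquiv
    exact ⟨L, hfd.congr_fderiv (ContinuousLinearMap.ext fun _ => rfl), hf⟩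
  choose L hL hLf using hgd
  choose ψ hψ0 hψg hψO hψ hψ' using fun k =>
    ((hg k).contDiffAt (Metric.ball_mem_nhds _ hr)).exists_openPartialHomeomorph
      (hL k _ (Metric.mem_ball_self hr)) (Metric.ball_mem_nhds (y₀ k) hr)
  have hψd : ∀ k, ∀ y ∈ (ψ k).source, ∀ c : Fin (m k) → ℂ,
      mfderiv 𝓘(ℂ, Fin (m k) → ℂ) 𝓘(ℂ, Fin (m' k) → ℂ) (ψ k) y c
        = fderiv ℂ τ (Function.update y₀ k y) (Pi.single k c) k := fun k y hy c => by
    have h1 := (hL k y (hψO k hy)).fderiv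
    rw [← hψg k, ← mfderiv_eq_fderiv] at h1
    rw [← hLf k y (hψO k hy)]
    exact DFunLike.congr_fun h1 c
  have hsm : ∀ z ∈ O, ∀ k (a b : Fin (m k) → ℂ),
      (Pi.single k ((alg k).cmul (z k) a b) : ∀ k, Fin (m k) → ℂ)
        = (prodAlg alg).cmul z (Pi.single k a) (Pi.single k b) := fun z hz k a b => by
    have := H.mul_single_single (isSplit_prodAlg _) (hball z hz).2 k
      (Pi.single k a) (Pi.single k b)
    rw [prodAlg_cmul_apply, Pi.single_eq_same, Pi.single_eq_same] at this
    exact this.symm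
  refine ⟨ψ, fun k => ⟨hψ0 k, contMDiffOn_iff_contDiffOn.2 (hψ k),
    contMDiffOn_iff_contDiffOn.2 (hψ' k), fun y hy a b => ?_, fun y hy => ?_⟩, ?_⟩
  · obtain ⟨z, hz, rfl, hzd⟩ : ∃ z ∈ O, z k = y ∧ z = Function.update y₀ k y :=
      ⟨_, hup k y (hψO k hy), Function.update_self .., rfl⟩
    refine (hψd k _ hy _).trans ((?_ : _ = (alg' k).cmul (ψ k (z k)) _ _).trans
      (congrArg₂ (fun v w => (alg' k).cmul (ψ k (z k)) v w) (hψd k _ hy a) (hψd k _ hy b)).symm)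
    rw [← hzd]
    refine (congrArg (fun w => fderiv ℂ τ z w k) (hsm z hz k a b)).trans
      ((congrFun (h.fderiv_mul (hball z hz).2 _ _) k).trans ?_)
    rw [prodAlg_cmul_apply, hτg z hz, hψg]
  · obtain ⟨z, hz, rfl, hzd⟩ : ∃ z ∈ O, z k = y ∧ z = Function.update y₀ k y :=
      ⟨_, hup k y (hψO k hy), Function.update_self .., rfl⟩
    refine (hψd k _ hy _).trans ?_
    rw [← hzd]
    refine (congrFun ((hball z hz).1 k ((prodAlg alg).unit z)) k).trans
      ((Pi.single_eq_same _ _).trans ((congrFun (h.fderiv_unit (hball z hz).2) k).trans ?_))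
    rw [prodAlg_unit_apply, hτg z hz, hψg]
  · filter_upwards [Metric.ball_mem_nhds y₀ hr] with z hz k
    rw [hψg, hτg z hz]

end Uniqueness

/-! ### Uniqueness of the decomposition and splitting of Euler fields. -/

section Theorem

variable {E : Type*} [NormedAddCommGroup E] [NormedSpace ℂ E] [FiniteDimensional ℂ E]
  {M : Type*} [TopologicalSpace M] [ChartedSpace E M] [IsManifold 𝓘(ℂ, E) ω M]
  {A : TangentAlg E M} {p : M}

namespace FDecomp

/-- Both decompositions see ε_k only in their k-th factor, so at the image of p the transition map
sends the k-th unit component into the k-th factor. This condition at one point already makes it a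
product of isomorphisms near that point. -/
theorem Extends.same (hA : A.IsFGerm p) {D D' : FDecomp A p (A.Weight p)} (hD : D.Extends)
    (hD' : D'.Extends) : D.Same D' := by
  classical
  have : CompleteSpace E := FiniteDimensional.complete ℂ E
  obtain ⟨U, hpU, hU⟩ := hA
  obtain ⟨ε, hsum, hort, hne, hε⟩ := A.exists_idempotents p
  have hεk : ∀ k, ε k ∈ A.eigenspace p k := fun k =>
    (hε k _).2 (A.idempotents_mul_self hort hsum k)
  let φ := D.chart.restrOpen U hU.isOpen
  let φ' := D'.chart.restrOpen U hU.isOpen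
  have hφ : A.IsFIso (prodAlg D.alg) φ := D.isFIso.restrOpen hU.isOpen
  have hφ' : A.IsFIso (prodAlg D'.alg) φ' := D'.isFIso.restrOpen hU.isOpen
  have hpφ : p ∈ φ.source := ⟨D.mem_source, hpU⟩
  have hpφ' : p ∈ φ'.source := ⟨D'.mem_source, hpU⟩
  let τ := φ.symm.trans φ'
  have hτ : (prodAlg D.alg).IsFIso (prodAlg D'.alg) τ := hφ.symm.trans hφ'
  have H : IsFStructure (prodAlg D.alg).cmul (prodAlg D.alg).unit τ.source :=
    (hφ.isFStructure hU fun x hx => hx.2).mono τ.open_source fun y hy => by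
      rw [φ.symm.trans_source] at hy
      exact hy.1
  have H' : IsFStructure (prodAlg D'.alg).cmul (prodAlg D'.alg).unit τ.target :=
    (hφ'.isFStructure hU fun x hx => hx.2).mono τ.open_target fun y hy => by
      rw [φ.symm.trans_target] at hy
      exact hy.1
  have hpτ : φ p ∈ τ.source := by
    rw [φ.symm.trans_source]
    refine ⟨φ.map_source hpφ, ?_⟩
    rw [Set.mem_preimage, φ.left_inv hpφ]
    exact hpφ'
  have hτφ : ∀ x ∈ φ.source, τ (φ x) = φ' x := fun x hx => congrArg φ' (φ.left_inv hx)
  have h₀ : ∀ j k, j ≠ k →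
      fderiv ℂ τ (φ p) (unitComponent (prodAlg D.alg).unit k (φ p)) j = 0 := by
    intro j k hjk
    have h1 : unitComponent (prodAlg D.alg).unit k (φ p)
        = mfderiv 𝓘(ℂ, E) 𝓘(ℂ, ∀ k, Fin (D.dim k) → ℂ) φ p (ε k) := by
      funext i
      obtain rfl | hi := eq_or_ne i k
      · exact (unitComponent_same (V := fun k => Fin (D.dim k) → ℂ) _ i _).trans
          (hD.comp_idempotent hεk hsum i).symm
      · exact (unitComponent_of_ne (V := fun k => Fin (D.dim k) → ℂ) _ hi _).trans
          (hD.comp_idempotent_of_ne hεk hi).symm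
    have h2 : mfderiv 𝓘(ℂ, E) 𝓘(ℂ, ∀ k, Fin (D'.dim k) → ℂ) (τ ∘ φ) p = _ :=
      mfderiv_comp p (hτ.mdiff.mdifferentiableAt hpτ) (hφ.mdiff.mdifferentiableAt hpφ)
    have h3 : τ ∘ φ =ᶠ[𝓝 p] φ' := by
      filter_upwards [φ.open_source.mem_nhds hpφ] with x hx using hτφ x hx
    have h4 := (DFunLike.congr_fun h2 (ε k)).symm.trans (DFunLike.congr_fun h3.mfderiv_eq (ε k))
    refine (congrArg (fun v => fderiv ℂ τ (φ p) v j) h1).trans ?_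
    rw [← mfderiv_eq_fderiv]
    exact (congrFun h4 j).trans (hD'.comp_idempotent_of_ne hεk hjk)
  obtain ⟨ψ, hψ, hτψ⟩ := hτ.exists_factors H H' hpτ h₀
  have hev : ∀ᶠ x in 𝓝 p, ∀ k, D'.chart x k = ψ k (D.chart x k) := by
    filter_upwards [(φ.continuousAt hpφ).eventually hτψ, φ.open_source.mem_nhds hpφ] with x h1 hx k
    exact (congrFun (hτφ x hx) k).symm.trans (h1 k)
  refine ⟨ψ, fun k => ⟨?_, ?_, (hψ k).2⟩, hev⟩
  · rw [← D.chart_apply]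
    exact (hψ k).1
  · rw [← D.chart_apply, ← D'.chart_apply]
    exact (hev.self_of_nhds k).symm

/-- Euler fields decompose along a decomposition of the germ. -/
theorem exists_euler (hA : A.IsFGerm p) {ι : Type*} [Fintype ι] (D : FDecomp A p ι) {d : ℂ}
    {X : ∀ x : M, TangentSpace 𝓘(ℂ, E) x} (hX : A.IsEulerGerm p d X) :
    ∃ Y : ∀ k, ∀ y : (Fin (D.dim k) → ℂ), TangentSpace 𝓘(ℂ, Fin (D.dim k) → ℂ) y,
      (∀ k, (D.alg k).IsEulerGerm (D.pt k) d (Y k)) ∧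
      ∀ᶠ x in 𝓝 p, ∀ k, D.comp k x (X x) = Y k (D.chart x k) := by
  classical
  have : CompleteSpace E := FiniteDimensional.complete ℂ E
  obtain ⟨U, hpU, hU⟩ := hA
  obtain ⟨O, hO, hpO, hX⟩ := hX
  choose S hS hSF using D.isFGerm
  let φ := D.chart.restrOpen (U ∩ O) (hU.isOpen.inter hO)
  have hφ : A.IsFIso (prodAlg D.alg) φ := D.isFIso.restrOpen (hU.isOpen.inter hO)
  have hpφ : p ∈ φ.source := ⟨D.mem_source, hpU, hpO⟩
  have hφU : φ.source ⊆ U := fun x hx => hx.2.1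
  have hφO : φ.source ⊆ O := fun x hx => hx.2.2
  have H := hφ.isFStructure hU hφU
  let F := ∀ k, Fin (D.dim k) → ℂ
  let X' : F → F := VectorField.mpullback 𝓘(ℂ, F) 𝓘(ℂ, E) φ.symm X
  obtain ⟨hX', hE⟩ : ContDiffOn ℂ ω X' φ.target ∧ ∀ V : Set F, IsOpen V → V ⊆ φ.target →
      ∀ Z W : F → F, ContDiffOn ℂ ω Z V → ContDiffOn ℂ ω W V → ∀ y ∈ V,
      lieDerivMul (prodAlg D.alg).cmul X' Z W y = d • (prodAlg D.alg).cmul y (Z y) (W y) :=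
    hφ.euler hU hφU ⟨hX.hol.mono hφO, fun V hV hVφ => hX.lie_mul V hV (hVφ.trans hφO)⟩
  set y₀ : F := φ p with hy₀
  have hpt : y₀ = D.pt := D.chart_apply
  have hnhds : ∀ᶠ z in 𝓝 y₀, z ∈ φ.target ∧ ∀ k, z k ∈ S k := by
    refine Filter.Eventually.and (φ.open_target.mem_nhds (φ.map_source hpφ))
      (Filter.eventually_all.2 fun k => ?_)
    refine (continuous_apply k).continuousAt.eventually_mem ((hSF k).isOpen.mem_nhds ?_)
    rw [hpt]
    exact hS k
  obtain ⟨r, hr, hball⟩ := Metric.eventually_nhds_iff_ball.1 hnhds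
  have hy₀r : y₀ ∈ Metric.ball y₀ r := Metric.mem_ball_self hr
  -- Restriction to the slice through y₀ loses nothing near y₀, since the k-th component of an Euler
  -- field is independent of the other coordinates.
  let Y : ∀ k, (Fin (D.dim k) → ℂ) → Fin (D.dim k) → ℂ := fun k y => X' (Function.update y₀ k y) k
  have hup : ∀ k, ∀ y ∈ Metric.ball (y₀ k) r, Function.update y₀ k y ∈ Metric.ball y₀ r :=
    fun k y hy => update_mem_ball hy₀r hy
  have hY : ∀ k, ContDiffOn ℂ ω (Y k) (Metric.ball (y₀ k) r) := fun k =>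
    (ContinuousLinearMap.proj (R := ℂ) (φ := fun k => Fin (D.dim k) → ℂ) k).contDiff.comp_contDiffOn
      (hX'.comp (contDiff_update ω y₀ k).contDiffOn fun y hy => (hball _ (hup k y hy)).1)
  have hX'd : ∀ z ∈ Metric.ball y₀ r, DifferentiableAt ℂ X' z := fun z hz =>
    (hX'.contDiffAt (φ.open_target.mem_nhds (hball z hz).1)).differentiableAt (by simp)
  have hXY : ∀ z ∈ Metric.ball y₀ r, ∀ k, X' z k = Y k (z k) := fun z hz k => by
    refine eq_of_fderiv_single_eq_zero (V := fun k => Fin (D.dim k) → ℂ) (g := fun w => X' w k)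
      (k := k) (convex_ball y₀ r) (fun x hx => differentiableAt_pi.1 (hX'd x hx) k)
      (fun x hx j hj c => H.fderiv_euler_single (isSplit_prodAlg _) hX'
        (hE _ φ.open_target subset_rfl) (hball x hx).1 hj c) (hup k _ (apply_mem_ball hz k)) hz
      (by rw [Function.update_self])
  refine ⟨Y, fun k => ⟨Metric.ball (y₀ k) r, Metric.isOpen_ball, ?_, ?_, ?_⟩, ?_⟩
  · rw [hpt]
    exact Metric.mem_ball_self hr
  · exact holField_iff_contDiffOn.2 (hY k)
  · intro V hV hVr Z W hZ hW y hy
    have hZ' := holField_iff_contDiffOn.1 hZ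
    have hW' := holField_iff_contDiffOn.1 hW
    refine ((D.alg k).lieMul_eq_lieDerivMul (Y k) Z W y).trans ?_
    obtain ⟨z, hz, rfl⟩ : ∃ z ∈ Metric.ball y₀ r, z k = y :=
      ⟨_, hup k y (hVr hy), Function.update_self ..⟩
    let O' : Set F := Metric.ball y₀ r ∩ (fun w => w k) ⁻¹' V
    have hO' : IsOpen O' := Metric.isOpen_ball.inter (hV.preimage (continuous_apply k))
    let lift : ((Fin (D.dim k) → ℂ) → Fin (D.dim k) → ℂ) → F → F := fun Z w => Pi.single k (Z (w k))
    have hlift : ∀ {Z : (Fin (D.dim k) → ℂ) → Fin (D.dim k) → ℂ}, ContDiffOn ℂ ω Z V →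
        ContDiffOn ℂ ω (lift Z) O' := fun {Z} hZ =>
      (ContinuousLinearMap.single ℂ (fun k => Fin (D.dim k) → ℂ) k).contDiff.comp_contDiffOn
        (hZ.comp (ContinuousLinearMap.proj (R := ℂ) (φ := fun k => Fin (D.dim k) → ℂ)
          k).contDiff.contDiffOn fun w hw => hw.2)
    have hliftk : ∀ (Z : (Fin (D.dim k) → ℂ) → Fin (D.dim k) → ℂ) w, lift Z w k = Z (w k) :=
      fun Z w => Pi.single_eq_same _ _
    have hd' : ∀ {Z : (Fin (D.dim k) → ℂ) → Fin (D.dim k) → ℂ}, ContDiffOn ℂ ω Z V →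
        DifferentiableAt ℂ Z (z k) := fun hX =>
      (hX.contDiffAt (hV.mem_nhds hy)).differentiableAt (by simp)
    have hd : ∀ {Z : F → F}, ContDiffOn ℂ ω Z O' → DifferentiableAt ℂ Z z :=
      fun hX => (hX.contDiffAt (hO'.mem_nhds ⟨hz, hy⟩)).differentiableAt (by simp)
    -- The Euler condition on the factor is the k-th component of the condition on the product,
    -- evaluated on lifted fields.
    have h1 := congrFun (hE O' hO' (fun w hw => (hball w hw.1).1) (lift Z) (lift W)
      (hlift hZ') (hlift hW') z ⟨hz, hy⟩) k
    rw [lieDerivMul_apply_of_comp (μ := (D.alg k).cmul) (X' := Y k) (Z' := Z) (W' := W)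
      ((H.hol_mul.contDiffAt (H.isOpen.mem_nhds (hball z hz).1)).differentiableAt (by simp))
      (((hSF k).isFStructure.hol_mul.contDiffAt
        ((hSF k).isOpen.mem_nhds ((hball z hz).2 k))).differentiableAt (by simp))
      (.of_forall fun w a b => rfl) (hX'd z hz) (hd (hlift hZ')) (hd (hlift hW'))
      (((hY k).contDiffAt (Metric.isOpen_ball.mem_nhds (hVr hy))).differentiableAt (by simp))
      (hd' hZ') (hd' hW')
      (by filter_upwards [Metric.isOpen_ball.mem_nhds hz] with w hw using hXY w hw k)
      (.of_forall (hliftk Z)) (.of_forall (hliftk W))] at h1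
    exact h1.trans (congrArg (fun v => d • v)
      (congrArg₂ (fun v w => (D.alg k).cmul (z k) v w) (hliftk Z z) (hliftk W z)))
  · filter_upwards [φ.open_source.mem_nhds hpφ,
      (φ.continuousAt hpφ).eventually_mem (Metric.ball_mem_nhds _ hr)] with x hx hxr k
    refine Eq.trans ?_ (hXY (φ x) hxr k)
    have h1 := congrArg (mfderiv 𝓘(ℂ, E) 𝓘(ℂ, F) φ x) (hφ.mpullback_mpullback_symm X hx)
    rw [hφ.mfderiv_mpullback hx] at h1
    exact (congrFun h1 k).symm

end FDecomp

end Theorem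

/-! ### Canonical coordinates. -/

section Semisimple

/-- A one-dimensional F-manifold has a local coordinate in which it is the standard one. -/
theorem TangentAlg.IsFGerm.exists_coordinate {m : ℕ} (hm : m = 1) {alg : CoordAlg m}
    {q : Fin m → ℂ} (h : alg.IsFGerm q) :
    ∃ g : (Fin m → ℂ) → ℂ, ∀ᶠ y in 𝓝 q, ContDiffAt ℂ ω g y ∧
      (∀ a b, fderiv ℂ g y (alg.cmul y a b) = fderiv ℂ g y a * fderiv ℂ g y b) ∧
      fderiv ℂ g y (alg.unit y : Fin m → ℂ) = 1 ∧ ∀ a, fderiv ℂ g y a = 0 → a = 0 := by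
  subst hm
  obtain ⟨U, hq, hU⟩ := h
  let c : ℂ → Fin 1 → ℂ := fun t _ => t
  have hc : ContDiff ℂ ω c := contDiff_pi.2 fun _ => contDiff_id
  have hcy : ∀ y : Fin 1 → ℂ, c (y 0) = y := fun y => funext fun i => by rw [Subsingleton.elim i 0]
  let unit : (Fin 1 → ℂ) → Fin 1 → ℂ := alg.unit
  have hum : ∀ y a, alg.cmul y (unit y) a = a := alg.unit_mul
  let w : ℂ → ℂ := fun t => unit (c t) 0
  have hwy : ∀ y : Fin 1 → ℂ, w (y 0) = unit y 0 := fun y => by simp only [w, hcy]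
  have hw0 : ∀ t, w t ≠ 0 := fun t ht => by
    have h0 : unit (c t) = 0 := funext fun i => by rw [Subsingleton.elim i 0]; exact ht
    have h1 := hum (c t) 1
    rw [h0, map_zero, zero_apply] at h1
    exact zero_ne_one (congrFun h1 0)
  obtain ⟨r, hr, hrU⟩ := Metric.isOpen_iff.1 (hU.isOpen.preimage hc.continuous) (q 0) (by
    rw [Set.mem_preimage, hcy]
    exact hq)
  have hw : ContDiffOn ℂ ω w (Metric.ball (q 0) r) :=
    (ContinuousLinearMap.proj (R := ℂ) (φ := fun _ : Fin 1 => ℂ) 0).contDiff.comp_contDiffOn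
      (hU.isFStructure.hol_unit.comp hc.contDiffOn hrU)
  have hwi : DifferentiableOn ℂ (fun t => (w t)⁻¹) (Metric.ball (q 0) r) :=
    (hw.differentiableOn (by simp)).inv fun t _ => hw0 t
  -- A primitive g of 1/w on a disc has dg(unit) = 1. Every vector is a multiple of the unit, so
  -- this also makes dg multiplicative.
  obtain ⟨g, hg⟩ := hwi.isExactOn_ball
  have hg' : ContDiffOn ℂ ω g (Metric.ball (q 0) r) :=
    DifferentiableOn.contDiffOn (fun t ht => (hg t ht).differentiableAt.differentiableWithinAt)
      Metric.isOpen_ball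
  refine ⟨fun y => g (y 0), ?_⟩
  filter_upwards [(continuous_apply (0 : Fin 1)).continuousAt.eventually_mem
    (Metric.ball_mem_nhds (q 0) hr)] with y hy
  have hd : ∀ a, fderiv ℂ (fun y : Fin 1 → ℂ => g (y 0)) y a = (w (y 0))⁻¹ * a 0 := fun a => by
    have h1 : HasFDerivAt (fun y : Fin 1 → ℂ => g (y 0)) _ y :=
      (hg _ hy).comp_hasFDerivAt (f := fun y : Fin 1 → ℂ => y 0) y
        (ContinuousLinearMap.proj (R := ℂ) (φ := fun _ : Fin 1 => ℂ) 0).hasFDerivAt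
    rw [h1.fderiv]
    rfl
  have hw0' : unit y 0 ≠ 0 := by
    rw [← hwy]
    exact hw0 _
  refine ⟨?_, fun a b => ?_, ?_, fun a ha => ?_⟩
  · exact ContDiffAt.comp (g := g) y (hg'.contDiffAt (Metric.isOpen_ball.mem_nhds hy))
      (ContinuousLinearMap.proj (R := ℂ) (φ := fun _ : Fin 1 => ℂ) 0).contDiff.contDiffAt
  · have ha : a = (a 0 / unit y 0) • unit y := funext fun i => by
      rw [Subsingleton.elim i 0, Pi.smul_apply, smul_eq_mul, div_mul_cancel₀ _ hw0']
    have h1 : alg.cmul y a b = (a 0 / unit y 0) • b := by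
      conv_lhs => rw [ha]
      rw [map_smul, smul_apply, hum]
    rw [h1, hd, hd, hd, hwy, Pi.smul_apply, smul_eq_mul]
    ring
  · refine (hd (unit y)).trans ?_
    rw [hwy, inv_mul_cancel₀ hw0']
  · rw [hd] at ha
    funext i
    rw [Subsingleton.elim i 0]
    exact (mul_eq_zero.1 ha).resolve_left (inv_ne_zero (hw0 _))

/-- A product of one-dimensional germs of F-manifolds has canonical coordinates. -/
theorem exists_canonical_coordinates {ι : Type*} [Fintype ι] {m : ι → ℕ} (hm : ∀ k, m k = 1)
    {alg : ∀ k, CoordAlg (m k)} {q : ∀ k, Fin (m k) → ℂ} (h : ∀ k, (alg k).IsFGerm (q k)) {n : ℕ}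
    (hn : Fintype.card ι = n) :
    ∃ ψ : OpenPartialHomeomorph (∀ k, Fin (m k) → ℂ) (Fin n → ℂ),
      q ∈ ψ.source ∧ (prodAlg alg).IsFIso (canonicalAlg n) ψ := by
  classical
  let e : ι ≃ Fin n := Fintype.equivFinOfCardEq hn
  choose g hg using fun k => (h k).exists_coordinate (hm k)
  let v : (∀ k, Fin (m k) → ℂ) → Fin n → ℂ := fun z i => g (e.symm i) (z (e.symm i))
  have hs : ∀ᶠ z in 𝓝 q, ∀ k, _ := Filter.eventually_all.2 fun k =>
    ((continuous_apply k).continuousAt (x := q)).eventually (hg k)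
  have hvd : ∀ z : (∀ k, Fin (m k) → ℂ), (∀ k, ContDiffAt ℂ ω (g k) (z k)) → ContDiffAt ℂ ω v z ∧
      ∀ a i, fderiv ℂ v z a i = fderiv ℂ (g (e.symm i)) (z (e.symm i)) (a (e.symm i)) := by
    intro z hz
    refine ⟨contDiffAt_pi.2 fun i => ContDiffAt.comp (g := g (e.symm i)) z (hz _)
      (ContinuousLinearMap.proj (R := ℂ) (φ := fun k => Fin (m k) → ℂ) _).contDiff.contDiffAt,
      fun a i => ?_⟩
    have h1 : HasFDerivAt v (ContinuousLinearMap.pi fun i =>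
        fderiv ℂ (g (e.symm i)) (z (e.symm i)) ∘L
          ContinuousLinearMap.proj (R := ℂ) (φ := fun k => Fin (m k) → ℂ) (e.symm i)) z :=
      hasFDerivAt_pi.2 fun i => HasFDerivAt.comp (g := g (e.symm i)) z
        ((hz _).differentiableAt (by simp)).hasFDerivAt
        (ContinuousLinearMap.proj (R := ℂ) (φ := fun k => Fin (m k) → ℂ) (e.symm i)).hasFDerivAt
    rw [h1.fderiv]
    rfl
  have hq := hs.self_of_nhds
  obtain ⟨hv, hdv⟩ := hvd q fun k => (hq k).1
  -- Each coordinate has injective derivative on its factor; source and target both have dimension n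
  -- because all factors are one-dimensional, so v is a local chart.
  have hinj : Function.Injective (fderiv ℂ v q) :=
    (injective_iff_map_eq_zero _).2 fun a ha => funext fun k => by
      refine (hq k).2.2.2 _ ?_
      have h1 := hdv a (e k)
      rw [ha, e.symm_apply_apply] at h1
      exact h1.symm
  have hrank : Module.finrank ℂ (∀ k, Fin (m k) → ℂ) = Module.finrank ℂ (Fin n → ℂ) := by
    rw [Module.finrank_pi_fintype]
    simp [hm, hn]
  let L : (∀ k, Fin (m k) → ℂ) ≃L[ℂ] (Fin n → ℂ) :=
    (LinearEquiv.ofInjectiveOfFinrankEq (fderiv ℂ v q : _ →ₗ[ℂ] _) hinj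
      hrank).toContinuousLinearEquiv
  obtain ⟨ψ, hqψ, hψv, hψs, hψ, hψ'⟩ := hv.exists_openPartialHomeomorph (f' := L)
    ((hv.differentiableAt (by simp)).hasFDerivAt.congr_fderiv
      (ContinuousLinearMap.ext fun _ => rfl)) hs
  have hd : ∀ z ∈ ψ.source, ∀ a : (∀ k, Fin (m k) → ℂ), ∀ i,
      (mfderiv 𝓘(ℂ, ∀ k, Fin (m k) → ℂ) 𝓘(ℂ, Fin n → ℂ) ψ z a : Fin n → ℂ) i
        = fderiv ℂ (g (e.symm i)) (z (e.symm i)) (a (e.symm i)) := fun z hz a i => by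
    rw [mfderiv_eq_fderiv, hψv]
    exact (hvd z fun k => (hψs hz k).1).2 a i
  refine ⟨ψ, hqψ, contMDiffOn_iff_contDiffOn.2 hψ, contMDiffOn_iff_contDiffOn.2 hψ',
    fun z hz a b => funext fun i => ?_, fun z hz => funext fun i => ?_⟩
  · refine (hd z hz _ i).trans (((hψs hz (e.symm i)).2.1 _ _).trans ?_)
    exact (congrArg₂ (· * ·) (hd z hz a i) (hd z hz b i)).symm
  · exact (hd z hz _ i).trans (hψs hz (e.symm i)).2.2.1

variable {E : Type*} [NormedAddCommGroup E] [NormedSpace ℂ E]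
  {M : Type*} [TopologicalSpace M] [ChartedSpace E M] {A : TangentAlg E M} {p : M}

namespace FDecomp

theorem sum_dim {ι : Type*} [Fintype ι] (D : FDecomp A p ι) :
    ∑ k, D.dim k = Module.finrank ℂ E := by
  have h := (D.isFIso.mdiff.mfderiv D.mem_source).toLinearEquiv.finrank_eq
  change Module.finrank ℂ E = Module.finrank ℂ (∀ k, Fin (D.dim k) → ℂ) at h
  rw [h, Module.finrank_pi_fintype]
  simp

/-- The eigenspace consists of the vectors with no component in the other factors, so projection to
the k-th factor is bijective on it. -/
theorem Extends.finrank_eigenspace [FiniteDimensional ℂ E] {D : FDecomp A p (A.Weight p)}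
    (hD : D.Extends) (k : A.Weight p) : Module.finrank ℂ (A.eigenspace p k) = D.dim k := by
  classical
  have hp := D.mem_source
  have hbij : Function.Bijective ((D.compₗ k p).domRestrict (A.eigenspace p k)) := by
    refine ⟨(injective_iff_map_eq_zero _).2 fun a ha => Subtype.ext (D.ext_comp hp fun j => ?_),
      fun c => ?_⟩
    · refine Eq.trans ?_ (map_zero _).symm
      obtain rfl | hj := eq_or_ne j k
      exacts [ha, (hD k a).1 a.2 j hj]
    · obtain ⟨a, ha, ha'⟩ := D.exists_single hp k c
      exact ⟨⟨a, (hD k a).2 ha'⟩, ha⟩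
  refine (LinearEquiv.ofBijective _ hbij).finrank_eq.trans ?_
  exact Module.finrank_fin_fun ℂ

end FDecomp

end Semisimple

/-! ### Assembly of the theorem. -/

theorem theorem4p2 {E : Type*} [NormedAddCommGroup E] [NormedSpace ℂ E] [FiniteDimensional ℂ E]
    {M : Type*} [TopologicalSpace M] [ChartedSpace E M] [IsManifold 𝓘(ℂ, E) ω M]
    (A : TangentAlg E M) (p : M) (hA : A.IsFGerm p) :
    (∃ D : FDecomp A p (A.Weight p),
      D.Extends ∧
      (∀ D' : FDecomp A p (A.Weight p), D'.Extends → D.Same D') ∧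
      (∀ k, (D.alg k).IsIrreducibleGerm (D.pt k) ∧
        (D.alg k).IsIrreducibleAt (D.pt k) ∧ (D.alg k).IsLocalAt (D.pt k)) ∧
      (∀ (d : ℂ) (X : ∀ x : M, TangentSpace 𝓘(ℂ, E) x), A.IsEulerGerm p d X →
        ∃ Y : ∀ k, ∀ y : (Fin (D.dim k) → ℂ), TangentSpace 𝓘(ℂ, Fin (D.dim k) → ℂ) y,
          (∀ k, (D.alg k).IsEulerGerm (D.pt k) d (Y k)) ∧
          ∀ᶠ x in 𝓝 p, ∀ k, D.comp k x (X x) = Y k (D.chart x k))) ∧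
    (A.IsSemisimpleAt p →
      ∃ u : OpenPartialHomeomorph M (Fin (Module.finrank ℂ E) → ℂ),
        p ∈ u.source ∧ A.IsFIso (canonicalAlg (Module.finrank ℂ E)) u) := by
  obtain ⟨D, hD⟩ := FDecomp.exists_extends hA
  refine ⟨⟨D, hD, fun D' hD' => hD.same hA hD', fun k => ?_, fun d X hX => D.exists_euler hA hX⟩,
    fun hs => ?_⟩
  · have hloc := hD.isLocalAt k
    have hirr := hloc.isIrreducibleAt
    exact ⟨⟨D.isFGerm k, FDecomp.isEmpty_of_isIrreducibleAt hirr⟩, hirr, hloc⟩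
  · have hdim : ∀ k, D.dim k = 1 := fun k => (hD.finrank_eigenspace k).symm.trans (hs k)
    have hcard : Fintype.card (A.Weight p) = Module.finrank ℂ E := by
      simp [← D.sum_dim, hdim]
    obtain ⟨ψ, hψ, hψ'⟩ := exists_canonical_coordinates hdim D.isFGerm hcard
    refine ⟨D.chart.trans ψ, ?_, D.isFIso.trans hψ'⟩
    rw [D.chart.trans_source]
    refine ⟨D.mem_source, ?_⟩
    rw [Set.mem_preimage, D.chart_apply]
    exact hψ
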